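/- **Setting.** Fix $T>0$. $D[0,T]$ is the space of real càdlàg paths on $[0,T]$ (with $x(0-):=x(0)$) and $D(x)=\{t: x(t)\ne x(t-)\}$. $D^\circ[0,T]=C[0,\infty)\times D^\uparrow[0,T]$, where $C[0,\infty)$ carries locally uniform convergence and $D^\uparrow[0,T]$, the set of non-negative non-decreasing càdlàg paths, carries Skorokhod's $M_1$ topology. The decorated Skorokhod space $\mathfrak D[0,T]$ consists of pairs $(x,I)$ with $x\in D[0,T]$ and $I=(I_t)_{t\in[0,T]}$ compact subsets of $\mathbb R$ such that $x(t-),x(t)\in I_t$, $d_{\mathrm H}(I_s,\{x(t)\})\to0$ as $s\downarrow t$ and $d_{\mathrm H}(I_s,\{x(t-)\})\to0$ as $s\uparrow t$ ($d_{\mathrm H}$ the Hausdorff distance); the distance of $(x,I)$ and $(x',I')$ is the Hausdorff distance of the graphs $\{(t,z):z\in I_t\}$, $\{(t,z):z\in I'_t\}$ in $[0,T]\times\mathbb R$ with the maximum metric. A path $x\in D[0,T]$ is identified with $(x,(\{x(t-),x(t)\})_t)$. A *weak solution* on $[0,T]$ for the input $(G_0,K,f,\lambda,\nu)$ is a filtered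 probability space $(\Omega,\mathcal F,(\mathcal G_t)_{t\ge0},\mathbb P)$ with a $(\mathcal G_t)$-Brownian motion $W$ and a non-decreasing continuous process $(X_t)_{t\le T}$, $X_0=0$, such that each $f(X_t)$ is a $(\mathcal G_s)$-stopping time, $(W_{f(X_t)})_{t\le T}$ is a martingale in its own filtration, and almost surely $$X_t=G_0(t)+\int_0^tK(t-s)\bigl(-\lambda X_s+\nu W_{f(X_s)}\bigr)\,ds,\qquad t\le T.$$ **Theorem.** Let $(W^n,X^n)_{n\ge0}$ be weak solutions on $[0,T]$ for the inputs $(G_0^n,K^n,f^n,\lambda^n,\nu^n)$, where $\lambda^n,\nu^n\ge0$; $f^n\in C^1(\mathbb R_+,\mathbb R_+)$ is non-decreasing with $f^n(0)=0$ and $|(f^n)'(x)|\le c_n(1+x)$ for some $c_n\ge0$; $K^n\in L^1_{loc}(\mathbb R_+,\mathbb R_+)$; and $G^n_0:\mathbb R_+\to\mathbb R_+$ is non-decreasing with $G_0^n(0)=0$. Suppose that * $K^n(t)\,dt\Rightarrow\delta_0(dt)$ weakly on $[0,T]$; * $G_0^n\to G_0$ pointwise on $[0,T]$, where $G_0$ is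 continuous; * $f^n\to f$ locally uniformly on $\mathbb R_+$, and $\sup_n\sup_{x\ge0}f^n(x)/(1+x^2)<\infty$; * $\lambda^n\to\lambda$ and $\nu^n\to\nu$. Let $W^*$ be a standard Brownian motion on some probability space. Put $$F^n(s)=\nu^nW^n_{f^n(s)}-\lambda^ns,\qquad F^*(s)=\nu W^*_{f(s)}-\lambda s,\qquad s\ge0,$$ $$X^*_t=\inf\{s\ge0:\ (1+\lambda)s-\nu W^*_{f(s)}>G_0(t)\},\qquad t\le T.$$ Then, almost surely, the set in the last display is non-empty for all $t\le T$ and $X^*\in D^\uparrow[0,T]$, and $$(F^n,X^n)\Longrightarrow(F^*,X^*)\quad\text{weakly on } D^\circ[0,T].$$ Consequently $\Upsilon^n:=F^n\circ X^n=\nu^nW^n_{f^n(X^n)}-\lambda^nX^n$ satisfies $$\Upsilon^n\Longrightarrow(X^*-G_0,\,I^*)\quad\text{weakly on }\mathfrak D[0,T],$$ where, almost surely, $(X^*-G_0,I^*)\in\mathfrak D[0,T]$, with $I^*_t=F^*([X^*_{t-},X^*_t])$ for $t\in D(X^*)$ and $I^*_t=\{X^*_t-G_0(t)\}$ for $t\notin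 D(X^*)$. -/

import Mathlib

open MeasureTheory ProbabilityTheory Filter Set Topology
open scoped NNReal ENNReal

noncomputable section

namespace VolterraClock

/-! ### Càdlàg paths on `[0, T]` -/

/-- The space `D[0,T]` of real-valued càdlàg paths on `[0, T]`. -/
@[ext]
structure CadlagPath (T : ℝ) where
  toFun : Icc (0 : ℝ) T → ℝ
  right_continuous : ∀ t, ContinuousWithinAt toFun (Ici t) t
  exists_left_limit : ∀ t, ∃ l, Tendsto toFun (𝓝[<] t) (𝓝 l)

namespace CadlagPath

variable {T : ℝ}

instance : CoeFun (CadlagPath T) (fun _ => Icc (0 : ℝ) T → ℝ) := ⟨toFun⟩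

/-- The left limit `x(t-)`, with the convention `x(0-) = x(0)`. -/
def left (x : CadlagPath T) (t : Icc (0 : ℝ) T) : ℝ := Function.leftLim x.toFun t

theorem left_of_eq_bot (x : CadlagPath T) {t : Icc (0 : ℝ) T} (h : 𝓝[<] t = ⊥) :
    x.left t = x t := leftLim_eq_of_eq_bot _ h

theorem tendsto_left (x : CadlagPath T) (t : Icc (0 : ℝ) T) :
    Tendsto x.toFun (𝓝[<] t) (𝓝 (x.left t)) :=
  tendsto_leftLim_of_tendsto (x.exists_left_limit t)

/-- The set `D(x)` of discontinuity times. -/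
def jumpTimes (x : CadlagPath T) : Set (Icc (0 : ℝ) T) := {t | x t ≠ x.left t}

/-- The image of a càdlàg path under a continuous function. -/
def map (g : C(ℝ, ℝ)) (x : CadlagPath T) : CadlagPath T where
  toFun t := g (x t)
  right_continuous t :=
    g.continuous.continuousAt.comp_continuousWithinAt (x.right_continuous t)
  exists_left_limit t := by
    obtain ⟨l, hl⟩ := x.exists_left_limit t
    exact ⟨g l, (g.continuous.tendsto l).comp hl⟩

/-! ### The `M₁` distance -/

/-- The completed graph: the graph of `x` together with the vertical segments
`[x(t-), x(t)]` at the jump times. -/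
def completedGraph (x : CadlagPath T) : Set (Icc (0 : ℝ) T × ℝ) :=
  {p | p.2 ∈ uIcc (x.left p.1) (x p.1)}

/-- The natural order along the completed graph: first by time, and within the segment over a
given time by the distance to the left limit. -/
def GraphLE (x : CadlagPath T) (p q : Icc (0 : ℝ) T × ℝ) : Prop :=
  p.1 < q.1 ∨ (p.1 = q.1 ∧ |p.2 - x.left p.1| ≤ |q.2 - x.left p.1|)

/-- A parametric representation of `x`: a continuous map from `[0,1]` onto the completed graph
that is non-decreasing for the order along the graph. -/
structure IsParamRep (x : CadlagPath T) (γ : C(unitInterval, Icc (0 : ℝ) T × ℝ)) : Prop where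
  range_eq : range γ = x.completedGraph
  monotone : ∀ a b, a ≤ b → x.GraphLE (γ a) (γ b)

/-- Skorokhod's `M₁` distance: the infimum over parametric representations `(r, u)` of `x` and
`(r', u')` of `y` of `‖r - r'‖_∞ ∨ ‖u - u'‖_∞`. -/
def m1EDist (x y : CadlagPath T) : ℝ≥0∞ :=
  ⨅ (γ : C(unitInterval, Icc (0 : ℝ) T × ℝ)) (_ : x.IsParamRep γ)
    (γ' : C(unitInterval, Icc (0 : ℝ) T × ℝ)) (_ : y.IsParamRep γ'), edist γ γ'

end CadlagPath

/-! ### Time changes and the space `D°[0,T]` -/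

/-- The space `D↑[0,T]` of non-negative, non-decreasing càdlàg paths. -/
@[ext]
structure IncPath (T : ℝ) extends CadlagPath T where
  nonneg : ∀ t, 0 ≤ toFun t
  mono : Monotone toFun

namespace IncPath

variable {T : ℝ}

instance : CoeFun (IncPath T) (fun _ => Icc (0 : ℝ) T → ℝ) := ⟨fun x => x.toFun⟩

/-- The value of a non-negative path, as an element of `[0, ∞)`. -/
def val (x : IncPath T) (t : Icc (0 : ℝ) T) : ℝ≥0 := ⟨x t, x.nonneg t⟩

/-- The `M₁` topology on `D↑[0,T]`: the open sets are those which contain an `M₁` ball around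
each of their points. -/
instance : TopologicalSpace (IncPath T) where
  IsOpen U := ∀ x ∈ U, ∃ ε : ℝ≥0∞, 0 < ε ∧
    ∀ y : IncPath T, x.toCadlagPath.m1EDist y.toCadlagPath < ε → y ∈ U
  isOpen_univ := fun _ _ => ⟨1, one_pos, fun _ _ => mem_univ _⟩
  isOpen_inter := by
    rintro U V hU hV x ⟨hxU, hxV⟩
    obtain ⟨a, ha, hA⟩ := hU x hxU
    obtain ⟨b, hb, hB⟩ := hV x hxV
    exact ⟨min a b, lt_min ha hb, fun y hy =>
      ⟨hA y (hy.trans_le (min_le_left _ _)), hB y (hy.trans_le (min_le_right _ _))⟩⟩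
  isOpen_sUnion := by
    rintro S hS x ⟨U, hU, hxU⟩
    obtain ⟨a, ha, hA⟩ := hS U hU x hxU
    exact ⟨a, ha, fun y hy => ⟨U, hU, hA y hy⟩⟩

end IncPath

/-- The space `D°[0,T]` of pairs `(φ, τ)`, `φ ∈ C[0,∞)`, `τ ∈ D↑[0,T]`. -/
def TimeChangedPath (T : ℝ) : Type := C(ℝ≥0, ℝ) × IncPath T

namespace TimeChangedPath

variable {T : ℝ}

/-- The product of the topology of uniform convergence on compacts and the `M₁` topology. -/
instance : TopologicalSpace (TimeChangedPath T) :=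
  inferInstanceAs (TopologicalSpace (C(ℝ≥0, ℝ) × IncPath T))

instance : MeasurableSpace (TimeChangedPath T) := borel _

instance : BorelSpace (TimeChangedPath T) := ⟨rfl⟩

/-- The element `(φ, τ)` of `D°[0,T]`. -/
def mk (φ : C(ℝ≥0, ℝ)) (τ : IncPath T) : TimeChangedPath T := (φ, τ)

/-- The càdlàg path `φ ∘ τ`. -/
def compose (φ : C(ℝ≥0, ℝ)) (τ : IncPath T) : CadlagPath T :=
  τ.toCadlagPath.map ⟨fun r => φ r.toNNReal, φ.continuous.comp continuous_real_toNNReal⟩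

theorem compose_apply (φ : C(ℝ≥0, ℝ)) (τ : IncPath T) (t : Icc (0 : ℝ) T) :
    compose φ τ t = φ (τ.val t) := by
  have h : (τ t).toNNReal = τ.val t := Real.toNNReal_of_nonneg (τ.nonneg t)
  show φ (τ t).toNNReal = _
  rw [h]

end TimeChangedPath

/-! ### Decorated càdlàg paths -/

/-- The decorated Skorokhod space `𝔇[0,T]`. -/
structure DecoratedPath (T : ℝ) where
  base : CadlagPath T
  dec : Icc (0 : ℝ) T → Set ℝ
  isCompact_dec : ∀ t, IsCompact (dec t)
  base_mem : ∀ t, base t ∈ dec t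
  left_mem : ∀ t, base.left t ∈ dec t
  tendsto_right : ∀ t,
    Tendsto (fun s => Metric.hausdorffDist (dec s) {base t}) (𝓝[>] t) (𝓝 0)
  tendsto_left : ∀ t,
    Tendsto (fun s => Metric.hausdorffDist (dec s) {base.left t}) (𝓝[<] t) (𝓝 0)

namespace DecoratedPath

variable {T : ℝ}

/-- The graph of the decorations. -/
def graph (p : DecoratedPath T) : Set (Icc (0 : ℝ) T × ℝ) := {q | q.2 ∈ p.dec q.1}

/-- The Hausdorff distance between the graphs, where `[0,T] × ℝ` carries the maximum metric.
(The graphs are compact, and non-empty for `T ≥ 0`, so this distance is finite.) -/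
instance : PseudoEMetricSpace (DecoratedPath T) where
  edist p q := Metric.hausdorffEDist p.graph q.graph
  edist_self _ := Metric.hausdorffEDist_self
  edist_comm _ _ := Metric.hausdorffEDist_comm
  edist_triangle _ _ _ := Metric.hausdorffEDist_triangle

instance : MeasurableSpace (DecoratedPath T) := borel _

instance : BorelSpace (DecoratedPath T) := ⟨rfl⟩

end DecoratedPath

theorem hausdorffDist_pair_le (a b c : ℝ) :
    Metric.hausdorffDist {a, b} {c} ≤ |a - c| + |b - c| := by
  refine Metric.hausdorffDist_le_of_mem_dist (by positivity) ?_ ?_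
  · rintro x (rfl | rfl)
    · exact ⟨c, rfl, by rw [Real.dist_eq]; linarith [abs_nonneg (b - c)]⟩
    · exact ⟨c, rfl, by rw [Real.dist_eq]; linarith [abs_nonneg (a - c)]⟩
  · rintro x rfl
    exact ⟨a, by simp, by rw [Real.dist_eq, abs_sub_comm]; linarith [abs_nonneg (b - x)]⟩

namespace CadlagPath

variable {T : ℝ}

theorem tendsto_left_nhdsGT (x : CadlagPath T) (t : Icc (0 : ℝ) T) :
    Tendsto x.left (𝓝[>] t) (𝓝 (x t)) := by
  have h : Tendsto x.toFun (𝓝[>] t) (𝓝 (x t)) :=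
    (x.right_continuous t).mono_left (nhdsWithin_mono _ Ioi_subset_Ici_self)
  refine (closed_nhds_basis (x t)).tendsto_right_iff.2 ?_
  rintro s ⟨hs, hsc⟩
  have h1 : ∀ᶠ r in 𝓝[>] t, x r ∈ s := h hs
  filter_upwards [h1, eventually_eventually_nhdsWithin.2 h1, self_mem_nhdsWithin] with r hr hr' hrt
  by_cases hb : 𝓝[<] r = ⊥
  · rw [x.left_of_eq_bot hb]; exact hr
  · have : (𝓝[<] r).NeBot := ⟨hb⟩
    refine hsc.mem_of_tendsto (x.tendsto_left r) ?_
    have : 𝓝[Ioi t] r = 𝓝 r := isOpen_Ioi.nhdsWithin_eq hrt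
    rw [this] at hr'
    exact hr'.filter_mono nhdsWithin_le_nhds

theorem tendsto_left_nhdsLT (x : CadlagPath T) (t : Icc (0 : ℝ) T) :
    Tendsto x.left (𝓝[<] t) (𝓝 (x.left t)) := by
  refine (closed_nhds_basis (x.left t)).tendsto_right_iff.2 ?_
  rintro s ⟨hs, hsc⟩
  have h1 : ∀ᶠ r in 𝓝[<] t, x r ∈ s := x.tendsto_left t hs
  filter_upwards [h1, eventually_eventually_nhdsWithin.2 h1, self_mem_nhdsWithin] with r hr hr' hrt
  by_cases hb : 𝓝[<] r = ⊥
  · rw [x.left_of_eq_bot hb]; exact hr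
  · have : (𝓝[<] r).NeBot := ⟨hb⟩
    refine hsc.mem_of_tendsto (x.tendsto_left r) ?_
    have : 𝓝[Iio t] r = 𝓝 r := isOpen_Iio.nhdsWithin_eq hrt
    rw [this] at hr'
    exact hr'.filter_mono nhdsWithin_le_nhds

theorem tendsto_hausdorffDist_pair {α : Type*} {F : Filter α} {a b : α → ℝ} {c : ℝ}
    (ha : Tendsto a F (𝓝 c)) (hb : Tendsto b F (𝓝 c)) :
    Tendsto (fun s => Metric.hausdorffDist {a s, b s} {c}) F (𝓝 0) := by
  refine squeeze_zero (fun _ => Metric.hausdorffDist_nonneg)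
    (fun s => hausdorffDist_pair_le (a s) (b s) c) ?_
  have h1 := (ha.sub_const c).abs
  have h2 := (hb.sub_const c).abs
  simpa using h1.add h2

/-- The embedding of `D[0,T]` into `𝔇[0,T]`: a càdlàg path `x` is decorated with the sets
`{x(t-), x(t)}`. -/
def toDecorated (x : CadlagPath T) : DecoratedPath T where
  base := x
  dec t := {x.left t, x t}
  isCompact_dec t := (Set.toFinite _).isCompact
  base_mem t := by simp
  left_mem t := by simp
  tendsto_right t := tendsto_hausdorffDist_pair (x.tendsto_left_nhdsGT t)
    ((x.right_continuous t).mono_left (nhdsWithin_mono _ Ioi_subset_Ici_self))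
  tendsto_left t := tendsto_hausdorffDist_pair (x.tendsto_left_nhdsLT t) (x.tendsto_left t)

end CadlagPath

/-! ### Volterra clocks -/

/-- The standing assumption on a time-change function `f`: it is a `C¹` function
`[0,∞) → [0,∞)` (one-sided derivative at `0`), non-decreasing, null at zero, and its derivative
has at most linear growth. -/
structure IsClockFunction (f : C(ℝ≥0, ℝ≥0)) : Prop where
  contDiffOn : ContDiffOn ℝ 1 (fun x : ℝ => (f x.toNNReal : ℝ)) (Ici 0)
  mono : Monotone f
  map_zero : f 0 = 0
  deriv_growth : ∃ c : ℝ, 0 ≤ c ∧ ∀ x : ℝ, 0 ≤ x →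
    |derivWithin (fun x : ℝ => (f x.toNNReal : ℝ)) (Ici 0) x| ≤ c * (1 + x)

/-- `W` is a standard Brownian motion relative to the filtration `𝒢`. -/
structure IsFilteredBrownian {Ω : Type*} {mΩ : MeasurableSpace Ω} (P : Measure Ω)
    (𝒢 : Filtration ℝ≥0 mΩ) (W : Ω → C(ℝ≥0, ℝ)) : Prop where
  isBrownian : IsBrownianReal (fun t ω => W ω t) P
  adapted : ∀ t, Measurable[𝒢 t] (fun ω => W ω t)
  indep_increments : ∀ s t, s ≤ t →
    Indep (MeasurableSpace.comap (fun ω => W ω t - W ω s) inferInstance) (𝒢 s) P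

/-- The convolution `∫₀ᵗ K(t-s) y(s) ds` for `t ∈ [0,T]`. -/
def volterraConv {T : ℝ} (K : ℝ → ℝ) (y : Icc (0 : ℝ) T → ℝ) (t : Icc (0 : ℝ) T) : ℝ :=
  ∫ s in (0 : ℝ)..t, K (t - s) * IccExtend (t.2.1.trans t.2.2) y s

/-- `(W, X)`, on the filtered probability space `(Ω, 𝒢, P)`, is a weak solution on `[0,T]` of
`X_t = G₀(t) + ∫₀ᵗ K(t-s) (-λ X_s + ν W_{f(X_s)}) ds`. -/
structure IsWeakSolution {T : ℝ} {Ω : Type*} {mΩ : MeasurableSpace Ω} (P : Measure Ω)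
    (𝒢 : Filtration ℝ≥0 mΩ) (W : Ω → C(ℝ≥0, ℝ)) (X : Ω → IncPath T)
    (G₀ K : ℝ → ℝ) (f : C(ℝ≥0, ℝ≥0)) (lam nu : ℝ) : Prop where
  brownian : IsFilteredBrownian P 𝒢 W
  measurable : ∀ t, Measurable (fun ω => X ω t)
  continuous : ∀ᵐ ω ∂P, Continuous (X ω).toFun
  start_zero : ∀ᵐ ω ∂P, ∀ t : Icc (0 : ℝ) T, (t : ℝ) = 0 → X ω t = 0
  stopping : ∀ t, IsStoppingTime 𝒢 (fun ω => (f ((X ω).val t) : WithTop ℝ≥0))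
  martingale : ∃ h : ∀ t : Icc (0 : ℝ) T, StronglyMeasurable (fun ω => W ω (f ((X ω).val t))),
    Martingale (fun t ω => W ω (f ((X ω).val t)))
      (Filtration.natural (fun t ω => W ω (f ((X ω).val t))) h) P
  volterra : ∀ᵐ ω ∂P, ∀ t : Icc (0 : ℝ) T,
    X ω t = G₀ t + volterraConv K (fun s => -lam * X ω s + nu * W ω (f ((X ω).val s))) t

/-- The path `F(s) = ν w(f(s)) - λ s`, `s ≥ 0`. -/
def drivingPath (lam nu : ℝ) (f : C(ℝ≥0, ℝ≥0)) (w : C(ℝ≥0, ℝ)) : C(ℝ≥0, ℝ) where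
  toFun s := nu * w (f s) - lam * s
  continuous_toFun := by fun_prop

end VolterraClock

end

noncomputable section

namespace VolterraClock

/-! ### Measurability on the path space -/

/-! As the kernels tend to the Dirac mass at zero, the Volterra equation degenerates to `(1 + λ) X_t
- ν W_{f(X_t)} = G₀(t)`. This only says that `X_t` is a time at which the level path `s ↦ (1 + λ) s
- ν W_{f(s)}` takes the value `G₀(t)`; the theorem identifies it as the first passage time above
that value.

The proof is a coupling. All the `Wⁿ` have the Wiener law, so `Xⁿ_t` can be compared with
`hittingClock` at level `G₀ t` evaluated at the same path `Wⁿ`, a variable whose law is that of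
`X*_t` for every `n`. Their difference tends to zero in `L¹` for each fixed `t > 0`, in two halves.

Lower bound, pathwise (`eventually_le_sol`): as long as `Xⁿ` lies below the passage time of a level
`b < G₀(t)`, the integrand of the equation is at least about `Xⁿ - b`. Then `Xⁿ` gains a fixed
amount over every short time step, and it would leave any bounded set.

Upper bound, in mean only: the stochastic term is a convolution of a centred martingale, so `E Xⁿ_t
≤ Gⁿ(t) - λⁿ (mass of Kⁿ) E Xⁿ_s` for `s < t` (`integral_le`). With the lower bound this gives
`limsup E Xⁿ_t ≤ G₀(t) / (1 + λ)`, which is exactly the mean of the passage time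
(`lintegral_passage`). An asymptotic lower bound together with matching means forces convergence in
`L¹`.

The exact mean is the delicate point. Optional stopping gives `≤` at once; equality needs uniform
integrability of the stopped Brownian motion, and quadratic growth of `f` is borderline for it. An
`x log x` type estimate, obtained by adding exponential martingales over dyadic scales
(`le_sum_exp`), is just enough.

For monotone paths, convergence on a dense set of times containing both end points already gives
`M₁` convergence, because completed graphs are parametrised by the sum of their coordinates
(`exists_paramRep_close`). So it suffices to work with countably many coordinates (`EvalPath`), and
both weak limits follow from continuous mapping. -/

instance instMeasurableSpacePaths : MeasurableSpace C(ℝ≥0, ℝ) := borel _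

instance instBorelSpacePaths : BorelSpace C(ℝ≥0, ℝ) := ⟨rfl⟩

theorem measurable_path_eval (t : ℝ≥0) : Measurable fun w : C(ℝ≥0, ℝ) => w t :=
  (continuous_eval_const t).measurable

/-- A continuous path is determined by its values on a dense sequence, and an injective Borel map
between standard Borel spaces is an embedding (Lusin–Souslin). -/
theorem measurableEmbedding_denseEval :
    MeasurableEmbedding fun (w : C(ℝ≥0, ℝ)) (q : ℕ) => w (TopologicalSpace.denseSeq ℝ≥0 q) := by
  refine Measurable.measurableEmbedding
    (measurable_pi_lambda _ fun q => measurable_path_eval _) fun v w h => ?_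
  refine DFunLike.coe_injective
    ((TopologicalSpace.denseRange_denseSeq ℝ≥0).equalizer v.continuous w.continuous ?_)
  exact h

theorem measurable_path_iff {Ω : Type*} [MeasurableSpace Ω] {W : Ω → C(ℝ≥0, ℝ)} :
    Measurable W ↔ ∀ t, Measurable fun ω => W ω t := by
  refine ⟨fun h t => (measurable_path_eval t).comp h, fun h => ?_⟩
  exact measurableEmbedding_denseEval.measurable_comp_iff.1 (measurable_pi_lambda _ fun q => h _)

theorem aemeasurable_path {Ω : Type*} [MeasurableSpace Ω] {P : Measure Ω} {W : Ω → C(ℝ≥0, ℝ)}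
    (h : ∀ t, AEMeasurable (fun ω => W ω t) P) : AEMeasurable W P := by
  have h1 : AEMeasurable (fun ω (q : ℕ) => W ω (TopologicalSpace.denseSeq ℝ≥0 q)) P :=
    aemeasurable_pi_lambda _ fun q => h _
  obtain ⟨N, hN, hNm, hN0⟩ := exists_measurable_superset_of_null (ae_iff.1 h1.ae_eq_mk)
  classical
  -- One null set `N` serves all the countably many dense coordinates; the path is replaced by zero
  -- on it.
  have h2 : Measurable fun ω => if ω ∈ N then (0 : C(ℝ≥0, ℝ)) else W ω := by
    refine measurableEmbedding_denseEval.measurable_comp_iff.1 ?_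
    have h3 : Measurable fun ω => if ω ∈ N then (fun _ : ℕ => (0 : ℝ)) else h1.mk _ ω :=
      Measurable.ite hNm measurable_const h1.measurable_mk
    convert h3 using 1
    ext ω q
    by_cases hω : ω ∈ N
    · simp [hω]
    · have : (fun (q : ℕ) => W ω (TopologicalSpace.denseSeq ℝ≥0 q)) = h1.mk _ ω := by
        by_contra hne
        exact hω (hN hne)
      simp [hω, ← this]
  refine ⟨_, h2, ?_⟩
  filter_upwards [compl_mem_ae_iff.2 hN0] with ω hω
  exact (if_neg hω).symm

theorem borel_path_le_comap :
    (inferInstance : MeasurableSpace C(ℝ≥0, ℝ)) ≤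
      MeasurableSpace.comap (fun (w : C(ℝ≥0, ℝ)) (t : ℝ≥0) => w t) MeasurableSpace.pi := by
  rw [← measurableEmbedding_denseEval.comap_eq]
  rintro s ⟨A, hA, rfl⟩
  exact ⟨(fun (x : ℝ≥0 → ℝ) q => x (TopologicalSpace.denseSeq ℝ≥0 q)) ⁻¹' A,
    (measurable_pi_lambda _ fun q => measurable_pi_apply _) hA, rfl⟩

theorem measurable_path_coe : Measurable fun (w : C(ℝ≥0, ℝ)) (t : ℝ≥0) => w t :=
  measurable_pi_lambda _ measurable_path_eval

theorem isProjectiveLimit_brownian {Ω : Type*} [MeasurableSpace Ω]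
    {P : Measure Ω} {W : Ω → C(ℝ≥0, ℝ)} (h : IsBrownianReal (fun t ω => W ω t) P) :
    IsProjectiveLimit ((P.map W).map fun (w : C(ℝ≥0, ℝ)) (t : ℝ≥0) => w t)
      BrownianReal.projectiveFamily := by
  intro I
  rw [Measure.map_map (Finset.measurable_restrict _) measurable_path_coe,
    AEMeasurable.map_map_of_aemeasurable
      ((Finset.measurable_restrict _).comp measurable_path_coe).aemeasurable
      (aemeasurable_path h.aemeasurable)]
  exact (h.hasLaw I).map_eq

/-- The law of Brownian motion on the path space is unique. -/
theorem brownian_map_eq {Ω Ω' : Type*} [MeasurableSpace Ω] [MeasurableSpace Ω']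
    {P : Measure Ω} {P' : Measure Ω'} {W : Ω → C(ℝ≥0, ℝ)} {W' : Ω' → C(ℝ≥0, ℝ)}
    (h : IsBrownianReal (fun t ω => W ω t) P) (h' : IsBrownianReal (fun t ω => W' ω t) P') :
    P.map W = P'.map W' := by
  have heq := (isProjectiveLimit_brownian h).unique (isProjectiveLimit_brownian h')
  refine Measure.ext fun s hs => ?_
  obtain ⟨A, hA, rfl⟩ := borel_path_le_comap s hs
  rw [← Measure.map_apply measurable_path_coe hA, ← Measure.map_apply measurable_path_coe hA, heq]

theorem isBrownianReal_map {Ω : Type*} [MeasurableSpace Ω] {P : Measure Ω} {W : Ω → C(ℝ≥0, ℝ)}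
    (h : IsBrownianReal (fun t ω => W ω t) P) :
    IsBrownianReal (fun t (w : C(ℝ≥0, ℝ)) => w t) (P.map W) where
  hasLaw I := by
    have hm : Measurable fun w : C(ℝ≥0, ℝ) => I.restrict fun t => w t :=
      measurable_pi_lambda _ fun t => measurable_path_eval _
    refine ⟨hm.aemeasurable, ?_⟩
    rw [AEMeasurable.map_map_of_aemeasurable hm.aemeasurable (aemeasurable_path h.aemeasurable)]
    exact (h.hasLaw I).map_eq
  cont := ae_of_all _ fun w => w.continuous

/-! ### Optional stopping on the path space -/

/-- A process on the path space which is a martingale for the canonical filtration. -/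
structure IsPathMartingale (μ : Measure C(ℝ≥0, ℝ)) (H : ℝ≥0 → C(ℝ≥0, ℝ) → ℝ) : Prop where
  integrable : ∀ t, Integrable (H t) μ
  setIntegral_eq : ∀ s t, s ≤ t → ∀ A : Set (Iic s → ℝ), MeasurableSet A →
    ∫ w in (fun (w : C(ℝ≥0, ℝ)) (v : Iic s) => w v) ⁻¹' A, H t w ∂μ =
      ∫ w in (fun (w : C(ℝ≥0, ℝ)) (v : Iic s) => w v) ⁻¹' A, H s w ∂μ

theorem measurable_past (s : ℝ≥0) :
    Measurable fun (w : C(ℝ≥0, ℝ)) (v : Iic s) => w v :=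
  measurable_pi_lambda _ fun _ => measurable_path_eval _

/-! ### Brownian motion and its exponential martingales on the path space -/

section Brownian

variable {μ : Measure C(ℝ≥0, ℝ)} (hB : IsBrownianReal (fun t (w : C(ℝ≥0, ℝ)) => w t) μ)

include hB

theorem indepFun_increment_past {s t : ℝ≥0} (hst : s ≤ t) :
    IndepFun (fun w : C(ℝ≥0, ℝ) => w t - w s) (fun (w : C(ℝ≥0, ℝ)) (v : Iic s) => w v) μ := by
  have h := (hB.toIsPreBrownianReal.indepFun_shift s).comp
    (measurable_pi_apply (t - s)) measurable_id
  simpa [Function.comp_def, add_tsub_cancel_of_le hst] using h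

theorem integral_mul_of_past {s t : ℝ≥0} (hst : s ≤ t) {g : ℝ → ℝ} (hg : Measurable g)
    {k : (Iic s → ℝ) → ℝ} (hk : Measurable k) :
    ∫ w, g (w t - w s) * k (fun v : Iic s => w v) ∂μ =
      (∫ w, g (w t - w s) ∂μ) * ∫ w, k (fun v : Iic s => w v) ∂μ := by
  refine ((indepFun_increment_past hB hst).comp hg hk).integral_fun_mul_eq_mul_integral ?_ ?_
  · exact (hg.comp ((measurable_path_eval t).sub (measurable_path_eval s))).aestronglyMeasurable
  · exact (hk.comp (measurable_past s)).aestronglyMeasurable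

theorem isPathMartingale_eval : IsPathMartingale μ fun t w => w t where
  integrable t := hB.integrable_eval t
  setIntegral_eq s t hst A hA := by
    have hm := measurable_past s hA
    have h := integral_mul_of_past hB hst measurable_id
      (k := A.indicator fun _ => 1) (measurable_const.indicator hA)
    have h0 : ∫ w : C(ℝ≥0, ℝ), id (w t - w s) ∂μ = 0 := by
      simp only [id]
      rw [integral_sub (hB.integrable_eval t) (hB.integrable_eval s), hB.integral_eval t,
        hB.integral_eval s, sub_zero]
    rw [h0, zero_mul] at h
    rw [← sub_eq_zero, ← integral_sub (hB.integrable_eval t).integrableOn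
      (hB.integrable_eval s).integrableOn, ← integral_indicator hm, ← h]
    refine integral_congr_ae (ae_of_all _ fun w => ?_)
    by_cases hw : (fun v : Iic s => w v) ∈ A
    · simp [indicator, hw]
    · simp [indicator, hw]

theorem integrable_exp_increment (s t : ℝ≥0) (θ : ℝ) :
    Integrable (fun w : C(ℝ≥0, ℝ) => Real.exp (θ * (w t - w s))) μ := by
  have h := (hB.hasLaw_sub t s).map_eq
  have := integrable_exp_mul_gaussianReal (μ := 0) (v := nndist t.1 s.1) θ
  rw [← h] at this
  exact this.comp_aemeasurable (hB.hasLaw_sub t s).aemeasurable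

theorem integral_exp_increment {s t : ℝ≥0} (hst : s ≤ t) (θ : ℝ) :
    ∫ w : C(ℝ≥0, ℝ), Real.exp (θ * (w t - w s)) ∂μ = Real.exp (θ ^ 2 * (t - s) / 2) := by
  have h := mgf_gaussianReal (hB.hasLaw_sub t s).map_eq θ
  have hst' : (s : ℝ) ≤ t := hst
  have h2 : ((nndist t.1 s.1 : ℝ≥0) : ℝ) = t - s := by
    rw [coe_nndist, Real.dist_eq]
    exact abs_of_nonneg (by simpa using hst')
  rw [h2] at h
  rw [mgf] at h
  refine h.trans ?_
  congr 1
  ring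

/-- The exponential martingale. -/
theorem isPathMartingale_exp (θ : ℝ) :
    IsPathMartingale μ fun t w => Real.exp (θ * w t - θ ^ 2 * t / 2) where
  integrable t := by
    have h := (integrable_exp_increment hB 0 t θ).mul_const (Real.exp (-(θ ^ 2 * t / 2)))
    refine h.congr ?_
    filter_upwards [hB.eval_zero_ae_eq_zero] with w hw
    rw [hw, ← Real.exp_add]
    ring_nf
  setIntegral_eq s t hst A hA := by
    have hm := measurable_past s hA
    -- The factor `k` carries the value at time `s` with the compensator of time `t`; the moment
    -- generating function of the increment then turns that `t` into `s`.
    have h := integral_mul_of_past hB hst (g := fun x => Real.exp (θ * x)) (by fun_prop)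
      (k := A.indicator fun x => Real.exp (θ * x ⟨s, le_refl s⟩ - θ ^ 2 * t / 2))
      (Measurable.indicator (by fun_prop) hA)
    rw [integral_exp_increment hB hst, ← integral_const_mul] at h
    rw [← integral_indicator hm, ← integral_indicator hm]
    convert h using 1
    · refine integral_congr_ae (ae_of_all _ fun w => ?_)
      by_cases hw : (fun v : Iic s => w v) ∈ A
      · simp only [indicator, hw, mem_preimage, if_true]
        rw [← Real.exp_add]
        ring_nf
      · simp [indicator, hw]
    · refine integral_congr_ae (ae_of_all _ fun w => ?_)
      by_cases hw : (fun v : Iic s => w v) ∈ A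
      · simp only [indicator, hw, mem_preimage, if_true]
        rw [← Real.exp_add]
        ring_nf
      · simp [indicator, hw]

end Brownian

/-! ### First passage along a grid -/

/-- The index of the first point of the grid `0, h, 2h, …` at which `z` exceeds `a`, capped. -/
def gridIndex (z : ℝ≥0 → ℝ) (a : ℝ) (h : ℝ≥0) : ℕ → ℕ
  | 0 => 0
  | i + 1 => open Classical in if ∀ j ≤ i, z (j * h) ≤ a then i + 1 else gridIndex z a h i

theorem gridIndex_le (z : ℝ≥0 → ℝ) (a : ℝ) (h : ℝ≥0) (N : ℕ) : gridIndex z a h N ≤ N := by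
  induction N with
  | zero => simp [gridIndex]
  | succ i ih => rw [gridIndex]; split_ifs <;> omega

theorem gridIndex_of_forall {z : ℝ≥0 → ℝ} {a : ℝ} {h : ℝ≥0} {N : ℕ}
    (H : ∀ j < N, z (j * h) ≤ a) : gridIndex z a h N = N := by
  cases N with
  | zero => rfl
  | succ i => rw [gridIndex, if_pos fun j hj => H j (by omega)]

theorem lt_of_gridIndex_lt {z : ℝ≥0 → ℝ} {a : ℝ} {h : ℝ≥0} {N : ℕ}
    (H : gridIndex z a h N < N) : a < z (gridIndex z a h N * h) := by
  induction N with
  | zero => simp at H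
  | succ i ih =>
    rw [gridIndex] at H ⊢
    split_ifs at H ⊢ with h1
    · omega
    · rcases (gridIndex_le z a h i).lt_or_eq with h2 | h2
      · exact ih h2
      · by_contra h3
        apply h1
        intro j hj
        rcases hj.lt_or_eq with hj | rfl
        · by_contra h4
          -- Once the level is exceeded at `j`, the index stays at or below `j` at all later stages;
          -- at stage `i` this contradicts `h2`.
          have : ∀ M, j < M → gridIndex z a h M ≤ j := by
            intro M hM
            induction M with
            | zero => omega
            | succ M ihM =>
              rw [gridIndex, if_neg fun h5 => h4 (h5 j (by omega))]
              rcases Nat.lt_succ_iff_lt_or_eq.1 hM with h6 | rfl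
              · exact ihM h6
              · exact gridIndex_le _ _ _ _
          have := this i hj
          omega
        · rw [h2] at h3
          exact not_lt.1 h3

theorem gridIndex_le_of_lt {z : ℝ≥0 → ℝ} {a : ℝ} {h : ℝ≥0} {j : ℕ} (hj : a < z (j * h)) (N : ℕ) :
    gridIndex z a h N ≤ j := by
  induction N with
  | zero => simp [gridIndex]
  | succ M ih =>
    rw [gridIndex]
    split_ifs with h1
    · by_contra h2
      exact absurd (h1 j (by omega)) (not_le.2 hj)
    · exact ih

/-- Discrete optional stopping. The index moves from `i` to `i + 1` exactly when no grid point up to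
`i` exceeds the level. Since `f` is monotone, this event depends on the path up to time `f (i * h)`
only, so the added increment has mean zero. -/
theorem integral_gridIndex {μ : Measure C(ℝ≥0, ℝ)} [IsFiniteMeasure μ]
    {H : ℝ≥0 → C(ℝ≥0, ℝ) → ℝ} (hH : IsPathMartingale μ H) {f : C(ℝ≥0, ℝ≥0)} (hf : Monotone f)
    (c ν a : ℝ) (h : ℝ≥0) (N : ℕ) :
    Integrable (fun w : C(ℝ≥0, ℝ) =>
      H (f (gridIndex (fun s => c * s - ν * w (f s)) a h N * h)) w) μ ∧
    ∫ w : C(ℝ≥0, ℝ), H (f (gridIndex (fun s => c * s - ν * w (f s)) a h N * h)) w ∂μ =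
      ∫ w, H (f 0) w ∂μ := by
  induction N with
  | zero => simpa [gridIndex] using hH.integrable (f 0)
  | succ i ih =>
    set A : Set (Iic (f (i * h)) → ℝ) :=
      {x | ∀ j : ℕ, ∀ hj : j ≤ i, c * (j * h : ℝ≥0) - ν * x ⟨f (j * h), hf (by gcongr)⟩ ≤ a} with hA
    have hAm : MeasurableSet A := by
      rw [hA]
      simp only [ofPred_forall]
      refine MeasurableSet.iInter fun j => MeasurableSet.iInter fun hj => ?_
      exact measurableSet_le (by fun_prop) measurable_const
    have hpm := measurable_past _ hAm
    have key : (fun w : C(ℝ≥0, ℝ) =>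
        H (f (gridIndex (fun s => c * s - ν * w (f s)) a h (i + 1) * h)) w) = fun w =>
        H (f (gridIndex (fun s => c * s - ν * w (f s)) a h i * h)) w +
          ((fun (w : C(ℝ≥0, ℝ)) (v : Iic (f (i * h))) => w v) ⁻¹' A).indicator
            (fun w => H (f ((i + 1 : ℕ) * h)) w - H (f (i * h)) w) w := by
      ext w
      have hiff : w ∈ ((fun (w : C(ℝ≥0, ℝ)) (v : Iic (f (i * h))) => w v) ⁻¹' A) ↔
          ∀ j ≤ i, (fun s : ℝ≥0 => c * s - ν * w (f s)) (j * h) ≤ a := Iff.rfl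
      by_cases hw : ∀ j ≤ i, (fun s : ℝ≥0 => c * s - ν * w (f s)) (j * h) ≤ a
      · rw [indicator_of_mem (hiff.2 hw), gridIndex, if_pos hw,
          gridIndex_of_forall fun j hj => hw j hj.le]
        ring
      · rw [indicator_of_notMem (fun h1 => hw (hiff.1 h1)), gridIndex, if_neg hw, add_zero]
    have hint : Integrable (((fun (w : C(ℝ≥0, ℝ)) (v : Iic (f (i * h))) => w v) ⁻¹' A).indicator
        fun w => H (f ((i + 1 : ℕ) * h)) w - H (f (i * h)) w) μ :=
      ((hH.integrable (f ((i + 1 : ℕ) * h))).sub (hH.integrable (f (i * h)))).indicator hpm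
    rw [key]
    refine ⟨ih.1.add hint, ?_⟩
    rw [integral_add ih.1 hint, ih.2, integral_indicator hpm]
    rw [integral_sub (hH.integrable _).integrableOn (hH.integrable _).integrableOn,
      hH.setIntegral_eq _ _ (hf (by gcongr; simp)) A hAm, sub_self, add_zero]

/-! ### First passage times -/

/-- The first passage time of `z` above the level `a`. -/
def passage (z : ℝ≥0 → ℝ) (a : ℝ) : ℝ≥0 := sInf {s | a < z s}

/-- The first passage time of `z` above the level `a`, capped at `m`. -/
def cappedPassage (z : ℝ≥0 → ℝ) (a : ℝ) (m : ℝ≥0) : ℝ≥0 := sInf {s | a < z s ∨ m ≤ s}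

section Passage

variable {z : ℝ≥0 → ℝ} {a : ℝ} {m : ℝ≥0}

theorem cappedPassage_le : cappedPassage z a m ≤ m := csInf_le (OrderBot.bddBelow _) (Or.inr le_rfl)

theorem cappedPassage_le_of_lt {s : ℝ≥0} (h : a < z s) : cappedPassage z a m ≤ s :=
  csInf_le (OrderBot.bddBelow _) (Or.inl h)

theorem le_of_lt_cappedPassage {s : ℝ≥0} (h : s < cappedPassage z a m) : z s ≤ a :=
  not_lt.1 fun h1 => (cappedPassage_le_of_lt h1).not_gt h

theorem exists_lt_of_cappedPassage_lt {s : ℝ≥0} (h : cappedPassage z a m < s) :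
    ∃ r < s, a < z r ∨ m ≤ r := by
  obtain ⟨r, hr, hrs⟩ := (csInf_lt_iff (OrderBot.bddBelow _) ⟨m, Or.inr le_rfl⟩).1 h
  exact ⟨r, hrs, hr⟩

theorem passage_le {s : ℝ≥0} (h : a < z s) : passage z a ≤ s := csInf_le (OrderBot.bddBelow _) h

theorem le_of_lt_passage {s : ℝ≥0} (h : s < passage z a) : z s ≤ a :=
  not_lt.1 fun h1 => (passage_le h1).not_gt h

theorem exists_lt_of_passage_lt (hne : ∃ s, a < z s) {s : ℝ≥0} (h : passage z a < s) :
    ∃ r < s, a < z r := by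
  obtain ⟨r, hr, hrs⟩ := (csInf_lt_iff (OrderBot.bddBelow _) hne).1 h
  exact ⟨r, hrs, hr⟩

theorem cappedPassage_eq_min (hne : ∃ s, a < z s) : cappedPassage z a m = min (passage z a) m := by
  apply le_antisymm
  · refine le_min (le_csInf hne fun s hs => cappedPassage_le_of_lt hs) cappedPassage_le
  · refine le_csInf ⟨m, Or.inr le_rfl⟩ ?_
    rintro s (hs | hs)
    · exact (min_le_left _ _).trans (passage_le hs)
    · exact (min_le_right _ _).trans hs

theorem le_of_forall_lt_of_continuous (hz : Continuous z) (h0 : z 0 ≤ a) {ρ : ℝ≥0}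
    (h : ∀ s < ρ, z s ≤ a) : z ρ ≤ a := by
  rcases eq_or_ne ρ 0 with rfl | hρ
  · exact h0
  · have : (𝓝[<] ρ).NeBot := nhdsLT_neBot_of_exists_lt ⟨0, pos_iff_ne_zero.2 hρ⟩
    exact le_of_tendsto (hz.continuousWithinAt (s := Iio ρ))
      (eventually_nhdsWithin_of_forall fun s hs => h s hs)

theorem apply_cappedPassage_le (hz : Continuous z) (h0 : z 0 ≤ a) :
    z (cappedPassage z a m) ≤ a :=
  le_of_forall_lt_of_continuous hz h0 fun _ => le_of_lt_cappedPassage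

theorem apply_passage_le (hz : Continuous z) (h0 : z 0 ≤ a) : z (passage z a) ≤ a :=
  le_of_forall_lt_of_continuous hz h0 fun _ => le_of_lt_passage

theorem le_apply_passage (hz : Continuous z) (hne : ∃ s, a < z s) : a ≤ z (passage z a) := by
  by_contra! h
  obtain ⟨u, hu, hu2⟩ := exists_Ico_subset_of_mem_nhds
    (hz.continuousAt.preimage_mem_nhds (Iio_mem_nhds h)) (exists_gt _)
  obtain ⟨r, hr, hr2⟩ := exists_lt_of_passage_lt hne hu
  exact lt_asymm hr2 (hu2 ⟨passage_le hr2, hr⟩)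

theorem apply_passage (hz : Continuous z) (h0 : z 0 ≤ a) (hne : ∃ s, a < z s) :
    z (passage z a) = a :=
  (apply_passage_le hz h0).antisymm (le_apply_passage hz hne)

theorem passage_mono {b : ℝ} (hab : a ≤ b) (hne : ∃ s, b < z s) : passage z a ≤ passage z b :=
  csInf_le_csInf (OrderBot.bddBelow _) hne fun _ hs => hab.trans_lt hs

theorem isGLB_passage (hne : ∃ s, a < z s) : IsGLB {s | a < z s} (passage z a) :=
  isGLB_csInf hne (OrderBot.bddBelow _)

/-- The second alternative is the convention that the infimum of the empty set is `0` in `ℝ≥0`. -/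
theorem passage_lt_iff {r : ℝ≥0} :
    passage z a < r ↔ (∃ s < r, a < z s) ∨ ((∀ s, z s ≤ a) ∧ 0 < r) := by
  by_cases hne : ∃ s, a < z s
  · constructor
    · exact fun h => Or.inl (exists_lt_of_passage_lt hne h)
    · rintro (⟨s, hs, hs2⟩ | ⟨h1, -⟩)
      · exact (passage_le hs2).trans_lt hs
      · obtain ⟨s, hs⟩ := hne
        exact absurd hs (h1 s).not_gt
  · push Not at hne
    have : passage z a = 0 := by
      rw [passage]
      have : {s | a < z s} = ∅ := by
        ext s
        simpa using hne s
      rw [this]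
      simp
    rw [this]
    constructor
    · exact fun h => Or.inr ⟨hne, h⟩
    · rintro (⟨s, hs, hs2⟩ | ⟨-, h⟩)
      · exact absurd hs2 (hne s).not_gt
      · exact h

/-- With `k + 1` steps of length `m / (k + 1)` the grid ends exactly at the cap `m`, so grid times
never precede the capped passage. Conversely, an exceedance persists on a short interval to the
right by continuity, and a fine enough grid meets that interval. -/
theorem tendsto_gridIndex (hz : Continuous z) :
    Tendsto (fun k : ℕ => (gridIndex z a (m / (k + 1 : ℕ)) (k + 1) : ℝ≥0) * (m / (k + 1 : ℕ))) atTop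
      (𝓝 (cappedPassage z a m)) := by
  have hN : ∀ k : ℕ, ((k + 1 : ℕ) : ℝ≥0) * (m / (k + 1 : ℕ)) = m := fun k =>
    mul_div_cancel₀ _ (by positivity)
  have hle : ∀ k : ℕ, (gridIndex z a (m / (k + 1 : ℕ)) (k + 1) : ℝ≥0) * (m / (k + 1 : ℕ)) ≤ m := by
    intro k
    calc _ ≤ ((k + 1 : ℕ) : ℝ≥0) * (m / (k + 1 : ℕ)) := by
          gcongr
          exact_mod_cast gridIndex_le z a _ _
      _ = m := hN k
  refine tendsto_order.2 ⟨fun l hl => Eventually.of_forall fun k => hl.trans_le ?_, fun u hu => ?_⟩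
  · rcases (gridIndex_le z a (m / (k + 1 : ℕ)) (k + 1)).lt_or_eq with h | h
    · exact cappedPassage_le_of_lt (lt_of_gridIndex_lt h)
    · rw [h, hN]
      exact cappedPassage_le
  · obtain ⟨r, hr, h | h⟩ := exists_lt_of_cappedPassage_lt hu
    · by_cases hm : m ≤ r
      · exact Eventually.of_forall fun k => (hle k).trans_lt (hm.trans_lt hr)
      push Not at hm
      obtain ⟨v, hv, hv2⟩ := exists_Ico_subset_of_mem_nhds
        (hz.continuousAt.preimage_mem_nhds (Ioi_mem_nhds h)) (exists_gt r)
      have hv' : r < min v u := lt_min hv hr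
      have hh : Tendsto (fun k : ℕ => r + m / ((k + 1 : ℕ) : ℝ≥0)) atTop (𝓝 (r + 0)) := by
        refine tendsto_const_nhds.add ?_
        exact (tendsto_const_div_atTop_nhds_zero_nat m).comp (tendsto_add_atTop_nat 1)
      rw [add_zero] at hh
      filter_upwards [hh.eventually_lt_const hv'] with k hk
      set h' : ℝ≥0 := m / (k + 1 : ℕ) with hh'
      have hm0 : 0 < m := (zero_le (a := r)).trans_lt hm
      have hpos : 0 < h' := by positivity
      -- The first grid point at or after `r`; it lies in `[r, r + h')`, where `z` still exceeds
      -- `a`.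
      set j := ⌈r / h'⌉₊ with hj
      have h1 : r ≤ j * h' := by
        rw [← div_le_iff₀ hpos]
        exact Nat.le_ceil _
      have h2 : j * h' < r + h' := by
        have := Nat.ceil_lt_add_one (zero_le (a := r / h'))
        calc (j : ℝ≥0) * h' < (r / h' + 1) * h' := by gcongr
          _ = r + h' := by rw [add_mul, div_mul_cancel₀ _ hpos.ne', one_mul]
      have h3 : a < z (j * h') := hv2 ⟨h1, h2.trans (hk.trans_le (min_le_left _ _))⟩
      calc (gridIndex z a h' (k + 1) : ℝ≥0) * h' ≤ j * h' := by
            gcongr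
            exact gridIndex_le_of_lt h3 _
        _ < r + h' := h2
        _ < u := hk.trans_le (min_le_right _ _)
    · exact Eventually.of_forall fun k => (hle k).trans_lt (h.trans_lt hr)

end Passage

/-- Convergence of expectations for sequences that are bounded in `L²`. -/
theorem tendsto_integral_of_sq_bounded {Ω : Type*} [MeasurableSpace Ω] {P : Measure Ω}
    [IsProbabilityMeasure P] {g : ℕ → Ω → ℝ} {g₀ : Ω → ℝ}
    (hg : ∀ k, Integrable (g k) P) (hlim : ∀ᵐ ω ∂P, Tendsto (fun k => g k ω) atTop (𝓝 (g₀ ω)))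
    {B : ℝ} (hsq : ∀ k, Integrable (fun ω => g k ω ^ 2) P) (hB : ∀ k, ∫ ω, g k ω ^ 2 ∂P ≤ B) :
    Integrable g₀ P ∧ Tendsto (fun k => ∫ ω, g k ω ∂P) atTop (𝓝 (∫ ω, g₀ ω ∂P)) := by
  have hm := aestronglyMeasurable_of_tendsto_ae _ (fun k => (hg k).1) hlim
  have hbd : ∀ k, eLpNorm (g k) 2 P ≤ ENNReal.ofReal (√B) := by
    intro k
    have h1 : MemLp (g k) 2 P := (memLp_two_iff_integrable_sq (hg k).1).2 (hsq k)
    rw [h1.eLpNorm_eq_integral_rpow_norm (by norm_num) (by norm_num)]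
    apply ENNReal.ofReal_le_ofReal
    rw [Real.sqrt_eq_rpow]
    simp only [ENNReal.toReal_ofNat, Real.rpow_ofNat, Real.norm_eq_abs, sq_abs]
    rw [one_div]
    refine Real.rpow_le_rpow (integral_nonneg fun ω => sq_nonneg _) (hB k) (by norm_num)
  have hui : UnifIntegrable g 1 P := by
    refine unifIntegrable_of le_rfl ENNReal.one_ne_top (fun k => (hg k).1) fun ε hε => ?_
    -- Where `|g| ≥ C` one has `|g| ≤ g² / C`, and this `C` makes the resulting bound `B / C` at
    -- most `ε`; the `+ 1` keeps `C` positive.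
    refine ⟨⟨(|B| + 1) / ε, by positivity⟩, fun k => ?_⟩
    have hC : 0 < (|B| + 1) / ε := by positivity
    rw [eLpNorm_one_eq_lintegral_enorm]
    calc ∫⁻ ω, ‖{ω | (⟨(|B| + 1) / ε, hC.le⟩ : ℝ≥0) ≤ ‖g k ω‖₊}.indicator (g k) ω‖ₑ ∂P
        ≤ ∫⁻ ω, ENNReal.ofReal (g k ω ^ 2 * (ε / (|B| + 1))) ∂P := by
          refine lintegral_mono fun ω => ?_
          by_cases hω : ω ∈ {ω | (⟨(|B| + 1) / ε, hC.le⟩ : ℝ≥0) ≤ ‖g k ω‖₊}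
          · rw [indicator_of_mem hω, ← ofReal_norm]
            apply ENNReal.ofReal_le_ofReal
            have h1 : (|B| + 1) / ε ≤ |g k ω| := hω
            rw [div_le_iff₀ hε] at h1
            rw [Real.norm_eq_abs, ← sq_abs, mul_div_assoc', le_div_iff₀ (by positivity)]
            nlinarith [abs_nonneg (g k ω)]
          · rw [indicator_of_notMem hω]
            simp
      _ = ENNReal.ofReal (∫ ω, g k ω ^ 2 * (ε / (|B| + 1)) ∂P) := by
          rw [ofReal_integral_eq_lintegral_ofReal ((hsq k).mul_const _)]
          exact ae_of_all _ fun ω => by positivity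
      _ ≤ ENNReal.ofReal ε := by
          apply ENNReal.ofReal_le_ofReal
          rw [integral_mul_const, mul_div_assoc', div_le_iff₀ (by positivity)]
          have := (hB k).trans (le_abs_self B)
          nlinarith
  have hg₀ : MemLp g₀ 1 P := by
    -- By Fatou, the limit inherits the `L²` bound.
    refine MemLp.mono_exponent (q := 2) ⟨hm, ?_⟩ one_le_two
    refine (Lp.eLpNorm_lim_le_liminf_eLpNorm (fun k => (hg k).1) g₀ hlim).trans_lt ?_
    refine (liminf_le_of_le (by isBoundedDefault) (a := ENNReal.ofReal (√B)) fun b hb => ?_).trans_lt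
      ENNReal.ofReal_lt_top
    obtain ⟨k, hk⟩ := hb.exists
    exact hk.trans (hbd k)
  have h1 := tendsto_Lp_finite_of_tendsto_ae le_rfl ENNReal.one_ne_top (fun k => (hg k).1) hg₀ hui
    hlim
  exact ⟨memLp_one_iff_integrable.1 hg₀,
    tendsto_integral_of_L1' _ hm (Eventually.of_forall hg) h1⟩

/-! ### The expected first passage time of `s ↦ c s - ν W_{f(s)}` -/

/-- The path `s ↦ c s - ν w(f(s))`. -/
def levelPath (c ν : ℝ) (f : C(ℝ≥0, ℝ≥0)) (w : C(ℝ≥0, ℝ)) (s : ℝ≥0) : ℝ := c * s - ν * w (f s)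

theorem continuous_levelPath (c ν : ℝ) (f : C(ℝ≥0, ℝ≥0)) (w : C(ℝ≥0, ℝ)) :
    Continuous (levelPath c ν f w) := by
  unfold levelPath
  fun_prop

theorem continuous_levelPath_apply (c ν : ℝ) (f : C(ℝ≥0, ℝ≥0)) (s : ℝ≥0) :
    Continuous fun w => levelPath c ν f w s := by
  unfold levelPath
  fun_prop

theorem measurableSet_exists_levelPath (c ν : ℝ) (f : C(ℝ≥0, ℝ≥0)) (a : ℝ) (r : ℝ≥0) :
    MeasurableSet {w | ∃ s < r, a < levelPath c ν f w s} := by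
  have : {w | ∃ s < r, a < levelPath c ν f w s} = ⋃ s < r, {w | a < levelPath c ν f w s} := by
    ext w
    simp
  rw [this]
  exact (isOpen_biUnion fun s _ => isOpen_lt continuous_const
    (continuous_levelPath_apply c ν f s)).measurableSet

theorem measurableSet_forall_levelPath (c ν : ℝ) (f : C(ℝ≥0, ℝ≥0)) (a : ℝ) :
    MeasurableSet {w | ∀ s, levelPath c ν f w s ≤ a} := by
  have : {w | ∀ s, levelPath c ν f w s ≤ a} = ⋂ s, {w | levelPath c ν f w s ≤ a} := by
    ext w
    simp
  rw [this]
  exact (isClosed_iInter fun s => isClosed_le (continuous_levelPath_apply c ν f s)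
    continuous_const).measurableSet

theorem measurable_passage (c ν : ℝ) (f : C(ℝ≥0, ℝ≥0)) (a : ℝ) :
    Measurable fun w => passage (levelPath c ν f w) a := by
  refine measurable_of_Iio fun r => ?_
  have : (fun w => passage (levelPath c ν f w) a) ⁻¹' Iio r =
      {w | ∃ s < r, a < levelPath c ν f w s} ∪
        ({w | ∀ s, levelPath c ν f w s ≤ a} ∩ {_w | 0 < r}) := by
    ext w
    exact passage_lt_iff
  rw [this]
  exact (measurableSet_exists_levelPath c ν f a r).union
    ((measurableSet_forall_levelPath c ν f a).inter (MeasurableSet.const _))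

theorem measurable_cappedPassage (c ν : ℝ) (f : C(ℝ≥0, ℝ≥0)) (a : ℝ) (m : ℝ≥0) :
    Measurable fun w => cappedPassage (levelPath c ν f w) a m := by
  refine measurable_of_Iio fun r => ?_
  have : (fun w => cappedPassage (levelPath c ν f w) a m) ⁻¹' Iio r =
      {w | ∃ s < r, a < levelPath c ν f w s} ∪ {_w | m < r} := by
    ext w
    constructor
    · intro h
      obtain ⟨s, hs, h | h⟩ := exists_lt_of_cappedPassage_lt h
      · exact Or.inl ⟨s, hs, h⟩
      · exact Or.inr (h.trans_lt hs)
    · rintro (⟨s, hs, h⟩ | h)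
      · exact (cappedPassage_le_of_lt h).trans_lt hs
      · exact cappedPassage_le.trans_lt h
  rw [this]
  exact (measurableSet_exists_levelPath c ν f a r).union (MeasurableSet.const _)

theorem IsPathMartingale.add {μ : Measure C(ℝ≥0, ℝ)} {G H : ℝ≥0 → C(ℝ≥0, ℝ) → ℝ}
    (hG : IsPathMartingale μ G) (hH : IsPathMartingale μ H) :
    IsPathMartingale μ fun t w => G t w + H t w where
  integrable t := (hG.integrable t).add (hH.integrable t)
  setIntegral_eq s t hst A hA := by
    rw [integral_add (hG.integrable t).integrableOn (hH.integrable t).integrableOn,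
      integral_add (hG.integrable s).integrableOn (hH.integrable s).integrableOn,
      hG.setIntegral_eq s t hst A hA, hH.setIntegral_eq s t hst A hA]

theorem IsPathMartingale.const_mul {μ : Measure C(ℝ≥0, ℝ)} {G : ℝ≥0 → C(ℝ≥0, ℝ) → ℝ}
    (hG : IsPathMartingale μ G) (r : ℝ) : IsPathMartingale μ fun t w => r * G t w where
  integrable t := (hG.integrable t).const_mul r
  setIntegral_eq s t hst A hA := by
    rw [integral_const_mul, integral_const_mul, hG.setIntegral_eq s t hst A hA]

/-- The grid times converge to the capped passage, and `H` is continuous in time. To pass to the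
limit in the expectations, `H²` is dominated by a second martingale `G` whose mean along the grid
times is constant, which bounds the stopped values in `L²`. -/
theorem integral_cappedPassage {μ : Measure C(ℝ≥0, ℝ)} [IsProbabilityMeasure μ]
    {G H : ℝ≥0 → C(ℝ≥0, ℝ) → ℝ} (hH : IsPathMartingale μ H) (hG : IsPathMartingale μ G)
    (hc : ∀ w, Continuous fun t => H t w) {f : C(ℝ≥0, ℝ≥0)} (hf : Monotone f) (c ν a : ℝ) (m : ℝ≥0)
    (hsq : ∀ t ≤ f m, ∀ w, H t w ^ 2 ≤ G t w) :
    Integrable (fun w => H (f (cappedPassage (levelPath c ν f w) a m)) w) μ ∧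
    ∫ w, H (f (cappedPassage (levelPath c ν f w) a m)) w ∂μ = ∫ w, H (f 0) w ∂μ := by
  set τ : ℕ → C(ℝ≥0, ℝ) → ℝ≥0 := fun k w =>
    (gridIndex (levelPath c ν f w) a (m / (k + 1 : ℕ)) (k + 1) : ℝ≥0) * (m / (k + 1 : ℕ)) with hτ
  have hτm : ∀ k w, f (τ k w) ≤ f m := by
    intro k w
    apply hf
    calc τ k w ≤ ((k + 1 : ℕ) : ℝ≥0) * (m / (k + 1 : ℕ)) := by
          simp only [hτ]
          gcongr
          exact gridIndex_le _ a _ _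
      _ = m := mul_div_cancel₀ _ (by positivity)
  have h1 := fun k : ℕ => integral_gridIndex hH hf c ν a (m / (k + 1 : ℕ)) (k + 1)
  have h2 := fun k : ℕ => integral_gridIndex hG hf c ν a (m / (k + 1 : ℕ)) (k + 1)
  have hsqi : ∀ k, Integrable (fun w => H (f (τ k w)) w ^ 2) μ := fun k =>
    (h2 k).1.mono' ((h1 k).1.1.pow 2) (ae_of_all _ fun w => by
      rw [Real.norm_of_nonneg (sq_nonneg _)]
      exact hsq _ (hτm k w) w)
  have h3 := tendsto_integral_of_sq_bounded (P := μ) (g := fun k w => H (f (τ k w)) w)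
    (g₀ := fun w => H (f (cappedPassage (levelPath c ν f w) a m)) w) (fun k => (h1 k).1)
    (ae_of_all _ fun w => (((hc w).comp f.continuous).tendsto _).comp
      (tendsto_gridIndex (continuous_levelPath c ν f w))) (B := ∫ w, G (f 0) w ∂μ) hsqi
    (fun k => by
      rw [← (h2 k).2]
      exact integral_mono (hsqi k) (h2 k).1 fun w => hsq _ (hτm k w) w)
  refine ⟨h3.1, tendsto_nhds_unique h3.2 ?_⟩
  refine tendsto_const_nhds.congr fun k => ?_
  exact (h1 k).2.symm

/-! ### Elementary inequalities for sums over dyadic scales -/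

section LogBound

/-- The terms vanish until `2 ^ (k + 1)` passes `y`; the first non-zero one is below `1`, and each
later one is half of the one before. -/
theorem sum_indicator_div_le {y : ℝ} (hy : 0 ≤ y) (N : ℕ) :
    ∑ k ∈ Finset.range N, (if y < 2 ^ (k + 1) then y / 2 ^ (k + 1) else 0) ≤ 2 := by
  -- For the induction, the claim is strengthened by the remainder `y / 2 ^ N` of the geometric
  -- series, unless no term is active yet.
  have key : (∑ k ∈ Finset.range N, (if y < 2 ^ (k + 1) then y / 2 ^ (k + 1) else 0)
      + y / 2 ^ N ≤ 2) ∨ ((∑ k ∈ Finset.range N, (if y < 2 ^ (k + 1) then y / 2 ^ (k + 1) else 0)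
        = 0) ∧ 2 ^ N ≤ y) := by
    induction N with
    | zero =>
      rcases le_total y 1 with h | h
      · left; simp; linarith
      · right; simpa using h
    | succ N ih =>
      rw [Finset.sum_range_succ]
      have h2 : y / 2 ^ (N + 1) + y / 2 ^ (N + 1) = y / 2 ^ N := by field_simp; ring
      have h0 : 0 ≤ y / 2 ^ (N + 1) := by positivity
      rcases ih with ih | ⟨ih, ih2⟩
      · left
        split_ifs <;> linarith
      · rw [ih]
        split_ifs with h
        · left
          have : y / 2 ^ N ≤ 2 := by
            rw [div_le_iff₀ (by positivity)]
            rw [pow_succ] at h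
            linarith
          linarith
        · right
          exact ⟨by simp, not_lt.1 h⟩
  have : 0 ≤ y / 2 ^ N := by positivity
  rcases key with h | ⟨h, -⟩ <;> linarith

theorem sum_inv_two_pow_le (N : ℕ) : ∑ k ∈ Finset.range N, ((2 : ℝ) ^ (k + 1))⁻¹ ≤ 1 := by
  have : ∑ k ∈ Finset.range N, ((2 : ℝ) ^ (k + 1))⁻¹ = 1 - (2 ^ N)⁻¹ := by
    induction N with
    | zero => simp
    | succ N ih =>
      rw [Finset.sum_range_succ, ih, pow_succ]
      field_simp
      ring
  rw [this]
  have : (0 : ℝ) ≤ (2 ^ N)⁻¹ := by positivity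
  linarith

/-- At scale `b = 2 ^ (k + 1)` the summand is at least `y - b`, since the exponential is positive,
and at least `-v / (2 b)`, by convexity. If `y ≥ 2 ^ (N + 1)`, every scale has `b ≤ y / 2` and
contributes at least `y / 2`. Otherwise the scales `b ≤ y` contribute non-negatively, and those
above `y` cost at most `κ (1 + y²) / (2 b)`, which sums to a multiple of `1 + y` because `∑ y / b ≤
2` there. Quadratic growth of `v` is the most this summation can absorb. -/
theorem le_sum_exp {y v κ : ℝ} (hy : 0 ≤ y) (hκ : 0 ≤ κ)
    (hv : v ≤ κ * (1 + y ^ 2)) (N : ℕ) :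
    (N / 2 : ℝ) * (if 2 ^ (N + 1) ≤ y then y else 0) - κ * (1 + y) ≤
      ∑ k ∈ Finset.range N,
        ((2 : ℝ) ^ (k + 1) * (Real.exp (-(y / 2 ^ (k + 1)) - v / (2 * (2 ^ (k + 1)) ^ 2)) - 1) + y)
      := by
  have hA : ∀ b : ℝ, 0 < b → y - b ≤ b * (Real.exp (-(y / b) - v / (2 * b ^ 2)) - 1) + y := by
    intro b hb
    nlinarith [Real.exp_pos (-(y / b) - v / (2 * b ^ 2))]
  have hB : ∀ b : ℝ, 0 < b →
      -(v / (2 * b)) ≤ b * (Real.exp (-(y / b) - v / (2 * b ^ 2)) - 1) + y := by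
    intro b hb
    have h := Real.add_one_le_exp (-(y / b) - v / (2 * b ^ 2))
    have h2 : b * (-(y / b) - v / (2 * b ^ 2)) ≤
        b * (Real.exp (-(y / b) - v / (2 * b ^ 2)) - 1) :=
      mul_le_mul_of_nonneg_left (by linarith) hb.le
    have h3 : b * (-(y / b) - v / (2 * b ^ 2)) = -y - v / (2 * b) := by field_simp
    linarith
  split_ifs with hN
  · calc (N / 2 : ℝ) * y - κ * (1 + y) ≤ ∑ k ∈ Finset.range N, y / 2 := by
          rw [Finset.sum_const, Finset.card_range, nsmul_eq_mul]
          have : 0 ≤ κ * (1 + y) := by positivity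
          linarith
      _ ≤ _ := by
          refine Finset.sum_le_sum fun k hk => ?_
          have hk' : k + 1 ≤ N := Finset.mem_range.1 hk
          have h1 : (2 : ℝ) ^ (k + 1) ≤ 2 ^ N := pow_le_pow_right₀ one_le_two hk'
          rw [pow_succ] at hN
          have := hA (2 ^ (k + 1)) (by positivity)
          linarith
  · rw [mul_zero, zero_sub]
    have h1 := sum_indicator_div_le hy N
    have h2 := sum_inv_two_pow_le N
    calc -(κ * (1 + y)) ≤ ∑ k ∈ Finset.range N, -(κ / 2 * (((2 : ℝ) ^ (k + 1))⁻¹ +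
          y * (if y < 2 ^ (k + 1) then y / 2 ^ (k + 1) else 0))) := by
          rw [Finset.sum_neg_distrib, ← Finset.mul_sum, Finset.sum_add_distrib, ← Finset.mul_sum]
          have h3 := mul_le_mul_of_nonneg_left h1 hy
          have h4 := mul_le_mul_of_nonneg_left (add_le_add h2 h3) (div_nonneg hκ zero_le_two)
          linarith
      _ ≤ _ := by
          refine Finset.sum_le_sum fun k _ => ?_
          have hb : (0 : ℝ) < 2 ^ (k + 1) := by positivity
          set b : ℝ := 2 ^ (k + 1)
          split_ifs with hyb
          · refine le_trans ?_ (hB b hb)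
            have : κ / 2 * (b⁻¹ + y * (y / b)) = κ * (1 + y ^ 2) / (2 * b) := by field_simp
            rw [this]
            gcongr
          · refine le_trans ?_ (hA b hb)
            have : 0 ≤ κ / 2 * (b⁻¹ + y * 0) := by positivity
            linarith [not_lt.1 hyb]

/-- This is `exp (-x) ≤ 1 - x + x²` for `x ≥ 0`. The bound is summable over dyadic `b`. -/
theorem mul_exp_neg_div_le {a b : ℝ} (ha : 0 ≤ a) (hb : 0 < b) :
    b * (Real.exp (-(a / b)) - 1) + a ≤ a ^ 2 * b⁻¹ := by
  have hx : 0 ≤ a / b := by positivity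
  have h : Real.exp (-(a / b)) ≤ 1 - a / b + (a / b) ^ 2 := by
    rcases le_total (a / b) 1 with h1 | h1
    · have := Real.abs_exp_sub_one_sub_id_le (x := -(a / b)) (by rw [abs_neg, abs_of_nonneg hx]; exact h1)
      have := (abs_le.1 this).2
      linarith [neg_sq (a / b)]
    · have : Real.exp (-(a / b)) ≤ 1 := Real.exp_le_one_iff.2 (by linarith)
      nlinarith
  calc b * (Real.exp (-(a / b)) - 1) + a ≤ b * ((1 - a / b + (a / b) ^ 2) - 1) + a := by gcongr
    _ = a ^ 2 * b⁻¹ := by field_simp; ring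

end LogBound

theorem integrable_cappedPassage {μ : Measure C(ℝ≥0, ℝ)} [IsFiniteMeasure μ] (c ν : ℝ)
    (f : C(ℝ≥0, ℝ≥0)) (a : ℝ) (m : ℝ≥0) :
    Integrable (fun w => (cappedPassage (levelPath c ν f w) a m : ℝ)) μ :=
  Integrable.of_bound (measurable_cappedPassage c ν f a m).coe_nnreal_real.aestronglyMeasurable
    (m : ℝ) (ae_of_all _ fun w => by
      rw [Real.norm_of_nonneg (NNReal.coe_nonneg _)]
      exact cappedPassage_le)

/-! ### Optional stopping at the capped passage, and the mean of the passage time -/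

section Passage

variable {μ : Measure C(ℝ≥0, ℝ)} [IsProbabilityMeasure μ]
  (hB : IsBrownianReal (fun t (w : C(ℝ≥0, ℝ)) => w t) μ)
  {f : C(ℝ≥0, ℝ≥0)} (hf : Monotone f) (hf0 : f 0 = 0)

include hB hf hf0

theorem integral_eval_cappedPassage (c ν a : ℝ) (m : ℝ≥0) :
    Integrable (fun w => w (f (cappedPassage (levelPath c ν f w) a m))) μ ∧
    ∫ w, w (f (cappedPassage (levelPath c ν f w) a m)) ∂μ = 0 := by
  -- The dominating martingale comes from `w² ≤ 2 (exp w + exp (-w))`; the factor `exp (f m / 2)`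
  -- undoes the compensators up to time `f m`.
  have h := integral_cappedPassage (isPathMartingale_eval hB)
    (((isPathMartingale_exp hB 1).add (isPathMartingale_exp hB (-1))).const_mul
      (2 * Real.exp (f m / 2))) (fun w => w.continuous) hf c ν a m ?_
  · rw [hf0, hB.integral_eval 0] at h
    exact h
  · intro t ht w
    have ht' : (t : ℝ) ≤ f m := ht
    have h1 : Real.exp (w t) ≤ Real.exp (f m / 2) * Real.exp (1 * w t - 1 ^ 2 * t / 2) := by
      rw [← Real.exp_add]
      apply Real.exp_le_exp.2
      linarith
    have h2 : Real.exp (-w t) ≤ Real.exp (f m / 2) * Real.exp (-1 * w t - (-1) ^ 2 * t / 2) := by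
      rw [← Real.exp_add]
      apply Real.exp_le_exp.2
      linarith
    rw [mul_assoc, mul_add]
    refine le_trans ?_ (mul_le_mul_of_nonneg_left (add_le_add h1 h2) zero_le_two)
    rcases le_total 0 (w t) with h | h
    · have := Real.quadratic_le_exp_of_nonneg h
      linarith [Real.exp_pos (-w t)]
    · have := Real.quadratic_le_exp_of_nonneg (neg_nonneg.2 h)
      linarith [Real.exp_pos (w t), neg_sq (w t)]

theorem integral_exp_cappedPassage (c ν a : ℝ) (m : ℝ≥0) (θ : ℝ) :
    Integrable (fun w => Real.exp (θ * w (f (cappedPassage (levelPath c ν f w) a m)) -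
      θ ^ 2 * f (cappedPassage (levelPath c ν f w) a m) / 2)) μ ∧
    ∫ w, Real.exp (θ * w (f (cappedPassage (levelPath c ν f w) a m)) -
      θ ^ 2 * f (cappedPassage (levelPath c ν f w) a m) / 2) ∂μ = 1 := by
  -- The square of the exponential martingale at `θ` is `exp (θ² t)` times the one at `2θ`.
  have h := integral_cappedPassage (isPathMartingale_exp hB θ)
    ((isPathMartingale_exp hB (2 * θ)).const_mul (Real.exp (θ ^ 2 * f m))) (fun w => by fun_prop)
    hf c ν a m ?_
  · refine ⟨h.1, h.2.trans ?_⟩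
    rw [hf0]
    have : (fun w : C(ℝ≥0, ℝ) => Real.exp (θ * w 0 - θ ^ 2 * (0 : ℝ≥0) / 2)) =ᵐ[μ]
        fun _ => (1 : ℝ) := by
      filter_upwards [hB.eval_zero_ae_eq_zero] with w hw
      rw [hw]
      simp
    rw [integral_congr_ae this]
    simp
  · intro t ht w
    have ht' : (t : ℝ) ≤ f m := ht
    rw [← Real.exp_add, ← Real.exp_nat_mul]
    apply Real.exp_le_exp.2
    push_cast
    nlinarith [mul_le_mul_of_nonneg_left ht' (sq_nonneg θ)]

variable {c ν a C : ℝ} (hc : 1 ≤ c) (ha : 0 ≤ a)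
  (hC : ∀ x, (f x : ℝ) ≤ C * (1 + (x : ℝ) ^ 2))

omit [IsProbabilityMeasure μ] hf in
theorem ae_levelPath_zero_le (c ν : ℝ) (ha : 0 ≤ a) : ∀ᵐ w ∂μ, levelPath c ν f w 0 ≤ a := by
  filter_upwards [hB.eval_zero_ae_eq_zero] with w hw
  simpa [levelPath, hf0, hw] using ha

include hc ha hC

/-- A logarithmic moment bound, which makes the truncated martingales uniformly integrable. -/
theorem integral_indicator_cappedPassage_le (m : ℝ≥0) (N : ℕ) :
    ∫ w, (N / 2 : ℝ) * (if 2 ^ (N + 1) ≤ a + ν * w (f (cappedPassage (levelPath c ν f w) a m))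
      then a + ν * w (f (cappedPassage (levelPath c ν f w) a m)) else 0) ∂μ ≤
    a ^ 2 + ν ^ 2 * C * (1 + a) := by
  obtain ⟨hi1, he1⟩ := integral_eval_cappedPassage hB hf hf0 c ν a m
  set ρ : C(ℝ≥0, ℝ) → ℝ≥0 := fun w => cappedPassage (levelPath c ν f w) a m with hρ
  set Y : C(ℝ≥0, ℝ) → ℝ := fun w => a + ν * w (f (ρ w)) with hY
  have hYi : Integrable Y μ := (integrable_const a).add (hi1.const_mul ν)
  have hYe : ∫ w, Y w ∂μ = a := by
    rw [hY, integral_add (integrable_const a) (hi1.const_mul ν), integral_const_mul, he1]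
    simp
  -- The level path is at most `a` at the capped passage and `c ≥ 1`. Hence `0 ≤ ρ ≤ Y`, and growth
  -- of `f` in `ρ` becomes growth in `Y`.
  have hYb : ∀ᵐ w ∂μ, (ρ w : ℝ) ≤ Y w := by
    filter_upwards [ae_levelPath_zero_le hB hf0 c ν ha] with w hw
    have h1 := apply_cappedPassage_le (m := m) (continuous_levelPath c ν f w) hw
    have h2 : c * (ρ w : ℝ) - ν * w (f (ρ w)) ≤ a := h1
    have : (0 : ℝ) ≤ ρ w := (ρ w).2
    simp only [hY]
    nlinarith
  set q : ℕ → C(ℝ≥0, ℝ) → ℝ := fun k w => (2 : ℝ) ^ (k + 1) *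
    (Real.exp (-(Y w / 2 ^ (k + 1)) - ν ^ 2 * f (ρ w) / (2 * (2 ^ (k + 1)) ^ 2)) - 1) + Y w with hq
  -- Up to the factor `exp (-a / b)` with `b = 2 ^ (k + 1)`, this is the exponential martingale at
  -- `θ = -ν / b`, whose stopped mean is `1`. So `q k` has mean `b (exp (-a / b) - 1) + a`.
  have hqexp : ∀ k : ℕ, (fun w => Real.exp (-(Y w / 2 ^ (k + 1)) -
      ν ^ 2 * f (ρ w) / (2 * (2 ^ (k + 1)) ^ 2))) = fun w => Real.exp (-(a / 2 ^ (k + 1))) *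
      Real.exp (-(ν / 2 ^ (k + 1)) * w (f (ρ w)) - (-(ν / 2 ^ (k + 1))) ^ 2 * f (ρ w) / 2) := by
    intro k
    ext w
    rw [← Real.exp_add]
    congr 1
    simp only [hY]
    field_simp
    ring
  have hqi : ∀ k, Integrable (q k) μ := by
    intro k
    refine Integrable.add (Integrable.const_mul (Integrable.sub ?_ (integrable_const _)) _) hYi
    rw [hqexp]
    exact (integral_exp_cappedPassage hB hf hf0 c ν a m _).1.const_mul _
  have hqe : ∀ k, ∫ w, q k w ∂μ ≤ a ^ 2 * ((2 : ℝ) ^ (k + 1))⁻¹ := by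
    intro k
    have h1 : Integrable (fun w => Real.exp (-(Y w / 2 ^ (k + 1)) -
        ν ^ 2 * f (ρ w) / (2 * (2 ^ (k + 1)) ^ 2))) μ := by
      rw [hqexp]
      exact (integral_exp_cappedPassage hB hf hf0 c ν a m _).1.const_mul _
    simp only [hq]
    have h2 : Integrable (fun w => (2 : ℝ) ^ (k + 1) * (Real.exp (-(Y w / 2 ^ (k + 1)) -
        ν ^ 2 * f (ρ w) / (2 * (2 ^ (k + 1)) ^ 2)) - 1)) μ :=
      (h1.sub (integrable_const _)).const_mul _
    rw [integral_add h2 hYi, integral_const_mul,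
      integral_sub h1 (integrable_const _), hYe, hqexp, integral_const_mul,
      (integral_exp_cappedPassage hB hf hf0 c ν a m _).2]
    simpa using mul_exp_neg_div_le (b := 2 ^ (k + 1)) ha (by positivity)
  have hC0 : 0 ≤ C := by
    have := hC 0
    rw [hf0] at this
    simpa using this
  -- The inequality `le_sum_exp` with `v = ν² f(ρ)` and `κ = ν² C`.
  have hlow : ∀ᵐ w ∂μ, (N / 2 : ℝ) * (if 2 ^ (N + 1) ≤ Y w then Y w else 0) ≤
      ∑ k ∈ Finset.range N, q k w + ν ^ 2 * C * (1 + Y w) := by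
    filter_upwards [hYb] with w hw
    have h0 : (0 : ℝ) ≤ ρ w := (ρ w).2
    have hv : ν ^ 2 * (f (ρ w) : ℝ) ≤ ν ^ 2 * C * (1 + Y w ^ 2) := by
      rw [mul_assoc]
      gcongr
      refine (hC _).trans ?_
      gcongr
    have := le_sum_exp (h0.trans hw) (by positivity) hv N
    linarith
  have hY1 : Integrable (fun w => ν ^ 2 * C * (1 + Y w)) μ :=
    ((integrable_const _).add hYi).const_mul _
  have hsum : Integrable (fun w => ∑ k ∈ Finset.range N, q k w + ν ^ 2 * C * (1 + Y w)) μ :=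
    (integrable_finsetSum _ fun k _ => hqi k).add hY1
  calc ∫ w, (N / 2 : ℝ) * (if 2 ^ (N + 1) ≤ Y w then Y w else 0) ∂μ
      ≤ ∫ w, (∑ k ∈ Finset.range N, q k w + ν ^ 2 * C * (1 + Y w)) ∂μ := by
        refine integral_mono_of_nonneg ?_ hsum hlow
        filter_upwards [hYb] with w hw
        have h0 : (0 : ℝ) ≤ ρ w := (ρ w).2
        have : 0 ≤ Y w := h0.trans hw
        simp only [Pi.zero_apply]
        positivity
    _ = ∑ k ∈ Finset.range N, ∫ w, q k w ∂μ + ν ^ 2 * C * (1 + a) := by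
        rw [integral_add (integrable_finsetSum _ fun k _ => hqi k) hY1,
          integral_finsetSum _ fun k _ => hqi k, integral_const_mul,
          integral_add (integrable_const _) hYi, hYe]
        simp
    _ ≤ ∑ k ∈ Finset.range N, a ^ 2 * ((2 : ℝ) ^ (k + 1))⁻¹ + ν ^ 2 * C * (1 + a) := by
        gcongr with k
        exact hqe k
    _ ≤ a ^ 2 + ν ^ 2 * C * (1 + a) := by
        rw [← Finset.mul_sum]
        have := mul_le_mul_of_nonneg_left (sum_inv_two_pow_le N) (sq_nonneg a)
        linarith

omit hC in
-- At the capped passage `c ρ ≤ a + ν W_{f(ρ)}`, and the right side has mean `a`. This half needs no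
-- growth condition on `f`.
theorem integral_cappedPassage_le (m : ℝ≥0) :
    ∫ w, (cappedPassage (levelPath c ν f w) a m : ℝ) ∂μ ≤ a / c := by
  obtain ⟨hi1, he1⟩ := integral_eval_cappedPassage hB hf hf0 c ν a m
  rw [le_div_iff₀' (by linarith), ← integral_const_mul]
  calc ∫ w, c * (cappedPassage (levelPath c ν f w) a m : ℝ) ∂μ
      ≤ ∫ w, (a + ν * w (f (cappedPassage (levelPath c ν f w) a m))) ∂μ := by
        refine integral_mono_ae ((integrable_cappedPassage c ν f a m).const_mul c)
          ((integrable_const a).add (hi1.const_mul ν)) ?_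
        filter_upwards [ae_levelPath_zero_le hB hf0 c ν ha] with w hw
        have h1 := apply_cappedPassage_le (m := m) (continuous_levelPath c ν f w) hw
        rw [levelPath] at h1
        linarith
    _ = a := by
        rw [integral_add (integrable_const a) (hi1.const_mul ν), integral_const_mul, he1]
        simp

/-- Write `Y = a + ν W_{f(ρ)}`, of mean `a`. If the passage comes before the cap, then `c ρ = Y`. If
it is capped, then `Y ≥ c ρ ≥ 2 ^ (N + 1)`. So the deficit is at most the mean of `Y` on `Y ≥ 2 ^ (N
+ 1)`, which the logarithmic bound makes `O(1 / N)`. -/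
theorem le_integral_cappedPassage {N : ℕ} (hN : 0 < N) :
    a - (a ^ 2 + ν ^ 2 * C * (1 + a)) * 2 / N ≤
      c * ∫ w, (cappedPassage (levelPath c ν f w) a (2 ^ (N + 1)) : ℝ) ∂μ := by
  set m : ℝ≥0 := 2 ^ (N + 1) with hm
  obtain ⟨hi1, he1⟩ := integral_eval_cappedPassage hB hf hf0 c ν a m
  have h := integral_indicator_cappedPassage_le (ν := ν) hB hf hf0 hc ha hC m N
  set ρ : C(ℝ≥0, ℝ) → ℝ≥0 := fun w => cappedPassage (levelPath c ν f w) a m with hρ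
  set Y : C(ℝ≥0, ℝ) → ℝ := fun w => a + ν * w (f (ρ w)) with hY
  have hYi : Integrable Y μ := (integrable_const a).add (hi1.const_mul ν)
  have hYe : ∫ w, Y w ∂μ = a := by
    rw [hY, integral_add (integrable_const a) (hi1.const_mul ν), integral_const_mul, he1]
    simp
  have hYind : Integrable (fun w => if 2 ^ (N + 1) ≤ Y w then Y w else 0) μ :=
    hYi.indicator₀ (nullMeasurableSet_le aemeasurable_const hYi.aemeasurable)
  rw [integral_const_mul] at h
  have h1 : a - ∫ w, (if 2 ^ (N + 1) ≤ Y w then Y w else 0) ∂μ ≤ c * ∫ w, (ρ w : ℝ) ∂μ := by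
    rw [← integral_const_mul]
    nth_rw 1 [← hYe]
    rw [← integral_sub hYi hYind]
    refine integral_mono_ae (hYi.sub hYind) ((integrable_cappedPassage c ν f a m).const_mul c) ?_
    filter_upwards [ae_levelPath_zero_le hB hf0 c ν ha] with w hw
    have h2 := apply_cappedPassage_le (m := m) (continuous_levelPath c ν f w) hw
    have h0 : (0 : ℝ) ≤ ρ w := (ρ w).2
    have hYw : Y w = a + ν * w (f (ρ w)) := rfl
    have h2' : c * (ρ w : ℝ) - ν * w (f (ρ w)) ≤ a := h2
    rcases (cappedPassage_le (z := levelPath c ν f w) (a := a) (m := m)).lt_or_eq with h3 | h3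
    · have h4 : ∃ s, a < levelPath c ν f w s := by
        obtain ⟨r, hr, h5 | h5⟩ := exists_lt_of_cappedPassage_lt h3
        · exact ⟨r, h5⟩
        · exact absurd hr h5.not_gt
      have h6 := cappedPassage_eq_min (m := m) h4
      have h7 : ρ w = passage (levelPath c ν f w) a := by
        rcases min_choice (passage (levelPath c ν f w) a) m with h8 | h8
        · exact h6.trans h8
        · exact absurd (h6.trans h8) h3.ne
      have h8 := apply_passage (continuous_levelPath c ν f w) hw h4
      rw [← h7] at h8
      have h9 : c * (ρ w : ℝ) - ν * w (f (ρ w)) = a := h8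
      split_ifs with h10
      · nlinarith
      · linarith
    · have h4 : (ρ w : ℝ) = 2 ^ (N + 1) := by
        have : ρ w = m := h3
        rw [this, hm]
        simp
      have h5 : 2 ^ (N + 1) ≤ Y w := by
        rw [← h4]
        nlinarith
      rw [if_pos h5]
      nlinarith
  have hN' : (0 : ℝ) < N := by exact_mod_cast hN
  have h2 : ∫ w, (if 2 ^ (N + 1) ≤ Y w then Y w else 0) ∂μ ≤
      (a ^ 2 + ν ^ 2 * C * (1 + a)) * 2 / N := by
    rw [le_div_iff₀ hN']
    linarith
  linarith

omit hC in
-- Where the level is never exceeded, the capped passage equals the cap `m`; its mean is at most `a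
-- / c` for every `m`, so that event is null.
theorem ae_exists_lt_levelPath : ∀ᵐ w ∂μ, ∃ s, a < levelPath c ν f w s := by
  have hm := measurableSet_forall_levelPath c ν f a
  set A := {w | ∀ s, levelPath c ν f w s ≤ a} with hA
  have h1 : ∀ m : ℕ, m * μ.real A ≤ a / c := by
    intro m
    refine le_trans ?_ (integral_cappedPassage_le (μ := μ) (ν := ν) hB hf hf0 hc ha m)
    have : (m : ℝ) * μ.real A = ∫ w, A.indicator (fun _ => (m : ℝ)) w ∂μ := by
      rw [integral_indicator hm]
      simp [mul_comm]
    rw [this]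
    refine integral_mono ((integrable_const _).indicator hm)
      (integrable_cappedPassage c ν f a m) fun w => ?_
    by_cases hw : w ∈ A
    · rw [indicator_of_mem hw]
      have : (m : ℝ≥0) ≤ cappedPassage (levelPath c ν f w) a m := by
        refine le_csInf ⟨m, Or.inr le_rfl⟩ ?_
        rintro s (hs | hs)
        · exact absurd (hw s) hs.not_ge
        · exact hs
      exact_mod_cast this
    · rw [indicator_of_notMem hw]
      positivity
  have h2 : μ.real A = 0 := by
    by_contra h
    have hpos : 0 < μ.real A := lt_of_le_of_ne measureReal_nonneg (Ne.symm h)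
    obtain ⟨m, hm⟩ := exists_nat_gt (a / c / μ.real A)
    rw [div_lt_iff₀ hpos] at hm
    exact absurd (h1 m) hm.not_ge
  have h3 : μ A = 0 := (measureReal_eq_zero_iff (measure_ne_top _ _)).1 h2
  refine (measure_eq_zero_iff_ae_notMem.1 h3).mono fun w hw => ?_
  simpa [hA] using hw

/-- The mean of the first passage time. -/
theorem lintegral_passage :
    ∫⁻ w, (passage (levelPath c ν f w) a : ℝ≥0∞) ∂μ = ENNReal.ofReal (a / c) := by
  have h1 : Tendsto (fun N : ℕ => ∫⁻ w, (cappedPassage (levelPath c ν f w) a (2 ^ (N + 1)) : ℝ≥0∞)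
      ∂μ) atTop (𝓝 (∫⁻ w, (passage (levelPath c ν f w) a : ℝ≥0∞) ∂μ)) := by
    refine lintegral_tendsto_of_tendsto_of_monotone (fun N => ?_) ?_ ?_
    · exact (measurable_cappedPassage c ν f a _).coe_nnreal_ennreal.aemeasurable
    · filter_upwards [ae_exists_lt_levelPath (μ := μ) (ν := ν) hB hf hf0 hc ha] with w hw
      intro M N hMN
      simp only [cappedPassage_eq_min hw]
      gcongr
      exact one_le_two
    · filter_upwards [ae_exists_lt_levelPath (μ := μ) (ν := ν) hB hf hf0 hc ha] with w hw
      simp only [cappedPassage_eq_min hw]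
      refine tendsto_const_nhds.congr' ?_
      have h2 : Tendsto (fun N : ℕ => (2 : ℝ≥0) ^ (N + 1)) atTop atTop :=
        (tendsto_pow_atTop_atTop_of_one_lt one_lt_two).comp (tendsto_add_atTop_nat 1)
      filter_upwards [h2.eventually_ge_atTop (passage (levelPath c ν f w) a)] with N hN
      rw [min_eq_left hN]
  refine tendsto_nhds_unique h1 ?_
  have h2 : ∀ N : ℕ, ∫⁻ w, (cappedPassage (levelPath c ν f w) a (2 ^ (N + 1)) : ℝ≥0∞) ∂μ =
      ENNReal.ofReal (∫ w, (cappedPassage (levelPath c ν f w) a (2 ^ (N + 1)) : ℝ) ∂μ) := by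
    intro N
    rw [ofReal_integral_eq_lintegral_ofReal (integrable_cappedPassage c ν f a _)
      (ae_of_all _ fun w => NNReal.coe_nonneg _)]
    simp
  simp only [h2]
  refine ENNReal.tendsto_ofReal ?_
  have hc0 : 0 < c := by linarith
  refine tendsto_of_tendsto_of_tendsto_of_le_of_le'
    (g := fun N : ℕ => (a - (a ^ 2 + ν ^ 2 * C * (1 + a)) * 2 / N) / c) ?_ tendsto_const_nhds ?_
    (Eventually.of_forall fun N => integral_cappedPassage_le hB hf hf0 hc ha _)
  · have := ((tendsto_const_div_atTop_nhds_zero_nat ((a ^ 2 + ν ^ 2 * C * (1 + a)) * 2)).const_sub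
      a).div_const c
    simpa using this
  · filter_upwards [eventually_gt_atTop 0] with N hN
    rw [div_le_iff₀' hc0]
    exact le_integral_cappedPassage hB hf hf0 hc ha hC hN

theorem integrable_passage : Integrable (fun w => (passage (levelPath c ν f w) a : ℝ)) μ := by
  refine ⟨(measurable_passage c ν f a).coe_nnreal_real.aestronglyMeasurable, ?_⟩
  rw [hasFiniteIntegral_iff_enorm]
  simp only [Real.enorm_eq_ofReal (NNReal.coe_nonneg _), ENNReal.ofReal_coe_nnreal]
  rw [lintegral_passage hB hf hf0 hc ha hC]
  exact ENNReal.ofReal_lt_top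

theorem integral_passage : ∫ w, (passage (levelPath c ν f w) a : ℝ) ∂μ = a / c := by
  rw [integral_eq_lintegral_of_nonneg_ae (ae_of_all _ fun w => NNReal.coe_nonneg _)
    (measurable_passage c ν f a).coe_nnreal_real.aestronglyMeasurable]
  simp only [ENNReal.ofReal_coe_nnreal]
  rw [lintegral_passage hB hf hf0 hc ha hC, ENNReal.toReal_ofReal (by positivity)]

end Passage

/-! ### Parametric representations of non-decreasing paths -/

namespace IncPath

variable {T : ℝ}

theorem left_le (x : IncPath T) (t : Icc (0 : ℝ) T) : x.left t ≤ x t := x.mono.leftLim_le le_rfl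

theorem le_left (x : IncPath T) {s t : Icc (0 : ℝ) T} (h : s < t) : x s ≤ x.left t :=
  x.mono.le_leftLim h

theorem nhdsLT_eq_bot_or (t : Icc (0 : ℝ) T) : (𝓝[<] t).NeBot ∨ ∀ s, t ≤ s := by
  by_cases h : ∃ s, s < t
  · exact Or.inl (nhdsLT_neBot_of_exists_lt h)
  · right
    push Not at h
    exact h

theorem left_eq_of_isBot (x : IncPath T) {t : Icc (0 : ℝ) T} (h : ∀ s, t ≤ s) :
    x.left t = x t := by
  apply x.left_of_eq_bot
  have : Iio t = ∅ := by
    ext s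
    simpa using h s
  rw [this, nhdsWithin_empty]

theorem left_nonneg (x : IncPath T) (t : Icc (0 : ℝ) T) : 0 ≤ x.left t := by
  rcases nhdsLT_eq_bot_or t with h | h
  · exact ge_of_tendsto (x.tendsto_left t) (Eventually.of_forall fun s => x.nonneg s)
  · rw [x.left_eq_of_isBot h]
    exact x.nonneg t

theorem mem_completedGraph {x : IncPath T} {p : Icc (0 : ℝ) T × ℝ} :
    p ∈ x.completedGraph ↔ x.left p.1 ≤ p.2 ∧ p.2 ≤ x p.1 := by
  show p.2 ∈ uIcc (x.left p.1) (x p.1) ↔ _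
  rw [uIcc_of_le (x.left_le _)]
  rfl

/-- The infimum of the times at which `t + x t` reaches `v` is attained, by right-continuity. -/
theorem exists_graphTime (x : IncPath T) {v : ℝ} {b : Icc (0 : ℝ) T} (hv : v ≤ b + x b) :
    ∃ r : Icc (0 : ℝ) T, v ≤ r + x r ∧ ∀ t < r, t + x t < v := by
  set S : Set ℝ := {t | ∃ h : t ∈ Icc (0 : ℝ) T, v ≤ t + x ⟨t, h⟩} with hS
  have hSne : S.Nonempty := ⟨b, b.2, hv⟩
  have hSb : BddBelow S := ⟨0, fun t ht => ht.1.1⟩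
  have hmem : sInf S ∈ Icc (0 : ℝ) T :=
    ⟨le_csInf hSne fun t ht => ht.1.1, (csInf_le hSb ⟨b.2, hv⟩).trans b.2.2⟩
  refine ⟨⟨sInf S, hmem⟩, ?_, fun t ht => ?_⟩
  · by_contra! hlt
    have hcont : ContinuousWithinAt (fun t : Icc (0 : ℝ) T => (t : ℝ) + x t) (Ici ⟨sInf S, hmem⟩)
        ⟨sInf S, hmem⟩ :=
      continuous_subtype_val.continuousWithinAt.add (x.right_continuous _)
    have h1 := hcont.eventually_lt_const hlt
    obtain ⟨u, hu, hu2⟩ := Metric.mem_nhdsWithin_iff.1 h1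
    obtain ⟨s, hs, hsu⟩ := exists_lt_of_csInf_lt hSne (lt_add_of_pos_right (sInf S) hu)
    obtain ⟨hsI, hsv⟩ := hs
    have hle : sInf S ≤ s := csInf_le hSb ⟨hsI, hsv⟩
    have hsm : (⟨s, hsI⟩ : Icc (0 : ℝ) T) ∈ Metric.ball ⟨sInf S, hmem⟩ u ∩ Ici ⟨sInf S, hmem⟩ := by
      refine ⟨?_, (show (⟨sInf S, hmem⟩ : Icc (0 : ℝ) T) ≤ ⟨s, hsI⟩ from hle)⟩
      rw [Metric.mem_ball, Subtype.dist_eq, Real.dist_eq, abs_of_nonneg (sub_nonneg.2 hle)]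
      linarith
    exact absurd hsv (not_le.2 (hu2 hsm))
  · by_contra! hle
    exact (csInf_le hSb ⟨t.2, hle⟩).not_gt ht

/-- Points of the completed graph, ordered by the sum of their coordinates. -/
theorem graph_mono {x : IncPath T} {p q : Icc (0 : ℝ) T × ℝ} (hp : p ∈ x.completedGraph)
    (hq : q ∈ x.completedGraph) (h : (p.1 : ℝ) + p.2 ≤ q.1 + q.2) : p.1 ≤ q.1 ∧ p.2 ≤ q.2 := by
  rw [mem_completedGraph] at hp hq
  rcases lt_trichotomy p.1 q.1 with h1 | h1 | h1
  · exact ⟨h1.le, hp.2.trans ((x.le_left h1).trans hq.1)⟩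
  · refine ⟨h1.le, ?_⟩
    rw [h1] at h
    linarith
  · have h2 : q.2 ≤ p.2 := hq.2.trans ((x.le_left h1).trans hp.1)
    have h3 : (q.1 : ℝ) < p.1 := h1
    linarith

/-- The anti-diagonal of sum `v` meets the completed graph above the first time `r` with `r + x r ≥
v`: before `r` the sum stays below `v`, so `x(r-) ≤ v - r ≤ x r`. -/
theorem exists_mem_completedGraph (x : IncPath T) {v : ℝ} {a b : Icc (0 : ℝ) T} (ha : ∀ s, a ≤ s)
    (hav : a + x a ≤ v) (hv : v ≤ b + x b) : ∃ p ∈ x.completedGraph, (p.1 : ℝ) + p.2 = v := by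
  obtain ⟨r, hr, hr2⟩ := x.exists_graphTime hv
  refine ⟨(r, v - r), mem_completedGraph.2 ⟨?_, by simp only; linarith⟩, by simp⟩
  rcases nhdsLT_eq_bot_or r with h | h
  · have h1 : Tendsto (fun t : Icc (0 : ℝ) T => v - t) (𝓝[<] r) (𝓝 (v - r)) :=
      (continuous_const.sub continuous_subtype_val).continuousWithinAt
    refine le_of_tendsto_of_tendsto (x.tendsto_left r) h1 ?_
    filter_upwards [self_mem_nhdsWithin] with t ht
    have := hr2 t ht
    linarith
  · rw [x.left_eq_of_isBot h]
    have : r = a := le_antisymm (h a) (ha r)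
    rw [this]
    simp only
    linarith

/-- Two non-decreasing paths which are close at the end points and on a grid have close parametric
representations. -/
theorem graph_close {x y : IncPath T} {p q : Icc (0 : ℝ) T × ℝ} (hp : p ∈ x.completedGraph)
    (hq : q ∈ y.completedGraph) {ε : ℝ} (h : |((p.1 : ℝ) + p.2) - (q.1 + q.2)| ≤ ε)
    {A : Set (Icc (0 : ℝ) T)}
    (hA : ∀ r r' : Icc (0 : ℝ) T, (r : ℝ) + ε ≤ r' → ∃ t ∈ A, r ≤ t ∧ t < r')
    (hAxy : ∀ t ∈ A, |x t - y t| ≤ ε) : |(p.1 : ℝ) - q.1| ≤ 2 * ε ∧ |p.2 - q.2| ≤ 3 * ε := by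
  have hε : 0 ≤ ε := (abs_nonneg _).trans h
  have key : |(p.1 : ℝ) - q.1| ≤ 2 * ε := by
    rw [mem_completedGraph] at hp hq
    have h' := abs_le.1 h
    rw [abs_le]
    constructor
    -- A comparison time `t` between the two abscissae gives `p.2 ≤ x t ≤ y t + ε ≤ q.2 + ε`. With
    -- `p.1 < q.1 - 2 ε` the sums of coordinates would then differ by more than `ε`.
    · by_contra! h1
      obtain ⟨t, ht, h2, h3⟩ := hA p.1 q.1 (by linarith)
      have h4 := abs_le.1 (hAxy t ht)
      have h5 : x p.1 ≤ x t := x.mono h2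
      have h6 := y.le_left h3
      linarith
    · by_contra! h1
      obtain ⟨t, ht, h2, h3⟩ := hA q.1 p.1 (by linarith)
      have h4 := abs_le.1 (hAxy t ht)
      have h5 : y q.1 ≤ y t := y.mono h2
      have h6 := x.le_left h3
      linarith
  refine ⟨key, ?_⟩
  have h1 := abs_le.1 h
  have h2 := abs_le.1 key
  rw [abs_le]
  constructor <;> linarith

/-- Each point of the completed graph is determined by the sum of its coordinates, and both
coordinates increase with that sum. Letting the sum run affinely in `i` therefore gives a Lipschitz
representation. -/
theorem exists_isParamRep (x : IncPath T) {a b : Icc (0 : ℝ) T} (ha : ∀ s, a ≤ s)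
    (hb : ∀ s, s ≤ b) : ∃ γ : C(unitInterval, Icc (0 : ℝ) T × ℝ), x.IsParamRep γ ∧
      ∀ i, ((γ i).1 : ℝ) + (γ i).2 = (1 - i) * (a + x a) + i * (b + x b) := by
  have hab : (a : ℝ) + x a ≤ b + x b := add_le_add (ha b) (x.mono (ha b))
  have hv : ∀ i : unitInterval, ∃ p ∈ x.completedGraph,
      ((p.1 : ℝ) + p.2) = (1 - i) * (a + x a) + i * (b + x b) := by
    intro i
    have h0 := i.2.1
    have h1 := i.2.2
    apply x.exists_mem_completedGraph ha (b := b) <;> nlinarith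
  choose γ hγ hγv using hv
  have hmono : ∀ i j : unitInterval, i ≤ j → (γ i).1 ≤ (γ j).1 ∧ (γ i).2 ≤ (γ j).2 := by
    intro i j hij
    refine graph_mono (hγ i) (hγ j) ?_
    rw [hγv, hγv]
    have : (i : ℝ) ≤ j := hij
    nlinarith
  have hdist : ∀ i j : unitInterval,
      dist (γ i) (γ j) ≤ (b + x b - (a + x a)) * dist i j := by
    have key : ∀ i j : unitInterval, i ≤ j → dist (γ i) (γ j) ≤
        (b + x b - (a + x a)) * dist i j := by
      intro i j hij
      obtain ⟨h1, h2⟩ := hmono i j hij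
      have h1' : ((γ i).1 : ℝ) ≤ (γ j).1 := h1
      have hi := hγv i
      have hj := hγv j
      have h3 : (i : ℝ) ≤ j := hij
      rw [Subtype.dist_eq, Real.dist_eq, abs_of_nonpos (by linarith)]
      rw [Prod.dist_eq, Subtype.dist_eq, Real.dist_eq, Real.dist_eq, abs_of_nonpos (by linarith),
        abs_of_nonpos (by linarith)]
      apply max_le <;> nlinarith
    intro i j
    rcases le_total i j with h | h
    · exact key i j h
    · rw [dist_comm (γ i), dist_comm i]
      exact key j i h
  have hcont : Continuous γ :=
    (LipschitzWith.of_dist_le_mul (K := ⟨b + x b - (a + x a), by linarith⟩) hdist).continuous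
  refine ⟨⟨γ, hcont⟩, ⟨?_, ?_⟩, hγv⟩
  · apply Subset.antisymm
    · rintro _ ⟨i, rfl⟩
      exact hγ i
    · intro p hp
      have hp' := mem_completedGraph.1 hp
      have h1 : (a : ℝ) + x a ≤ p.1 + p.2 := by
        have h2 : (a : ℝ) ≤ p.1 := ha p.1
        rcases (ha p.1).lt_or_eq with h3 | h3
        · linarith [x.le_left h3]
        · have := x.left_eq_of_isBot ha
          rw [h3] at this ⊢
          linarith
      have h2 : (p.1 : ℝ) + p.2 ≤ b + x b := by
        have h3 : (p.1 : ℝ) ≤ b := hb p.1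
        linarith [x.mono (hb p.1)]
      obtain ⟨i, hi⟩ : ∃ i : unitInterval,
          (p.1 : ℝ) + p.2 = (1 - i) * (a + x a) + i * (b + x b) := by
        rcases hab.lt_or_eq with h3 | h3
        · refine ⟨⟨(p.1 + p.2 - (a + x a)) / (b + x b - (a + x a)), ?_, ?_⟩, ?_⟩
          · exact div_nonneg (by linarith) (by linarith)
          · rw [div_le_one (by linarith)]
            linarith
          · have : (b : ℝ) + x b - (a + x a) ≠ 0 := by linarith
            simp only
            field_simp
            ring
        · exact ⟨0, by simp; linarith⟩
      refine ⟨i, ?_⟩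
      have h3 := graph_mono (hγ i) hp (by rw [hγv, hi])
      have h4 := graph_mono hp (hγ i) (by rw [hγv, hi])
      exact Prod.ext (le_antisymm h3.1 h4.1) (le_antisymm h3.2 h4.2)
  · intro i j hij
    obtain ⟨h1, h2⟩ := hmono i j hij
    rcases h1.lt_or_eq with h3 | h3
    · exact Or.inl h3
    · refine Or.inr ⟨h3, ?_⟩
      have h4 := (mem_completedGraph.1 (hγ i)).1
      show |(γ i).2 - x.left (γ i).1| ≤ |(γ j).2 - x.left (γ i).1|
      rw [abs_of_nonneg (by linarith), abs_of_nonneg (by linarith)]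
      linarith

/-- Both representations run affinely in the sum of coordinates, so at equal parameters the sums
differ by no more than the end point values do, and `graph_close` applies. -/
theorem exists_paramRep_close {x y : IncPath T} {a b : Icc (0 : ℝ) T} (ha : ∀ s, a ≤ s)
    (hb : ∀ s, s ≤ b) {ε : ℝ} {A : Set (Icc (0 : ℝ) T)}
    (hA : ∀ r r' : Icc (0 : ℝ) T, (r : ℝ) + ε ≤ r' → ∃ t ∈ A, r ≤ t ∧ t < r')
    (hAxy : ∀ t ∈ A, |x t - y t| ≤ ε) (hxa : |x a - y a| ≤ ε) (hxb : |x b - y b| ≤ ε) :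
    ∃ γ γ' : C(unitInterval, Icc (0 : ℝ) T × ℝ), x.IsParamRep γ ∧ y.IsParamRep γ' ∧
      ∀ i, dist (γ i) (γ' i) ≤ 3 * ε := by
  have hε : 0 ≤ ε := (abs_nonneg _).trans hxa
  obtain ⟨γ, hγ, hγv⟩ := x.exists_isParamRep ha hb
  obtain ⟨γ', hγ', hγv'⟩ := y.exists_isParamRep ha hb
  refine ⟨γ, γ', hγ, hγ', fun i => ?_⟩
  have h1 : γ i ∈ x.completedGraph := hγ.range_eq ▸ mem_range_self i
  have h2 : γ' i ∈ y.completedGraph := hγ'.range_eq ▸ mem_range_self i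
  obtain ⟨h3, h4⟩ := graph_close h1 h2 (ε := ε) (by
    rw [hγv, hγv']
    have h0 := i.2.1
    have h1 := i.2.2
    rw [abs_le] at hxa hxb ⊢
    constructor <;> nlinarith) hA hAxy
  rw [Prod.dist_eq, Subtype.dist_eq, Real.dist_eq, Real.dist_eq]
  exact max_le (by linarith) h4

end IncPath

/-! ### Decorated paths from time changes -/

namespace TimeChangedPath

variable {T : ℝ}

theorem compose_left (φ : C(ℝ≥0, ℝ)) (τ : IncPath T) (t : Icc (0 : ℝ) T) :
    (compose φ τ).left t = φ (τ.left t).toNNReal := by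
  rcases IncPath.nhdsLT_eq_bot_or t with h | h
  · refine leftLim_eq_of_tendsto ?_
    exact ((φ.continuous.comp continuous_real_toNNReal).tendsto _).comp (τ.tendsto_left t)
  · have hbot : 𝓝[<] t = ⊥ := by
      have : Iio t = ∅ := by
        ext s
        simpa using h s
      rw [this, nhdsWithin_empty]
    rw [CadlagPath.left_of_eq_bot _ hbot, CadlagPath.left_of_eq_bot _ hbot]
    rfl

/-- The range of `φ` over the jump segment `[τ(t-), τ(t)]`. -/
def decoration (φ : C(ℝ≥0, ℝ)) (τ : IncPath T) (t : Icc (0 : ℝ) T) : Set ℝ :=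
  φ '' {s : ℝ≥0 | τ.left t ≤ s ∧ (s : ℝ) ≤ τ t}

theorem tendsto_hausdorffDist_decoration (φ : C(ℝ≥0, ℝ)) (τ : IncPath T)
    {F : Filter (Icc (0 : ℝ) T)} {l : ℝ} (h1 : Tendsto τ.left F (𝓝 l))
    (h2 : Tendsto τ.toFun F (𝓝 l)) :
    Tendsto (fun s => Metric.hausdorffDist (decoration φ τ s) {φ l.toNNReal}) F (𝓝 0) := by
  refine Metric.tendsto_nhds.2 fun ε hε => ?_
  have hφ : Continuous fun r : ℝ => φ r.toNNReal := φ.continuous.comp continuous_real_toNNReal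
  obtain ⟨δ, hδ, hδ2⟩ := Metric.continuousAt_iff.1 hφ.continuousAt (ε / 2) (half_pos hε)
  filter_upwards [Metric.tendsto_nhds.1 h1 δ hδ, Metric.tendsto_nhds.1 h2 δ hδ] with s hs1 hs2
  rw [Real.dist_0_eq_abs, abs_of_nonneg Metric.hausdorffDist_nonneg]
  refine lt_of_le_of_lt ?_ (half_lt_self hε)
  have key : ∀ r : ℝ≥0, τ.left s ≤ r → (r : ℝ) ≤ τ s → dist (φ r) (φ l.toNNReal) ≤ ε / 2 := by
    intro r hr1 hr2
    have hr : dist (r : ℝ) l < δ := by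
      rw [Real.dist_eq, abs_lt] at *
      constructor <;> linarith
    have := hδ2 hr
    rw [Real.toNNReal_coe] at this
    exact this.le
  refine Metric.hausdorffDist_le_of_mem_dist (by positivity) ?_ ?_
  · rintro _ ⟨r, ⟨hr1, hr2⟩, rfl⟩
    exact ⟨_, rfl, key r hr1 hr2⟩
  · rintro _ rfl
    refine ⟨φ (τ.val s), ⟨τ.val s, ⟨τ.left_le s, le_rfl⟩, rfl⟩, ?_⟩
    rw [dist_comm]
    exact key _ (τ.left_le s) le_rfl

/-- The path `φ ∘ τ`, decorated with the ranges of `φ` over the jump segments of `τ`. -/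
def decorate (p : C(ℝ≥0, ℝ) × IncPath T) : DecoratedPath T where
  base := compose p.1 p.2
  dec := decoration p.1 p.2
  isCompact_dec t := by
    have h : {s : ℝ≥0 | p.2.left t ≤ s ∧ (s : ℝ) ≤ p.2 t} =
        Icc (p.2.left t).toNNReal (p.2.val t) := by
      ext s
      exact ⟨fun h => ⟨Real.toNNReal_le_iff_le_coe.2 h.1, h.2⟩,
        fun h => ⟨Real.toNNReal_le_iff_le_coe.1 h.1, h.2⟩⟩
    rw [decoration, h]
    exact isCompact_Icc.image p.1.continuous
  base_mem t := by
    rw [compose_apply]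
    exact ⟨p.2.val t, ⟨p.2.left_le t, le_rfl⟩, rfl⟩
  left_mem t := by
    rw [compose_left]
    refine ⟨_, ⟨?_, ?_⟩, rfl⟩
    · rw [Real.coe_toNNReal _ (p.2.left_nonneg t)]
    · rw [Real.coe_toNNReal _ (p.2.left_nonneg t)]
      exact p.2.left_le t
  tendsto_right t := tendsto_hausdorffDist_decoration p.1 p.2 (p.2.tendsto_left_nhdsGT t)
    ((p.2.right_continuous t).mono_left (nhdsWithin_mono _ Ioi_subset_Ici_self))
  tendsto_left t := by
    rw [compose_left]
    exact tendsto_hausdorffDist_decoration p.1 p.2 (p.2.tendsto_left_nhdsLT t) (p.2.tendsto_left t)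

/-- The decorated graph is the image of the completed graph of the time change under `(t, s) ↦ (t, φ
s)`. This ties the Hausdorff distance on `𝔇` to the `M₁` distance on the time changes. -/
theorem mem_graph_decorate {p : C(ℝ≥0, ℝ) × IncPath T} {q : Icc (0 : ℝ) T × ℝ} :
    q ∈ (decorate p).graph ↔ ∃ s, (q.1, s) ∈ p.2.completedGraph ∧ p.1 s.toNNReal = q.2 := by
  constructor
  · rintro ⟨s, ⟨hs1, hs2⟩, hs⟩
    exact ⟨s, IncPath.mem_completedGraph.2 ⟨hs1, hs2⟩, by rwa [Real.toNNReal_coe]⟩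
  · rintro ⟨s, hs, hs2⟩
    obtain ⟨h1, h2⟩ := IncPath.mem_completedGraph.1 hs
    have h0 : 0 ≤ s := (p.2.left_nonneg _).trans h1
    refine ⟨s.toNNReal, ⟨?_, ?_⟩, hs2⟩ <;> rwa [Real.coe_toNNReal _ h0]

/-- Parametric representations sweep out the whole decorated graphs, so pairing points of equal
parameter bounds the Hausdorff distance from both sides. -/
theorem dist_decorate_le {φ ψ : C(ℝ≥0, ℝ)} {x y : IncPath T}
    {γ γ' : C(unitInterval, Icc (0 : ℝ) T × ℝ)} (hγ : x.IsParamRep γ) (hγ' : y.IsParamRep γ')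
    {δ ε : ℝ} (hδε : δ ≤ ε) (hd : ∀ i, dist (γ i) (γ' i) ≤ δ)
    (hφ : ∀ i, dist (φ (γ i).2.toNNReal) (ψ (γ' i).2.toNNReal) ≤ ε) :
    edist (decorate (φ, x)) (decorate (ψ, y)) ≤ ENNReal.ofReal ε := by
  have hpt : ∀ i, edist ((γ i).1, φ (γ i).2.toNNReal) ((γ' i).1, ψ (γ' i).2.toNNReal) ≤
      ENNReal.ofReal ε := by
    intro i
    rw [edist_dist, Prod.dist_eq]
    apply ENNReal.ofReal_le_ofReal
    refine max_le ?_ (hφ i)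
    exact ((le_max_left _ _).trans (hd i)).trans hδε
  have hmem : ∀ i, γ i ∈ x.completedGraph := fun i => hγ.range_eq ▸ mem_range_self i
  have hmem' : ∀ i, γ' i ∈ y.completedGraph := fun i => hγ'.range_eq ▸ mem_range_self i
  refine Metric.hausdorffEDist_le_of_mem_edist ?_ ?_
  · rintro ⟨t, z⟩ hq
    obtain ⟨s, hs, hs2⟩ := mem_graph_decorate.1 hq
    rw [← hγ.range_eq] at hs
    obtain ⟨i, hi⟩ := hs
    refine ⟨((γ' i).1, ψ (γ' i).2.toNNReal), mem_graph_decorate.2 ⟨_, hmem' i, rfl⟩, ?_⟩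
    have h := hpt i
    rw [hi] at h
    rw [← (show (φ s.toNNReal) = z from hs2)]
    exact h
  · rintro ⟨t, z⟩ hq
    obtain ⟨s, hs, hs2⟩ := mem_graph_decorate.1 hq
    rw [← hγ'.range_eq] at hs
    obtain ⟨i, hi⟩ := hs
    refine ⟨((γ i).1, φ (γ i).2.toNNReal), mem_graph_decorate.2 ⟨_, hmem i, rfl⟩, ?_⟩
    have h := hpt i
    rw [hi] at h
    rw [edist_comm, ← (show (ψ s.toNNReal) = z from hs2)]
    exact h

end TimeChangedPath

/-! ### A finer topology -/

/-- The space `D°[0,T]`, with the topology of locally uniform convergence of the first component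
and of convergence of the second component at the times `e 0, e 1, …`. -/
def EvalPath {T : ℝ} (_e : ℕ → Icc (0 : ℝ) T) : Type := C(ℝ≥0, ℝ) × IncPath T

namespace EvalPath

variable {T : ℝ} {e : ℕ → Icc (0 : ℝ) T}

/-- The coordinates which define the topology. -/
def coord (p : EvalPath e) : C(ℝ≥0, ℝ) × (ℕ → ℝ) := (p.1, fun i => p.2 (e i))

/-- Being pulled back from a countable product, this uniformity is countably generated, which the
coupling criterion requires; measurability also reduces to coordinates. -/
instance : UniformSpace (EvalPath e) := UniformSpace.comap coord inferInstance

instance : MeasurableSpace (EvalPath e) := borel _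

instance : BorelSpace (EvalPath e) := ⟨rfl⟩

instance : IsCountablyGenerated (uniformity (EvalPath e)) :=
  inferInstanceAs (IsCountablyGenerated (Filter.comap _ (uniformity (C(ℝ≥0, ℝ) × (ℕ → ℝ)))))

theorem isInducing_coord : IsInducing (coord (e := e)) := ⟨rfl⟩

theorem measurable_iff {Ω : Type*} [MeasurableSpace Ω] {f : Ω → EvalPath e} :
    Measurable f ↔ Measurable fun ω => coord (f ω) := by
  have h : (inferInstance : MeasurableSpace (EvalPath e)) =
      MeasurableSpace.comap coord inferInstance := by
    show borel (EvalPath e) = _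
    rw [BorelSpace.measurable_eq (α := C(ℝ≥0, ℝ) × (ℕ → ℝ)), borel_comap]
  constructor
  · exact fun hf => isInducing_coord.continuous.measurable.comp hf
  · intro hf
    rw [measurable_iff_comap_le] at hf ⊢
    refine le_trans (le_of_eq ?_) hf
    exact (congrArg (MeasurableSpace.comap f) h).trans MeasurableSpace.comap_comp

/-- The point `(φ, x)`. -/
def mk (e : ℕ → Icc (0 : ℝ) T) (φ : C(ℝ≥0, ℝ)) (x : IncPath T) : EvalPath e := (φ, x)

theorem measurable_mk {Ω : Type*} [MeasurableSpace Ω] {φ : Ω → C(ℝ≥0, ℝ)}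
    {x : Ω → IncPath T} (hφ : Measurable φ) (hx : ∀ t, Measurable fun ω => x ω t) :
    Measurable fun ω => mk e (φ ω) (x ω) :=
  measurable_iff.2 (hφ.prodMk (measurable_pi_lambda _ fun i => hx (e i)))

theorem continuous_fst : Continuous fun p : EvalPath e => (p.1 : C(ℝ≥0, ℝ)) :=
  (_root_.continuous_fst.comp isInducing_coord.continuous : Continuous fun p : EvalPath e =>
    (coord p).1)

theorem exists_grid (he : DenseRange e) {ε : ℝ} (hε : 0 < ε) :
    ∃ A : Finset ℕ, ∀ r r' : Icc (0 : ℝ) T, (r : ℝ) + ε ≤ r' → ∃ i ∈ A, r ≤ e i ∧ e i < r' := by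
  obtain ⟨A, hA⟩ := (isCompact_univ (X := Icc (0 : ℝ) T)).elim_finite_subcover
    (fun i => Metric.ball (e i) (ε / 2)) (fun i => Metric.isOpen_ball) (fun t _ => by
      obtain ⟨i, hi⟩ := he.exists_dist_lt t (half_pos hε)
      exact mem_iUnion.2 ⟨i, hi⟩)
  refine ⟨A, fun r r' h => ?_⟩
  have hm : ((r : ℝ) + r') / 2 ∈ Icc (0 : ℝ) T :=
    ⟨by linarith [r.2.1, r'.2.1], by linarith [r.2.2, r'.2.2]⟩
  -- A net point within `ε / 2` of the midpoint of `r` and `r'` lies between them.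
  obtain ⟨i, hiA, hi⟩ := mem_iUnion₂.1 (hA (mem_univ ⟨_, hm⟩))
  rw [Metric.mem_ball, Subtype.dist_eq, Real.dist_eq, abs_lt] at hi
  refine ⟨i, hiA, ?_, ?_⟩
  · show (r : ℝ) ≤ e i
    linarith [hi.1, hi.2]
  · show (e i : ℝ) < r'
    linarith [hi.1, hi.2]

/-- In the finer topology, nearby points have uniformly close parametric representations. -/
theorem eventually_paramRep_close (he : DenseRange e) (h0 : ∀ s, e 0 ≤ s) (h1 : ∀ s, s ≤ e 1)
    (p : EvalPath e) {δ : ℝ} (hδ : 0 < δ) :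
    ∀ᶠ q in 𝓝 p, ∃ γ γ' : C(unitInterval, Icc (0 : ℝ) T × ℝ), p.2.IsParamRep γ ∧
      q.2.IsParamRep γ' ∧ ∀ i, dist (γ i) (γ' i) ≤ δ := by
  obtain ⟨A, hA⟩ := exists_grid he (ε := δ / 3) (by positivity)
  have hev : ∀ i : ℕ, ∀ᶠ q : EvalPath e in 𝓝 p, |p.2 (e i) - q.2 (e i)| ≤ δ / 3 := by
    intro i
    have hc : Continuous fun q : EvalPath e => (coord q).2 i :=
      (continuous_apply i).comp (continuous_snd.comp isInducing_coord.continuous)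
    filter_upwards [Metric.tendsto_nhds.1 (hc.tendsto p) (δ / 3) (by positivity)] with q hq
    rw [← Real.dist_eq, dist_comm]
    exact hq.le
  filter_upwards [(Filter.eventually_all_finset A).2 fun i _ => hev i, hev 0, hev 1]
    with q hqA hq0 hq1
  obtain ⟨γ, γ', hγ, hγ', h⟩ := IncPath.exists_paramRep_close (x := p.2) (y := q.2) h0 h1
    (A := e '' A) (ε := δ / 3) (fun r r' h => by
      obtain ⟨i, hi, h2⟩ := hA r r' h
      exact ⟨e i, ⟨i, hi, rfl⟩, h2⟩) (by
      rintro _ ⟨i, hi, rfl⟩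
      exact hqA i hi) hq0 hq1
  exact ⟨γ, γ', hγ, hγ', fun i => (h i).trans (by linarith)⟩

theorem continuous_toTimeChangedPath (he : DenseRange e) (h0 : ∀ s, e 0 ≤ s) (h1 : ∀ s, s ≤ e 1) :
    Continuous fun p : EvalPath e => TimeChangedPath.mk p.1 p.2 := by
  have hsnd : Continuous fun p : EvalPath e => (p.2 : IncPath T) := by
    refine continuous_def.2 fun U hU => isOpen_iff_mem_nhds.2 fun p hp => ?_
    obtain ⟨ε, hε, hεU⟩ := hU _ hp
    obtain ⟨δ, hδ0, hδ⟩ := ENNReal.lt_iff_exists_nnreal_btwn.1 hε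
    have hδ0' : (0 : ℝ) < δ := by exact_mod_cast hδ0
    filter_upwards [eventually_paramRep_close he h0 h1 p hδ0'] with q hq
    obtain ⟨γ, γ', hγ, hγ', h⟩ := hq
    refine hεU q.2 (lt_of_le_of_lt ?_ hδ)
    refine (iInf₂_le γ hγ).trans ((iInf₂_le γ' hγ').trans ?_)
    rw [edist_dist]
    refine (ENNReal.ofReal_le_ofReal ((ContinuousMap.dist_le hδ0'.le).2 h)).trans ?_
    rw [ENNReal.ofReal_coe_nnreal]
  exact continuous_fst.prodMk hsnd

/-- Near `p` the representations are uniformly close and all values stay below `M`, one more than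
the final value of the time change. Uniform continuity of `p.1` and uniform closeness of `q.1` on
`[0, M]` do the rest. -/
theorem continuous_decorate (he : DenseRange e) (h0 : ∀ s, e 0 ≤ s) (h1 : ∀ s, s ≤ e 1) :
    Continuous fun p : EvalPath e => TimeChangedPath.decorate p := by
  refine continuous_iff_continuousAt.2 fun p => ?_
  refine EMetric.tendsto_nhds.2 fun ε hε => ?_
  obtain ⟨η, hη0, hη⟩ := ENNReal.lt_iff_exists_nnreal_btwn.1 hε
  have hη0' : (0 : ℝ) < η := by exact_mod_cast hη0
  set M : ℝ≥0 := p.2.val (e 1) + 1 with hM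
  obtain ⟨δ, hδ, hδ2⟩ := Metric.uniformContinuousOn_iff.1
    ((isCompact_Icc (a := (0 : ℝ≥0)) (b := M)).uniformContinuousOn_of_continuous
      p.1.continuous.continuousOn) (η / 2) (by positivity)
  have hunif : ∀ᶠ q : EvalPath e in 𝓝 p, ∀ s ∈ Icc (0 : ℝ≥0) M, dist (p.1 s) (q.1 s) < η / 2 := by
    have := (ContinuousMap.tendsto_iff_forall_isCompact_tendstoUniformlyOn.1 (continuous_fst.tendsto p))
      _ (isCompact_Icc (a := (0 : ℝ≥0)) (b := M))
    exact Metric.tendstoUniformlyOn_iff.1 this (η / 2) (by positivity)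
  -- The three entries serve uniform continuity of `p.1`, staying below `M`, and the time
  -- coordinate.
  set δ' : ℝ := min (δ / 2) (min 1 η) with hδ'
  have hδ'0 : 0 < δ' := by positivity
  filter_upwards [hunif, eventually_paramRep_close he h0 h1 p hδ'0] with q hq1 hq2
  obtain ⟨γ, γ', hγ, hγ', h⟩ := hq2
  refine lt_of_le_of_lt ?_ hη
  rw [edist_comm, ← ENNReal.ofReal_coe_nnreal]
  refine TimeChangedPath.dist_decorate_le (φ := p.1) (ψ := q.1) hγ hγ'
    ((min_le_right _ _).trans (min_le_right _ _)) h fun i => ?_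
  have hmem : γ i ∈ p.2.completedGraph := hγ.range_eq ▸ mem_range_self i
  obtain ⟨hm1, hm2⟩ := IncPath.mem_completedGraph.1 hmem
  have hle : (γ i).2 ≤ p.2 (e 1) := hm2.trans (p.2.mono (h1 _))
  have hd : dist (γ i).2 (γ' i).2 ≤ δ' := (le_max_right _ _).trans (h i)
  have hd1 : dist (γ i).2.toNNReal (γ' i).2.toNNReal ≤ δ' :=
    (by simpa using Real.lipschitzWith_toNNReal.dist_le_mul (γ i).2 (γ' i).2 : _ ≤ _).trans hd
  have hs : (γ i).2.toNNReal ∈ Icc (0 : ℝ≥0) M := by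
    refine ⟨zero_le, Real.toNNReal_le_iff_le_coe.2 ?_⟩
    show _ ≤ p.2 (e 1) + 1
    linarith
  have hs' : (γ' i).2.toNNReal ∈ Icc (0 : ℝ≥0) M := by
    refine ⟨zero_le, Real.toNNReal_le_iff_le_coe.2 ?_⟩
    show _ ≤ p.2 (e 1) + 1
    have h2 : δ' ≤ 1 := (min_le_right _ _).trans (min_le_left _ _)
    rw [Real.dist_eq, abs_le] at hd
    linarith
  have h3 := hδ2 _ hs _ hs' (hd1.trans_lt ((min_le_left _ _).trans_lt (half_lt_self hδ)))
  have h4 := hq1 _ hs'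
  calc _ ≤ dist (p.1 (γ i).2.toNNReal) (p.1 (γ' i).2.toNNReal) +
        dist (p.1 (γ' i).2.toNNReal) (q.1 (γ' i).2.toNNReal) := dist_triangle _ _ _
    _ ≤ η := by linarith

end EvalPath

/-! ### Convergence in distribution by coupling -/

section Coupling

variable {Ω : ℕ → Type*} [mΩ : ∀ n, MeasurableSpace (Ω n)] (P : ∀ n, Measure (Ω n))

/-- The relations which hold for `(A n, B n)` with probability tending to one. -/
def couplingFilter {E : Type*} (A B : ∀ n, Ω n → E) : Filter (E × E) where
  sets := {V | Tendsto (fun n => P n {ω | (A n ω, B n ω) ∉ V}) atTop (𝓝 0)}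
  univ_sets := by simp
  sets_of_superset {V W} hV hVW := by
    refine tendsto_of_tendsto_of_tendsto_of_le_of_le tendsto_const_nhds hV (fun _ => zero_le)
      fun n => measure_mono fun ω hω h => hω (hVW h)
  inter_sets {V W} hV hW := by
    have h : Tendsto (fun n => P n {ω | (A n ω, B n ω) ∉ V} + P n {ω | (A n ω, B n ω) ∉ W}) atTop
        (𝓝 (0 + 0)) := Tendsto.add hV hW
    rw [add_zero] at h
    refine tendsto_of_tendsto_of_tendsto_of_le_of_le tendsto_const_nhds h (fun _ => zero_le)
      fun n => (measure_mono fun ω hω => ?_).trans (measure_union_le _ _)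
    by_contra h'
    simp only [mem_union, not_or] at h'
    exact hω ⟨not_not.1 h'.1, not_not.1 h'.2⟩

variable {P}

theorem mem_couplingFilter {E : Type*} {A B : ∀ n, Ω n → E} {V : Set (E × E)} :
    V ∈ couplingFilter P A B ↔ Tendsto (fun n => P n {ω | (A n ω, B n ω) ∉ V}) atTop (𝓝 0) :=
  Iff.rfl

theorem couplingFilter_le_comap {E F : Type*} {A B : ∀ n, Ω n → E} {g : E → F}
    {𝓥 : Filter (F × F)}
    (h : couplingFilter P (fun n ω => g (A n ω)) (fun n ω => g (B n ω)) ≤ 𝓥) :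
    couplingFilter P A B ≤ 𝓥.comap fun p => (g p.1, g p.2) :=
  map_le_iff_le_comap.1 fun _ hV => h hV

theorem couplingFilter_real_le {A B : ∀ n, Ω n → ℝ}
    (h : ∀ ε > 0, Tendsto (fun n => P n {ω | ε ≤ |A n ω - B n ω|}) atTop (𝓝 0)) :
    couplingFilter P A B ≤ uniformity ℝ := by
  intro V hV
  obtain ⟨ε, hε, hV⟩ := Metric.mem_uniformity_dist.1 hV
  refine tendsto_of_tendsto_of_tendsto_of_le_of_le tendsto_const_nhds (h ε hε) (fun _ => zero_le)
      fun n => measure_mono fun ω hω => ?_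
  by_contra h'
  exact hω (hV (not_le.1 h'))

/-- The uniformity is an infimum of pulled-back ones, so coordinatewise closeness in probability
suffices. -/
theorem couplingFilter_evalPath_le {T : ℝ} {e : ℕ → Icc (0 : ℝ) T}
    {φ ψ : ∀ n, Ω n → C(ℝ≥0, ℝ)} {x y : ∀ n, Ω n → IncPath T}
    (hφ : couplingFilter P φ ψ ≤ uniformity C(ℝ≥0, ℝ))
    (hx : ∀ i, couplingFilter P (fun n ω => x n ω (e i)) (fun n ω => y n ω (e i)) ≤ uniformity ℝ) :
    couplingFilter P (fun n ω => EvalPath.mk e (φ n ω) (x n ω))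
      (fun n ω => EvalPath.mk e (ψ n ω) (y n ω)) ≤ uniformity (EvalPath e) := by
  refine couplingFilter_le_comap (g := EvalPath.coord) ?_
  rw [uniformity_prod]
  refine le_inf (couplingFilter_le_comap (g := Prod.fst) hφ)
    (couplingFilter_le_comap (g := Prod.snd) ?_)
  rw [Pi.uniformity]
  exact le_iInf fun i => couplingFilter_le_comap (g := fun z : ℕ → ℝ => z i) (hx i)

variable [∀ n, IsProbabilityMeasure (P n)]

/-- Portmanteau for an open set `G`, exhausted by the sets `U k` of points farther than `1 / (k +
1)` from its complement. If `B n` is in `U k` and `A n` is within `1 / (k + 1)` of it, then `A n` is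
in `G`; and `B n` has exactly the law of `Z`. -/
theorem tendstoInDistribution_of_coupling {E : Type*} [UniformSpace E]
    [IsCountablyGenerated (uniformity E)] [MeasurableSpace E] [BorelSpace E]
    {A B : ∀ n, Ω n → E} (hA : ∀ n, Measurable (A n)) (hB : ∀ n, Measurable (B n))
    {Ω' : Type*} [MeasurableSpace Ω'] {P' : Measure Ω'} [IsProbabilityMeasure P'] {Z : Ω' → E}
    (hZ : AEMeasurable Z P') (hlaw : ∀ n, (P n).map (B n) = P'.map Z)
    (h : couplingFilter P A B ≤ uniformity E) : TendstoInDistribution A atTop Z P P' := by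
  let _ := UniformSpace.pseudoMetricSpace E
  refine ⟨fun n => (hA n).aemeasurable, hZ, ?_⟩
  refine tendsto_of_forall_isOpen_le_liminf' fun G hG => ?_
  simp only [ProbabilityMeasure.coe_mk]
  set μ := P'.map Z
  set U : ℕ → Set E := fun k => {x | ((k : ℝ≥0∞) + 1)⁻¹ < Metric.infEDist x Gᶜ} with hU
  have hUopen : ∀ k, IsOpen (U k) := fun k => isOpen_lt continuous_const Metric.continuous_infEDist
  have hUmono : Monotone U := by
    intro k l hkl x hx
    have hx' : ((k : ℝ≥0∞) + 1)⁻¹ < Metric.infEDist x Gᶜ := hx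
    refine lt_of_le_of_lt ?_ hx'
    gcongr
  have hUG : ⋃ k, U k = G := by
    ext x
    rw [mem_iUnion]
    constructor
    · rintro ⟨k, hk⟩
      by_contra hx
      have : Metric.infEDist x Gᶜ = 0 := Metric.infEDist_zero_of_mem hx
      have hk' : _ < Metric.infEDist x Gᶜ := hk
      rw [this] at hk'
      exact not_lt_zero hk'
    · intro hx
      have h0 : Metric.infEDist x Gᶜ ≠ 0 := by
        intro h0
        have := (Metric.mem_closure_iff_infEDist_zero).2 h0
        rw [hG.isClosed_compl.closure_eq] at this
        exact this hx
      obtain ⟨k, hk⟩ := ENNReal.exists_inv_nat_lt h0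
      refine ⟨k, lt_of_le_of_lt ?_ hk⟩
      gcongr
      exact le_self_add
  have h1 := tendsto_measure_iUnion_atTop (μ := μ) hUmono
  rw [hUG] at h1
  refine le_of_tendsto h1 (Eventually.of_forall fun k => ?_)
  set V : Set (E × E) := {p | edist p.1 p.2 < ((k : ℝ≥0∞) + 1)⁻¹} with hV
  have hVmem : V ∈ uniformity E := _root_.mem_uniformity_edist.2
    ⟨_, ENNReal.inv_pos.2 (by finiteness), fun h => h⟩
  have h2 := mem_couplingFilter.1 (h hVmem)
  have h3 : ∀ n, μ (U k) - P n {ω | (A n ω, B n ω) ∉ V} ≤ (P n).map (A n) G := by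
    intro n
    rw [tsub_le_iff_right, Measure.map_apply (hA n) hG.measurableSet, ← hlaw n,
      Measure.map_apply (hB n) (hUopen k).measurableSet]
    refine (measure_mono fun ω hω => ?_).trans (measure_union_le _ _)
    by_cases hv : (A n ω, B n ω) ∈ V
    · left
      by_contra hx
      have h4 : Metric.infEDist (B n ω) Gᶜ ≤ edist (B n ω) (A n ω) :=
        Metric.infEDist_le_edist_of_mem hx
      rw [edist_comm] at h4
      have h5 : ((k : ℝ≥0∞) + 1)⁻¹ < Metric.infEDist (B n ω) Gᶜ := hω
      exact lt_asymm (h5.trans_le h4) hv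
    · exact Or.inr hv
  have h4 : Tendsto (fun n => μ (U k) - P n {ω | (A n ω, B n ω) ∉ V}) atTop (𝓝 (μ (U k))) := by
    have := ENNReal.Tendsto.sub (tendsto_const_nhds (x := μ (U k)) (f := atTop)) h2
      (Or.inr (by simp))
    simpa using this
  show μ (U k) ≤ _
  rw [← h4.liminf_eq]
  exact liminf_le_liminf (Eventually.of_forall h3)

end Coupling

/-! ### Convergence of the driving paths -/

theorem drivingPath_eq (lam nu : ℝ) (f : C(ℝ≥0, ℝ≥0)) (w : C(ℝ≥0, ℝ)) :
    drivingPath lam nu f w = nu • w.comp f - lam • ⟨fun s : ℝ≥0 => (s : ℝ), NNReal.continuous_coe⟩ := by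
  ext s
  simp [drivingPath]

theorem continuous_drivingPath (lam nu : ℝ) (f : C(ℝ≥0, ℝ≥0)) :
    Continuous (drivingPath lam nu f) := by
  have : drivingPath lam nu f = fun w : C(ℝ≥0, ℝ) => nu • w.comp f -
      lam • (⟨fun s : ℝ≥0 => (s : ℝ), NNReal.continuous_coe⟩ : C(ℝ≥0, ℝ)) :=
    funext fun w => drivingPath_eq lam nu f w
  rw [this]
  exact ((ContinuousMap.continuous_precomp f).const_smul nu).sub continuous_const

theorem tendsto_drivingPath {lam nu : ℕ → ℝ} {f : ℕ → C(ℝ≥0, ℝ≥0)} {lam₀ nu₀ : ℝ}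
    {f₀ : C(ℝ≥0, ℝ≥0)} (hf : TendstoLocallyUniformly (fun n x => f n x) f₀ atTop)
    (hlam : Tendsto lam atTop (𝓝 lam₀)) (hnu : Tendsto nu atTop (𝓝 nu₀)) (w : C(ℝ≥0, ℝ)) :
    Tendsto (fun n => drivingPath (lam n) (nu n) (f n) w) atTop
      (𝓝 (drivingPath lam₀ nu₀ f₀ w)) := by
  have h1 : Tendsto f atTop (𝓝 f₀) := ContinuousMap.tendsto_iff_tendstoLocallyUniformly.2 hf
  have h2 : Tendsto (fun n => w.comp (f n)) atTop (𝓝 (w.comp f₀)) :=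
    ((ContinuousMap.continuous_postcomp w).tendsto f₀).comp h1
  simp only [drivingPath_eq]
  exact (hnu.smul h2).sub (hlam.smul_const _)

/-- Since every `W n` has law `μ`, the probabilities are `μ (S n)` for sets of paths on one space,
and each fixed path eventually leaves `S n`. An open entourage makes `S n` measurable. -/
theorem couplingFilter_drivingPath_le {Ω : ℕ → Type*} [mΩ : ∀ n, MeasurableSpace (Ω n)]
    {P : ∀ n, Measure (Ω n)} {μ : Measure C(ℝ≥0, ℝ)} [IsFiniteMeasure μ]
    {W : ∀ n, Ω n → C(ℝ≥0, ℝ)} (hW : ∀ n, Measurable (W n)) (hlaw : ∀ n, (P n).map (W n) = μ)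
    {lam nu : ℕ → ℝ} {f : ℕ → C(ℝ≥0, ℝ≥0)} {lam₀ nu₀ : ℝ}
    {f₀ : C(ℝ≥0, ℝ≥0)} (hf : TendstoLocallyUniformly (fun n x => f n x) f₀ atTop)
    (hlam : Tendsto lam atTop (𝓝 lam₀)) (hnu : Tendsto nu atTop (𝓝 nu₀)) :
    couplingFilter P (fun n ω => drivingPath (lam n) (nu n) (f n) (W n ω))
      (fun n ω => drivingPath lam₀ nu₀ f₀ (W n ω)) ≤ uniformity C(ℝ≥0, ℝ) := by
  intro V hV
  obtain ⟨U, ⟨hU, hUo⟩, hUV⟩ := uniformity_hasBasis_open.mem_iff.1 hV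
  refine mem_of_superset (mem_couplingFilter.2 ?_) hUV
  set S : ℕ → Set C(ℝ≥0, ℝ) := fun n =>
    {w | (drivingPath (lam n) (nu n) (f n) w, drivingPath lam₀ nu₀ f₀ w) ∉ U} with hS
  have hSm : ∀ n, MeasurableSet (S n) := fun n =>
    (hUo.isClosed_compl.preimage ((continuous_drivingPath (lam n) (nu n) (f n)).prodMk
      (continuous_drivingPath lam₀ nu₀ f₀))).measurableSet
  have h1 : ∀ n, P n {ω | (drivingPath (lam n) (nu n) (f n) (W n ω),
      drivingPath lam₀ nu₀ f₀ (W n ω)) ∉ U} = μ (S n) := fun n => by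
    rw [← hlaw n, Measure.map_apply (hW n) (hSm n)]
    rfl
  refine Tendsto.congr (fun n => (h1 n).symm) ?_
  have h5 : ∀ w, ∀ᶠ n in atTop, (w ∈ S n ↔ w ∈ (∅ : Set C(ℝ≥0, ℝ))) := by
    intro w
    have h4 : {x | (x, drivingPath lam₀ nu₀ f₀ w) ∈ U} ∈ 𝓝 (drivingPath lam₀ nu₀ f₀ w) :=
      mem_nhds_right _ hU
    filter_upwards [tendsto_drivingPath hf hlam hnu w h4] with n hn
    have hn' : (drivingPath (lam n) (nu n) (f n) w, drivingPath lam₀ nu₀ f₀ w) ∈ U := hn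
    exact iff_of_false (not_not.2 hn') (notMem_empty w)
  simpa using tendsto_measure_of_tendsto_indicator_of_isFiniteMeasure atTop (μ := μ) hSm h5

theorem setOf_forall_le_mem_uniformity (M : ℝ≥0) {ε : ℝ} (hε : 0 < ε) :
    {p : C(ℝ≥0, ℝ) × C(ℝ≥0, ℝ) | ∀ s ≤ M, |p.1 s - p.2 s| < ε} ∈ uniformity C(ℝ≥0, ℝ) := by
  rw [ContinuousMap.mem_compactConvergence_entourage_iff]
  refine ⟨Icc 0 M, {p | dist p.1 p.2 < ε}, isCompact_Icc, Metric.dist_mem_uniformity hε, ?_⟩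
  intro p hp s hs
  rw [← Real.dist_eq]
  exact hp s ⟨zero_le, hs⟩

/-! ### Kernels that converge to the Dirac mass at zero -/

theorem intervalIntegral_nonneg_of_forall_Ioo {g : ℝ → ℝ} {a b : ℝ} (hab : a ≤ b)
    (h : ∀ r ∈ Ioo a b, 0 ≤ g r) : 0 ≤ ∫ r in a..b, g r := by
  rw [intervalIntegral.integral_of_le hab, integral_Ioc_eq_integral_Ioo]
  exact setIntegral_nonneg measurableSet_Ioo h

section Kernel

variable {T : ℝ} {K : ℕ → ℝ → ℝ}

/-- The indicator of `[0, η]` lies between the tent `max 0 (1 - t / η)` and the constant `1`; both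
are continuous with value `1` at zero. -/
theorem tendsto_integral_kernel (hT : 0 < T) (hK_int : ∀ n, LocallyIntegrableOn (K n) (Ici 0))
    (hK_nonneg : ∀ n t, 0 < t → 0 ≤ K n t)
    (hK : ∀ φ : ℝ → ℝ, ContinuousOn φ (Icc 0 T) →
      Tendsto (fun n => ∫ t in (0 : ℝ)..T, φ t * K n t) atTop (𝓝 (φ 0)))
    {η : ℝ} (hη : 0 < η) (hηT : η ≤ T) :
    Tendsto (fun n => ∫ t in (0 : ℝ)..η, K n t) atTop (𝓝 1) := by
  have hint : ∀ n, ∀ b, 0 ≤ b → IntervalIntegrable (K n) volume 0 b := by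
    intro n b hb
    rw [intervalIntegrable_iff_integrableOn_Icc_of_le hb]
    exact ((hK_int n).integrableOn_compact_subset Icc_subset_Ici_self isCompact_Icc)
  have h1 := hK (fun _ => 1) continuousOn_const
  simp only [one_mul] at h1
  have hφ : Continuous fun t : ℝ => max 0 (1 - t / η) := by fun_prop
  have h2 := hK _ hφ.continuousOn
  simp only [zero_div, sub_zero, zero_le_one, sup_of_le_right] at h2
  refine tendsto_of_tendsto_of_tendsto_of_le_of_le h2 h1 (fun n => ?_) (fun n => ?_)
  · have hi : IntervalIntegrable (fun t => max 0 (1 - t / η) * K n t) volume 0 T :=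
      (hint n T hT.le).continuousOn_mul hφ.continuousOn
    show ∫ t in (0 : ℝ)..T, max 0 (1 - t / η) * K n t ≤ ∫ t in (0 : ℝ)..η, K n t
    rw [← intervalIntegral.integral_add_adjacent_intervals (b := η)
      (hi.mono_set (uIcc_subset_uIcc_left (by rw [uIcc_of_le hT.le]; exact ⟨hη.le, hηT⟩)))
      (hi.mono_set (uIcc_subset_uIcc_right (by rw [uIcc_of_le hT.le]; exact ⟨hη.le, hηT⟩)))]
    have h3 : ∫ t in η..T, max 0 (1 - t / η) * K n t = 0 := by
      refine (intervalIntegral.integral_congr fun t ht => ?_).trans intervalIntegral.integral_zero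
      rw [uIcc_of_le hηT] at ht
      show max 0 (1 - t / η) * K n t = 0
      rw [max_eq_left, zero_mul]
      rw [sub_nonpos, le_div_iff₀ hη, one_mul]
      exact ht.1
    rw [h3, add_zero]
    refine intervalIntegral.integral_mono_on_of_le_Ioo hη.le
      ((hint n η hη.le).continuousOn_mul hφ.continuousOn) (hint n η hη.le) fun t ht => ?_
    have : max 0 (1 - t / η) ≤ 1 := max_le zero_le_one (by
      have : 0 ≤ t / η := div_nonneg ht.1.le hη.le
      linarith)
    nlinarith [hK_nonneg n t ht.1]
  · show ∫ t in (0 : ℝ)..η, K n t ≤ ∫ t in (0 : ℝ)..T, K n t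
    rw [← intervalIntegral.integral_add_adjacent_intervals (hint n η hη.le)
      ((hint n T hT.le).mono_set (uIcc_subset_uIcc_right (by rw [uIcc_of_le hT.le]; exact ⟨hη.le, hηT⟩)))]
    have := intervalIntegral_nonneg_of_forall_Ioo (g := K n) hηT
      fun t ht => hK_nonneg n t (hη.trans ht.1)
    linarith

end Kernel

/-! ### Monotonicity and bounds for Volterra convolutions -/

section Conv

variable {T : ℝ} {K : ℝ → ℝ} (hK_int : LocallyIntegrableOn K (Ici 0))
  (hK_nonneg : ∀ t, 0 < t → 0 ≤ K t)
include hK_int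

theorem intervalIntegrable_kernel {b : ℝ} (hb : 0 ≤ b) : IntervalIntegrable K volume 0 b := by
  rw [intervalIntegrable_iff_integrableOn_Icc_of_le hb]
  exact hK_int.integrableOn_compact_subset Icc_subset_Ici_self isCompact_Icc

theorem intervalIntegrable_kernel_sub {b : ℝ} (hb : 0 ≤ b) :
    IntervalIntegrable (fun s => K (b - s)) volume 0 b := by
  have := (intervalIntegrable_kernel hK_int hb).comp_sub_left b
  simp only [sub_zero, sub_self] at this
  exact this.symm

theorem intervalIntegrable_volterraConv {y : Icc (0 : ℝ) T → ℝ} (hy : Continuous y)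
    (t : Icc (0 : ℝ) T) :
    IntervalIntegrable (fun s => K (t - s) * IccExtend (t.2.1.trans t.2.2) y s) volume 0 t :=
  (intervalIntegrable_kernel_sub hK_int t.2.1).mul_continuousOn hy.Icc_extend'.continuousOn

theorem volterraConv_add {y z : Icc (0 : ℝ) T → ℝ} (hy : Continuous y) (hz : Continuous z)
    (t : Icc (0 : ℝ) T) :
    volterraConv K (fun s => y s + z s) t = volterraConv K y t + volterraConv K z t := by
  rw [volterraConv, volterraConv, volterraConv, ← intervalIntegral.integral_add
    (intervalIntegrable_volterraConv hK_int hy t) (intervalIntegrable_volterraConv hK_int hz t)]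
  congr 1
  ext s
  simp only [IccExtend, Function.comp]
  ring

omit hK_int in
theorem volterraConv_const_mul (c : ℝ) (y : Icc (0 : ℝ) T → ℝ) (t : Icc (0 : ℝ) T) :
    volterraConv K (fun s => c * y s) t = c * volterraConv K y t := by
  rw [volterraConv, volterraConv, ← intervalIntegral.integral_const_mul]
  congr 1
  ext s
  simp only [IccExtend, Function.comp]
  ring

include hK_nonneg

theorem volterraConv_mono {y z : Icc (0 : ℝ) T → ℝ} (hy : Continuous y) (hz : Continuous z)
    (t : Icc (0 : ℝ) T) (h : ∀ s ≤ t, y s ≤ z s) : volterraConv K y t ≤ volterraConv K z t := by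
  refine intervalIntegral.integral_mono_on_of_le_Ioo t.2.1
    (intervalIntegrable_volterraConv hK_int hy t) (intervalIntegrable_volterraConv hK_int hz t)
    fun s hs => ?_
  have hsT : s ∈ Icc 0 T := ⟨hs.1.le, hs.2.le.trans t.2.2⟩
  rw [IccExtend_of_mem _ _ hsT, IccExtend_of_mem _ _ hsT]
  exact mul_le_mul_of_nonneg_left (h _ hs.2.le) (hK_nonneg _ (by linarith [hs.2]))

/-- The part of the integral before `s` is non-negative and is dropped; after `s` the path is at
least `x s`. -/
theorem le_volterraConv {x : Icc (0 : ℝ) T → ℝ} (hx : Continuous x) (hmono : Monotone x)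
    (hx0 : ∀ s, 0 ≤ x s) {s t : Icc (0 : ℝ) T} (hst : s ≤ t) :
    (∫ r in (0 : ℝ)..(t - s : ℝ), K r) * x s ≤ volterraConv K x t := by
  have hst' : (s : ℝ) ≤ t := hst
  have hi := intervalIntegrable_volterraConv hK_int hx t
  have h0 := t.2.1
  have hs := s.2.1
  rw [volterraConv, ← intervalIntegral.integral_add_adjacent_intervals (b := s)
      (hi.mono_set (uIcc_subset_uIcc_left (by rw [uIcc_of_le h0]; exact ⟨hs, hst'⟩)))
      (hi.mono_set (uIcc_subset_uIcc_right (by rw [uIcc_of_le h0]; exact ⟨hs, hst'⟩)))]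
  have h1 : 0 ≤ ∫ r in (0 : ℝ)..s, K (t - r) * IccExtend (t.2.1.trans t.2.2) x r :=
    intervalIntegral_nonneg_of_forall_Ioo hs fun r hr =>
      mul_nonneg (hK_nonneg _ (by linarith [hr.2])) (hx0 _)
  have h2 : (∫ r in (0 : ℝ)..(t - s : ℝ), K r) * x s = ∫ r in (s : ℝ)..t, K (t - r) * x s := by
    rw [intervalIntegral.integral_mul_const, intervalIntegral.integral_comp_sub_left K]
    simp
  have h3 : ∫ r in (s : ℝ)..t, K (t - r) * x s ≤
      ∫ r in (s : ℝ)..t, K (t - r) * IccExtend (t.2.1.trans t.2.2) x r := by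
    refine intervalIntegral.integral_mono_on_of_le_Ioo hst' ?_
      (hi.mono_set (uIcc_subset_uIcc_right (by rw [uIcc_of_le h0]; exact ⟨hs, hst'⟩))) fun r hr => ?_
    · exact ((intervalIntegrable_kernel_sub hK_int h0).mono_set
        (uIcc_subset_uIcc_right (by rw [uIcc_of_le h0]; exact ⟨hs, hst'⟩))).mul_const _
    · have hrT : r ∈ Icc 0 T := ⟨hs.trans hr.1.le, hr.2.le.trans t.2.2⟩
      rw [IccExtend_of_mem _ _ hrT]
      exact mul_le_mul_of_nonneg_left (hmono (show s ≤ ⟨r, hrT⟩ from hr.1.le))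
        (hK_nonneg _ (by linarith [hr.2]))
  linarith

theorem volterraConv_const_le (c : ℝ) (hc : 0 ≤ c) (t : Icc (0 : ℝ) T) :
    volterraConv K (fun _ => c) t ≤ c * ∫ r in (0 : ℝ)..T, K r := by
  have h1 : volterraConv K (fun _ => c) t = c * ∫ r in (0 : ℝ)..t, K r := by
    rw [volterraConv, ← intervalIntegral.integral_const_mul]
    have := intervalIntegral.integral_comp_sub_left (a := 0) (b := t) (fun r => c * K r) t
    rw [sub_self, sub_zero] at this
    rw [← this]
    congr 1
    ext s
    simp only [IccExtend, Function.comp]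
    ring
  rw [h1]
  refine mul_le_mul_of_nonneg_left ?_ hc
  rw [← intervalIntegral.integral_add_adjacent_intervals (b := (t : ℝ)) (c := T)
    (intervalIntegrable_kernel hK_int t.2.1)
    ((intervalIntegrable_kernel hK_int (t.2.1.trans t.2.2)).mono_set (uIcc_subset_uIcc_right
      (by rw [uIcc_of_le (t.2.1.trans t.2.2)]; exact t.2)))]
  have := intervalIntegral_nonneg_of_forall_Ioo (g := K) t.2.2
      fun r hr => hK_nonneg r (t.2.1.trans_lt hr.1)
  linarith

end Conv

/-! ### Expectations of convolutions -/

section Fubini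

variable {T : ℝ} {K : ℝ → ℝ} {Ω : Type*} [MeasurableSpace Ω] {P : Measure Ω} [IsProbabilityMeasure P]

/-- Fubini: continuity in time gives joint measurability, and the bound `B`, uniform in time, gives
integrability on the product. -/
theorem integral_volterraConv_of_forall_continuous (hK_int : LocallyIntegrableOn K (Ici 0))
    {Z : Ω → Icc (0 : ℝ) T → ℝ} (hZc : ∀ ω, Continuous (Z ω))
    (hZm : ∀ s, Measurable fun ω => Z ω s) (hZi : ∀ s, Integrable (fun ω => Z ω s) P)
    {B : ℝ} (hB : ∀ s, ∫ ω, |Z ω s| ∂P ≤ B) (hZ0 : ∀ s, ∫ ω, Z ω s ∂P = 0) (t : Icc (0 : ℝ) T) :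
    Integrable (fun ω => volterraConv K (Z ω) t) P ∧ ∫ ω, volterraConv K (Z ω) t ∂P = 0 := by
  have h0T : (0 : ℝ) ≤ T := t.2.1.trans t.2.2
  set ρ := (volume : Measure ℝ).restrict (Ioc 0 (t : ℝ)) with hρ
  have hKi : Integrable (fun s => K (t - s)) ρ :=
    (intervalIntegrable_iff_integrableOn_Ioc_of_le t.2.1).1 (intervalIntegrable_kernel_sub hK_int t.2.1)
  have hZ : StronglyMeasurable fun p : ℝ × Ω => IccExtend h0T (Z p.2) p.1 := by
    refine stronglyMeasurable_uncurry_of_continuous_of_stronglyMeasurable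
      (u := fun (s : ℝ) (ω : Ω) => IccExtend h0T (Z ω) s) (fun ω => (hZc ω).Icc_extend') fun s => ?_
    exact (hZm _).stronglyMeasurable
  have hm : AEStronglyMeasurable (fun p : ℝ × Ω => K (t - p.1) * IccExtend h0T (Z p.2) p.1)
      (ρ.prod P) := hKi.1.comp_fst.mul hZ.aestronglyMeasurable
  have hint : Integrable (fun p : ℝ × Ω => K (t - p.1) * IccExtend h0T (Z p.2) p.1) (ρ.prod P) := by
    refine (integrable_prod_iff hm).2 ⟨ae_of_all _ fun s => Integrable.const_mul
      (show Integrable (fun ω => IccExtend h0T (Z ω) s) P from hZi _) (K (t - s)), ?_⟩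
    refine (hKi.norm.mul_const B).mono' hm.norm.integral_prod_right' (ae_of_all _ fun s => ?_)
    rw [Real.norm_of_nonneg (integral_nonneg fun ω => norm_nonneg _)]
    simp only [norm_mul]
    rw [integral_const_mul]
    exact mul_le_mul_of_nonneg_left (hB _) (norm_nonneg _)
  have heq : ∀ ω, volterraConv K (Z ω) t = ∫ s, K (t - s) * IccExtend h0T (Z ω) s ∂ρ := fun ω =>
    intervalIntegral.integral_of_le t.2.1
  simp only [heq]
  refine ⟨hint.integral_prod_right, ?_⟩
  rw [← integral_integral_swap (f := fun s ω => K (t - s) * IccExtend h0T (Z ω) s) hint]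
  simp only [integral_const_mul]
  simp [IccExtend, hZ0]

theorem integral_volterraConv (hK_int : LocallyIntegrableOn K (Ici 0))
    {Z : Ω → Icc (0 : ℝ) T → ℝ} (hZc : ∀ᵐ ω ∂P, Continuous (Z ω))
    (hZm : ∀ s, Measurable fun ω => Z ω s) (hZi : ∀ s, Integrable (fun ω => Z ω s) P)
    {B : ℝ} (hB : ∀ s, ∫ ω, |Z ω s| ∂P ≤ B) (hZ0 : ∀ s, ∫ ω, Z ω s ∂P = 0) (t : Icc (0 : ℝ) T) :
    Integrable (fun ω => volterraConv K (Z ω) t) P ∧ ∫ ω, volterraConv K (Z ω) t ∂P = 0 := by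
  classical
  obtain ⟨N, hN, hNm, hN0⟩ := exists_measurable_superset_of_null (ae_iff.1 hZc)
  set Z' : Ω → Icc (0 : ℝ) T → ℝ := fun ω => if ω ∈ N then 0 else Z ω with hZ'
  have hZZ' : ∀ᵐ ω ∂P, Z' ω = Z ω := by
    filter_upwards [compl_mem_ae_iff.2 hN0] with ω hω
    exact if_neg hω
  have hs : ∀ s, (fun ω => Z' ω s) =ᵐ[P] fun ω => Z ω s := fun s => by
    filter_upwards [hZZ'] with ω hω
    rw [hω]
  have h := integral_volterraConv_of_forall_continuous (P := P) (Z := Z') hK_int (fun ω => ?_)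
    (fun s => ?_) (fun s => (hZi s).congr (hs s).symm) (B := B) (fun s => ?_) (fun s => ?_) t
  · have h2 : (fun ω => volterraConv K (Z' ω) t) =ᵐ[P] fun ω => volterraConv K (Z ω) t := by
      filter_upwards [hZZ'] with ω hω
      rw [hω]
    exact ⟨h.1.congr h2, (integral_congr_ae h2).symm.trans h.2⟩
  · by_cases hω : ω ∈ N
    · simp only [hZ', if_pos hω]
      exact continuous_const
    · simp only [hZ', if_neg hω]
      by_contra hc
      exact hω (hN hc)
  · have : (fun ω => Z' ω s) = fun ω => if ω ∈ N then 0 else Z ω s := by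
      ext ω
      by_cases hω : ω ∈ N <;> simp [hZ', hω]
    rw [this]
    exact Measurable.ite hNm measurable_const (hZm s)
  · rw [integral_congr_ae (g := fun ω => |Z ω s|)]
    · exact hB s
    · filter_upwards [hs s] with ω hω
      rw [hω]
  · rw [integral_congr_ae (hs s), hZ0]

end Fubini

/-! ### Estimates for weak solutions -/

namespace IsWeakSolution

variable {T : ℝ} {Ω : Type*} {mΩ : MeasurableSpace Ω} {P : Measure Ω} [IsProbabilityMeasure P]
    {𝒢 : Filtration ℝ≥0 mΩ} {W : Ω → C(ℝ≥0, ℝ)} {X : Ω → IncPath T}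
    {G₀ K : ℝ → ℝ} {f : C(ℝ≥0, ℝ≥0)} {lam nu : ℝ}
    (h : IsWeakSolution P 𝒢 W X G₀ K f lam nu)
include h

omit [IsProbabilityMeasure P] in
theorem measurable_path : Measurable W :=
  measurable_path_iff.2 fun t => (h.brownian.adapted t).mono (𝒢.le t) le_rfl

omit [IsProbabilityMeasure P] in
theorem integrable_clocked (t : Icc (0 : ℝ) T) : Integrable (fun ω => W ω (f ((X ω).val t))) P := by
  obtain ⟨_, hmart⟩ := h.martingale
  exact hmart.integrable t

omit [IsProbabilityMeasure P] in
theorem measurable_clocked (t : Icc (0 : ℝ) T) : Measurable fun ω => W ω (f ((X ω).val t)) := by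
  obtain ⟨hs, -⟩ := h.martingale
  exact (hs t).measurable

omit [IsProbabilityMeasure P] in
-- Conditional Jensen for the martingale. The value at `T` is thus the uniform `L¹` bound needed for
-- Fubini.
theorem integral_abs_clocked_le {s t : Icc (0 : ℝ) T} (hst : s ≤ t) :
    ∫ ω, |W ω (f ((X ω).val s))| ∂P ≤ ∫ ω, |W ω (f ((X ω).val t))| ∂P := by
  obtain ⟨_, hmart⟩ := h.martingale
  rw [← integral_congr_ae (f := fun ω => |(P[fun ω => W ω (f ((X ω).val t)) | _]) ω|)
    ((hmart.condExp_ae_eq hst).mono fun ω hω => congrArg abs hω)]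
  exact integral_abs_condExp_le _

theorem integral_clocked (hf0 : f 0 = 0) (t : Icc (0 : ℝ) T) :
    ∫ ω, W ω (f ((X ω).val t)) ∂P = 0 := by
  obtain ⟨_, hmart⟩ := h.martingale
  set z : Icc (0 : ℝ) T := ⟨0, le_rfl, t.2.1.trans t.2.2⟩ with hz
  have hzt : z ≤ t := t.2.1
  have h1 := hmart.setIntegral_eq hzt MeasurableSet.univ
  simp only [Measure.restrict_univ] at h1
  rw [← h1]
  refine integral_eq_zero_of_ae ?_
  filter_upwards [h.start_zero, h.brownian.isBrownian.eval_zero_ae_eq_zero] with ω h2 h3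
  have h4 : (X ω).val z = 0 := NNReal.coe_injective (h2 z rfl)
  rw [h4, hf0, h3]
  rfl

omit [IsProbabilityMeasure P] in
theorem ae_continuous_clocked :
    ∀ᵐ ω ∂P, Continuous fun s => W ω (f ((X ω).val s)) := by
  filter_upwards [h.continuous] with ω hω
  have : Continuous (X ω).val := Continuous.subtype_mk hω _
  exact (W ω).continuous.comp (f.continuous.comp this)

theorem integral_volterraConv_clocked (hK_int : LocallyIntegrableOn K (Ici 0)) (hf0 : f 0 = 0)
    (t : Icc (0 : ℝ) T) :
    Integrable (fun ω => volterraConv K (fun s => W ω (f ((X ω).val s))) t) P ∧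
      ∫ ω, volterraConv K (fun s => W ω (f ((X ω).val s))) t ∂P = 0 :=
  integral_volterraConv hK_int h.ae_continuous_clocked h.measurable_clocked h.integrable_clocked
    (B := ∫ ω, |W ω (f ((X ω).val ⟨T, t.2.1.trans t.2.2, le_rfl⟩))| ∂P)
    (fun s => h.integral_abs_clocked_le (show s ≤ ⟨T, t.2.1.trans t.2.2, le_rfl⟩ from s.2.2))
    (h.integral_clocked hf0) t

omit [IsProbabilityMeasure P] in
theorem ae_le (hK_int : LocallyIntegrableOn K (Ici 0)) (hK_nonneg : ∀ t, 0 < t → 0 ≤ K t)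
    (hlam : 0 ≤ lam) {s t : Icc (0 : ℝ) T} (hst : s ≤ t) :
    ∀ᵐ ω ∂P, X ω t ≤ G₀ t + nu * volterraConv K (fun s => W ω (f ((X ω).val s))) t -
      lam * (∫ r in (0 : ℝ)..(t - s : ℝ), K r) * X ω s := by
  filter_upwards [h.volterra, h.continuous, h.ae_continuous_clocked] with ω h1 h2 h3
  rw [h1 t, volterraConv_add hK_int (h2.const_mul (-lam)) (h3.const_mul nu),
    volterraConv_const_mul, volterraConv_const_mul]
  have h4 := mul_le_mul_of_nonneg_left
    (le_volterraConv hK_int hK_nonneg h2 (X ω).mono (X ω).nonneg hst) hlam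
  linarith

theorem integrable (hK_int : LocallyIntegrableOn K (Ici 0)) (hK_nonneg : ∀ t, 0 < t → 0 ≤ K t)
    (hlam : 0 ≤ lam) (hf0 : f 0 = 0) (t : Icc (0 : ℝ) T) : Integrable (fun ω => X ω t) P := by
  obtain ⟨hi, -⟩ := h.integral_volterraConv_clocked hK_int hf0 t
  refine ((integrable_const (G₀ t)).add (hi.const_mul nu)).mono' (h.measurable t).aestronglyMeasurable ?_
  -- With `s = t` the kernel mass is zero and the `lam` term disappears.
  filter_upwards [h.ae_le hK_int hK_nonneg hlam (le_refl t)] with ω hω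
  rw [Real.norm_of_nonneg ((X ω).nonneg t)]
  simpa using hω

/-- The convolution of the clocked martingale has mean zero; the drift term is kept through
`le_volterraConv`, since it lowers the mean to the right value. -/
theorem integral_le (hK_int : LocallyIntegrableOn K (Ici 0)) (hK_nonneg : ∀ t, 0 < t → 0 ≤ K t)
    (hlam : 0 ≤ lam) (hf0 : f 0 = 0) {s t : Icc (0 : ℝ) T} (hst : s ≤ t) :
    ∫ ω, X ω t ∂P ≤ G₀ t - lam * (∫ r in (0 : ℝ)..(t - s : ℝ), K r) * ∫ ω, X ω s ∂P := by
  obtain ⟨hi, h0⟩ := h.integral_volterraConv_clocked hK_int hf0 t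
  have hs := h.integrable hK_int hK_nonneg hlam hf0 s
  refine (integral_mono_ae (h.integrable hK_int hK_nonneg hlam hf0 t)
    (((integrable_const (G₀ t)).add (hi.const_mul nu)).sub (hs.const_mul _))
    (h.ae_le hK_int hK_nonneg hlam hst)).trans_eq ?_
  rw [integral_sub' ((integrable_const (G₀ t)).add (hi.const_mul nu)) (hs.const_mul _),
    integral_add' (integrable_const (G₀ t)) (hi.const_mul nu), integral_const_mul, integral_const_mul, h0]
  simp

omit [IsProbabilityMeasure P] in
-- If the integrand dominates `X - c`, the equation becomes a self-improving inequality: the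
-- convolution returns almost all of `X s` once the kernel mass on `[0, t - s]` is near one, and `G₀
-- t` is added with only about `c` subtracted.
theorem ae_le_add (hK_int : LocallyIntegrableOn K (Ici 0)) (hK_nonneg : ∀ t, 0 < t → 0 ≤ K t) :
    ∀ᵐ ω ∂P, ∀ (s t : Icc (0 : ℝ) T) (c : ℝ), s ≤ t → 0 ≤ c →
      (∀ r ≤ t, X ω r - c ≤ drivingPath lam nu f (W ω) ((X ω).val r)) →
      G₀ t + (∫ r in (0 : ℝ)..(t - s : ℝ), K r) * X ω s - c * (∫ r in (0 : ℝ)..T, K r) ≤ X ω t := by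
  filter_upwards [h.volterra, h.continuous, h.ae_continuous_clocked] with ω h1 h2 h3 s t c hst hc hr
  have h4 := le_volterraConv hK_int hK_nonneg h2 (X ω).mono (X ω).nonneg hst
  have h5 := volterraConv_const_le hK_int hK_nonneg c hc t
  have hy : Continuous fun r => -lam * X ω r + nu * W ω (f ((X ω).val r)) :=
    (h2.const_mul (-lam)).add (h3.const_mul nu)
  have h6 : volterraConv K (fun r => X ω r) t ≤
      volterraConv K (fun r => (-lam * X ω r + nu * W ω (f ((X ω).val r))) + c) t := by
    refine volterraConv_mono hK_int hK_nonneg h2 (hy.add_const c) t fun r hrt => ?_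
    have h7 : X ω r - c ≤ nu * W ω (f ((X ω).val r)) - lam * X ω r := hr r hrt
    linarith
  rw [volterraConv_add hK_int hy continuous_const] at h6
  have h8 := h1 t
  have h9 : (∫ r in (0 : ℝ)..(t - s : ℝ), K r) * X ω s ≤ volterraConv K (fun r => X ω r) t := h4
  linarith

end IsWeakSolution

/-! ### The limiting clock -/

/-- The limiting clock at level `a`: the first passage time of `s ↦ (1 + λ) s - ν w(f(s))`
above `a`. -/
def hittingClock (lam nu : ℝ) (f : C(ℝ≥0, ℝ≥0)) (a : ℝ) (w : C(ℝ≥0, ℝ)) : ℝ≥0 :=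
  passage (levelPath (1 + lam) nu f w) a

theorem measurable_hittingClock (lam nu : ℝ) (f : C(ℝ≥0, ℝ≥0)) (a : ℝ) :
    Measurable (hittingClock lam nu f a) := measurable_passage _ _ _ _

theorem sub_drivingPath_le_of_lt_hittingClock {lam nu : ℝ} {f : C(ℝ≥0, ℝ≥0)} {a : ℝ}
    {w : C(ℝ≥0, ℝ)} {s : ℝ≥0} (h : s < hittingClock lam nu f a w) :
    s - drivingPath lam nu f w s ≤ a := by
  have h1 : (1 + lam) * s - nu * w (f s) ≤ a := le_of_lt_passage h
  have h2 : drivingPath lam nu f w s = nu * w (f s) - lam * s := rfl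
  rw [h2]
  linarith

/-- A sequence of weak solutions whose inputs converge, where `μ` is the Wiener measure. -/
structure IsConvergentScheme {T : ℝ} {Ω : ℕ → Type*} [mΩ : ∀ n, MeasurableSpace (Ω n)]
    (P : ∀ n, Measure (Ω n)) (𝒢 : ∀ n, Filtration ℝ≥0 (mΩ n))
    (W : ∀ n, Ω n → C(ℝ≥0, ℝ)) (X : ∀ n, Ω n → IncPath T)
    (G K : ℕ → ℝ → ℝ) (f : ℕ → C(ℝ≥0, ℝ≥0)) (lam nu : ℕ → ℝ)
    (G₀ : ℝ → ℝ) (f₀ : C(ℝ≥0, ℝ≥0)) (lam₀ nu₀ : ℝ) (μ : Measure C(ℝ≥0, ℝ)) : Prop where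
  pos : 0 < T
  sol : ∀ n, IsWeakSolution (P n) (𝒢 n) (W n) (X n) (G n) (K n) (f n) (lam n) (nu n)
  lam_nonneg : ∀ n, 0 ≤ lam n
  clock_zero : ∀ n, f n 0 = 0
  kernel_int : ∀ n, LocallyIntegrableOn (K n) (Ici 0)
  kernel_nonneg : ∀ n t, 0 < t → 0 ≤ K n t
  input_mono : ∀ n, MonotoneOn (G n) (Ici 0)
  input_zero : ∀ n, G n 0 = 0
  kernel_tendsto : ∀ φ : ℝ → ℝ, ContinuousOn φ (Icc 0 T) →
      Tendsto (fun n => ∫ t in (0 : ℝ)..T, φ t * K n t) atTop (𝓝 (φ 0))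
  continuousOn_limit : ContinuousOn G₀ (Icc 0 T)
  input_tendsto : ∀ t ∈ Icc 0 T, Tendsto (fun n => G n t) atTop (𝓝 (G₀ t))
  clock_tendsto : TendstoLocallyUniformly (fun n x => f n x) f₀ atTop
  lam_tendsto : Tendsto lam atTop (𝓝 lam₀)
  nu_tendsto : Tendsto nu atTop (𝓝 nu₀)
  clock_mono : ∀ n, Monotone (f n)
  clock_growth : ∃ C : ℝ, ∀ n (x : ℝ≥0), (f n x : ℝ) ≤ C * (1 + (x : ℝ) ^ 2)
  law_eq : ∀ n, (P n).map (W n) = μ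
  brownian : IsBrownianReal (fun t w => w t) μ

namespace IsConvergentScheme

variable {T : ℝ} {Ω : ℕ → Type*} [mΩ : ∀ n, MeasurableSpace (Ω n)]
    {P : ∀ n, Measure (Ω n)} {𝒢 : ∀ n, Filtration ℝ≥0 (mΩ n)}
    {W : ∀ n, Ω n → C(ℝ≥0, ℝ)} {X : ∀ n, Ω n → IncPath T}
    {G K : ℕ → ℝ → ℝ} {f : ℕ → C(ℝ≥0, ℝ≥0)} {lam nu : ℕ → ℝ}
    {G₀ : ℝ → ℝ} {f₀ : C(ℝ≥0, ℝ≥0)} {lam₀ nu₀ : ℝ} {μ : Measure C(ℝ≥0, ℝ)}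
    (h : IsConvergentScheme P 𝒢 W X G K f lam nu G₀ f₀ lam₀ nu₀ μ)
include h

theorem lam_limit_nonneg : 0 ≤ lam₀ := ge_of_tendsto' h.lam_tendsto h.lam_nonneg

theorem tendsto_clock (x : ℝ≥0) : Tendsto (fun n => f n x) atTop (𝓝 (f₀ x)) :=
  (tendstoLocallyUniformlyOn_univ.2 h.clock_tendsto).tendsto_at (mem_univ x)

theorem clock_limit_mono : Monotone f₀ := fun x y hxy =>
  le_of_tendsto_of_tendsto' (h.tendsto_clock x) (h.tendsto_clock y) fun n => h.clock_mono n hxy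

theorem clock_limit_zero : f₀ 0 = 0 :=
  tendsto_nhds_unique (h.tendsto_clock 0) (by simp [h.clock_zero])

theorem clock_limit_growth : ∃ C : ℝ, ∀ x : ℝ≥0, (f₀ x : ℝ) ≤ C * (1 + (x : ℝ) ^ 2) := by
  obtain ⟨C, hC⟩ := h.clock_growth
  exact ⟨C, fun x => le_of_tendsto' ((NNReal.tendsto_coe).2 (h.tendsto_clock x)) fun n => hC n x⟩

theorem input_limit_zero : G₀ 0 = 0 :=
  tendsto_nhds_unique (h.input_tendsto 0 ⟨le_rfl, h.pos.le⟩) (by simp [h.input_zero])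

theorem input_limit_mono : MonotoneOn G₀ (Icc 0 T) := fun s hs t ht hst =>
  le_of_tendsto_of_tendsto' (h.input_tendsto s hs) (h.input_tendsto t ht) fun n =>
    h.input_mono n hs.1 ht.1 hst

theorem input_limit_nonneg {t : ℝ} (ht : t ∈ Icc 0 T) : 0 ≤ G₀ t := by
  rw [← h.input_limit_zero]
  exact h.input_limit_mono ⟨le_rfl, h.pos.le⟩ ht ht.1

theorem exists_lt_input_limit {t : Icc (0 : ℝ) T} (ht : 0 < (t : ℝ)) {b : ℝ} (hb : b < G₀ t) :
    ∃ s : Icc (0 : ℝ) T, s < t ∧ b < G₀ s := by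
  obtain ⟨δ, hδ, hδ2⟩ := Metric.continuousWithinAt_iff.1 (h.continuousOn_limit t t.2) (G₀ t - b)
    (sub_pos.2 hb)
  have h1 : max 0 (t - δ / 2) < (t : ℝ) := max_lt ht (by linarith)
  have h2 : max 0 (t - δ / 2) ∈ Icc 0 T := ⟨le_max_left _ _, h1.le.trans t.2.2⟩
  refine ⟨⟨_, h2⟩, h1, ?_⟩
  have h3 := hδ2 h2 (by
    rw [Real.dist_eq, abs_lt]
    constructor <;> linarith [le_max_right 0 (t - δ / 2)])
  rw [Real.dist_eq, abs_lt] at h3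
  show b < G₀ (max 0 (t - δ / 2))
  linarith

theorem tendsto_kernel {η : ℝ} (hη : 0 < η) (hηT : η ≤ T) :
    Tendsto (fun n => ∫ t in (0 : ℝ)..η, K n t) atTop (𝓝 1) :=
  tendsto_integral_kernel h.pos h.kernel_int h.kernel_nonneg h.kernel_tendsto hη hηT

theorem measurable_hitting (n : ℕ) (b : ℝ) :
    Measurable fun ω => (hittingClock lam₀ nu₀ f₀ b (W n ω) : ℝ) :=
  ((measurable_hittingClock _ _ _ _).comp (h.sol n).measurable_path).coe_nnreal_real

theorem integrable_hittingClock [IsProbabilityMeasure μ] {b : ℝ} (hb : 0 ≤ b) :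
    Integrable (fun w => (hittingClock lam₀ nu₀ f₀ b w : ℝ)) μ := by
  obtain ⟨C, hC⟩ := h.clock_limit_growth
  exact integrable_passage h.brownian h.clock_limit_mono h.clock_limit_zero
    (by linarith [h.lam_limit_nonneg]) hb hC

theorem integral_hittingClock [IsProbabilityMeasure μ] {b : ℝ} (hb : 0 ≤ b) :
    ∫ w, (hittingClock lam₀ nu₀ f₀ b w : ℝ) ∂μ = b / (1 + lam₀) := by
  obtain ⟨C, hC⟩ := h.clock_limit_growth
  exact integral_passage h.brownian h.clock_limit_mono h.clock_limit_zero
    (by linarith [h.lam_limit_nonneg]) hb hC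

theorem ae_exists_lt [IsProbabilityMeasure μ] (b : ℝ) (hb : 0 ≤ b) :
    ∀ᵐ w ∂μ, ∃ s, b < levelPath (1 + lam₀) nu₀ f₀ w s :=
  ae_exists_lt_levelPath h.brownian h.clock_limit_mono h.clock_limit_zero
    (by linarith [h.lam_limit_nonneg]) hb

/-- A non-negative variable of mean `0 / (1 + lam₀)` vanishes almost surely. This settles level zero
and the time `t = 0`. -/
theorem ae_hittingClock_zero [IsProbabilityMeasure μ] : ∀ᵐ w ∂μ, hittingClock lam₀ nu₀ f₀ 0 w = 0 := by
  have h1 := h.integral_hittingClock le_rfl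
  rw [zero_div, integral_eq_zero_iff_of_nonneg (fun w => NNReal.coe_nonneg _)
    (h.integrable_hittingClock le_rfl)] at h1
  filter_upwards [h1] with w hw
  exact NNReal.coe_injective hw

theorem ae_path {p : C(ℝ≥0, ℝ) → Prop} (hp : ∀ᵐ w ∂μ, p w) (n : ℕ) : ∀ᵐ ω ∂P n, p (W n ω) := by
  rw [← h.law_eq n] at hp
  exact ae_of_ae_map (h.sol n).measurable_path.aemeasurable hp

theorem integrable_hitting [IsProbabilityMeasure μ] (n : ℕ) {b : ℝ} (hb : 0 ≤ b) :
    Integrable (fun ω => (hittingClock lam₀ nu₀ f₀ b (W n ω) : ℝ)) (P n) := by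
  have h1 := h.integrable_hittingClock hb
  rw [← h.law_eq n] at h1
  exact h1.comp_measurable (h.sol n).measurable_path

theorem integral_path (n : ℕ) {g : C(ℝ≥0, ℝ) → ℝ} (hg : Measurable g) :
    ∫ ω, g (W n ω) ∂P n = ∫ w, g w ∂μ := by
  rw [← h.law_eq n, integral_map (h.sol n).measurable_path.aemeasurable hg.aestronglyMeasurable]

theorem integral_hitting [IsProbabilityMeasure μ] (n : ℕ) {b : ℝ} (hb : 0 ≤ b) :
    ∫ ω, (hittingClock lam₀ nu₀ f₀ b (W n ω) : ℝ) ∂P n = b / (1 + lam₀) := by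
  rw [← h.integral_hittingClock hb]
  exact h.integral_path n (measurable_hittingClock _ _ _ _).coe_nnreal_real

theorem integrable_sol [∀ n, IsProbabilityMeasure (P n)] (n : ℕ) (t : Icc (0 : ℝ) T) : Integrable (fun ω => X n ω t) (P n) :=
  (h.sol n).integrable (h.kernel_int n) (h.kernel_nonneg n) (h.lam_nonneg n) (h.clock_zero n) t

/-! ### The solutions do not lag behind the limiting clock -/

omit h in
theorem le_of_increments {x : Icc (0 : ℝ) T → ℝ} (hx : ∀ s, 0 ≤ x s) {s t : Icc (0 : ℝ) T}
    (hst : s ≤ t) {p : ℕ} (hp : 0 < p) {δ : ℝ}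
    (hinc : ∀ r r' : Icc (0 : ℝ) T, s ≤ r → r' ≤ t → (r' - r : ℝ) = (t - s) / p → x r + δ ≤ x r') :
    p * δ ≤ x t := by
  have hst' : (s : ℝ) ≤ t := hst
  have hp' : (0 : ℝ) < p := by exact_mod_cast hp
  set η : ℝ := (t - s) / p with hη
  have hη0 : 0 ≤ η := div_nonneg (by linarith) hp'.le
  have hpη : p * η = t - s := mul_div_cancel₀ _ hp'.ne'
  have hmem : ∀ j : ℕ, j ≤ p → (s : ℝ) + j * η ≤ t := by
    intro j hj
    have : (j : ℝ) * η ≤ p * η := by gcongr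
    linarith
  have hs := s.2.1
  have ht := t.2.2
  have key : ∀ j : ℕ, ∀ hj : j ≤ p, j * δ ≤ x ⟨s + j * η, by positivity, (hmem j hj).trans ht⟩ := by
    intro j
    induction j with
    | zero =>
      intro _
      simpa using hx _
    | succ j ih =>
      intro hj
      have h1 := ih (by omega)
      refine (?_ : _ ≤ _).trans (hinc ⟨s + j * η, by positivity, (hmem j (by omega)).trans ht⟩ _ ?_ ?_ ?_)
      · push_cast
        linarith
      · show (s : ℝ) ≤ s + j * η
        have : 0 ≤ (j : ℝ) * η := by positivity
        linarith
      · exact hmem (j + 1) hj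
      · push_cast
        ring
  have h2 := key p le_rfl
  have h3 : (⟨s + p * η, by positivity, (hmem p le_rfl).trans ht⟩ : Icc (0 : ℝ) T) = t := by
    apply Subtype.ext
    show (s : ℝ) + p * η = t
    linarith
  rwa [h3] at h2

omit h in
theorem tendsto_measure_lt_of_real [IsProbabilityMeasure μ] {g : C(ℝ≥0, ℝ) → ℝ} (hg : Measurable g) :
    Tendsto (fun M : ℕ => μ {w | (M : ℝ) < g w}) atTop (𝓝 0) := by
  have h1 := tendsto_measure_of_tendsto_indicator_of_isFiniteMeasure atTop (μ := μ)
    (As := fun M : ℕ => {w | (M : ℝ) < g w}) (A := ∅)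
    (fun M => measurableSet_lt measurable_const hg) fun w => by
      obtain ⟨N, hN⟩ := exists_nat_ge (g w)
      filter_upwards [eventually_ge_atTop N] with M hM
      refine iff_of_false (fun hw => ?_) (notMem_empty w)
      have hw' : (M : ℝ) < g w := hw
      have : (N : ℝ) ≤ M := by exact_mod_cast hM
      linarith
  simpa using h1

/-- By contradiction. With margin `δ = G₀ s - b`, if `X t` lies before the passage time, then the
limiting driving path is at least `r - b` at every value `r` taken by `X` up to `t`, and the true
one is at least `r - (b + δ / 4)`. By `ae_le_add`, `X` then gains at least `δ / 4` on each of `p`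
steps between `s` and `t`, exceeding `M`. -/
theorem eventually_le_sol {s t : Icc (0 : ℝ) T} (hst : s < t) {b : ℝ} (hb0 : 0 ≤ b)
    (hb : b < G₀ s) (M : ℝ≥0) :
    ∃ ε > 0, ∀ᶠ n in atTop, ∀ᵐ ω ∂P n, (hittingClock lam₀ nu₀ f₀ b (W n ω)) ≤ M →
      (∀ r ≤ M, |drivingPath (lam n) (nu n) (f n) (W n ω) r -
        drivingPath lam₀ nu₀ f₀ (W n ω) r| < ε) →
      hittingClock lam₀ nu₀ f₀ b (W n ω) ≤ (X n ω).val t := by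
  have hst' : (s : ℝ) < t := hst
  set δ := G₀ s - b with hδ
  have hδ0 : 0 < δ := sub_pos.2 hb
  -- So many steps that `p * (δ / 4) > M`.
  obtain ⟨p, hp⟩ := exists_nat_gt (M / (δ / 4) : ℝ)
  have hp0' : (0 : ℝ) < p := (by positivity : (0 : ℝ) ≤ M / (δ / 4)).trans_lt hp
  have hp0 : 0 < p := by exact_mod_cast hp0'
  rw [div_lt_iff₀ (by positivity)] at hp
  set η : ℝ := (t - s) / p with hη
  have hη0 : 0 < η := div_pos (sub_pos.2 hst') hp0'
  have hηT : η ≤ T := by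
    refine (div_le_self (sub_pos.2 hst').le (by exact_mod_cast hp0)).trans ?_
    linarith [s.2.1, t.2.2]
  refine ⟨δ / 4, by positivity, ?_⟩
  have h1 : Tendsto (fun n => G n s - (b + δ / 4) * ∫ r in (0 : ℝ)..T, K n r) atTop
      (𝓝 (G₀ s - (b + δ / 4) * 1)) :=
    (h.input_tendsto s s.2).sub ((h.tendsto_kernel h.pos le_rfl).const_mul _)
  have h2 : Tendsto (fun n => |1 - ∫ r in (0 : ℝ)..η, K n r| * (M : ℝ)) atTop (𝓝 (|1 - 1| * M)) :=
    (((h.tendsto_kernel hη0 hηT).const_sub 1).abs).mul_const _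
  rw [sub_self, abs_zero, zero_mul] at h2
  -- The first limit is `3 δ / 4`, so the gain per step is eventually above `δ / 2`; the missing
  -- kernel mass costs less than `δ / 4` of it.
  filter_upwards [h1.eventually_const_lt (u := δ / 2) (by linarith),
    h2.eventually_lt_const (u := δ / 4) (by positivity)] with n hn1 hn2
  filter_upwards [(h.sol n).ae_le_add (h.kernel_int n) (h.kernel_nonneg n)] with ω hω hM hF
  by_contra! hlt
  have hle : ∀ r ≤ t, (X n ω).val r ≤ (X n ω).val t := fun r hr => (X n ω).mono hr
  have hXM : ∀ r ≤ t, X n ω r ≤ M := fun r hr => ((hle r hr).trans hlt.le).trans hM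
  have hdr : ∀ r ≤ t, X n ω r - (b + δ / 4) ≤
      drivingPath (lam n) (nu n) (f n) (W n ω) ((X n ω).val r) := by
    intro r hr
    have h3 : X n ω r - drivingPath lam₀ nu₀ f₀ (W n ω) ((X n ω).val r) ≤ b :=
      sub_drivingPath_le_of_lt_hittingClock ((hle r hr).trans_lt hlt)
    have h4 := abs_lt.1 (hF ((X n ω).val r) (show (X n ω).val r ≤ M from hXM r hr))
    linarith [h4.1]
  have h5 : p * (δ / 4) ≤ X n ω t := by
    refine le_of_increments (X n ω).nonneg hst.le hp0 fun r r' hr hr' hrr => ?_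
    have hrr' : r ≤ r' := by
      show (r : ℝ) ≤ r'
      have : (r' : ℝ) - r = η := hrr
      linarith
    have h6 := hω r r' (b + δ / 4) hrr' (by positivity) fun q hq => hdr q (hq.trans hr')
    rw [hrr, ← hη] at h6
    have h7 : G n s ≤ G n r' := h.input_mono n s.2.1 r'.2.1 (hr.trans hrr')
    have h8 : (1 - ∫ q in (0 : ℝ)..η, K n q) * X n ω r ≤ |1 - ∫ q in (0 : ℝ)..η, K n q| * M :=
      mul_le_mul (le_abs_self _) (hXM r (hrr'.trans hr')) ((X n ω).nonneg r) (abs_nonneg _)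
    linarith
  have := hXM t le_rfl
  linarith

theorem tendsto_measure_sol_lt [IsProbabilityMeasure μ] (t : Icc (0 : ℝ) T) {b : ℝ} (hb0 : 0 ≤ b)
    (hb : b = 0 ∨ b < G₀ t) :
    Tendsto (fun n => P n {ω | X n ω t < hittingClock lam₀ nu₀ f₀ b (W n ω)}) atTop (𝓝 0) := by
  rcases hb with rfl | hb
  · refine tendsto_const_nhds.congr fun n => (measure_eq_zero_iff_ae_notMem.2 ?_).symm
    filter_upwards [h.ae_path h.ae_hittingClock_zero n] with ω hω
    show ¬ _ < _
    rw [hω]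
    simpa using (X n ω).nonneg t
  · have ht : 0 < (t : ℝ) := by
      refine t.2.1.lt_of_ne fun h0 => ?_
      rw [← h0, h.input_limit_zero] at hb
      linarith
    obtain ⟨s, hst, hs⟩ := h.exists_lt_input_limit ht hb
    refine ENNReal.tendsto_nhds_zero.2 fun ε hε => ?_
    have hε2 : 0 < ε / 2 := ENNReal.half_pos hε.ne'
    -- The passage time has the same law for all `n`, so one bound `M` serves every `n`.
    obtain ⟨M, hM⟩ := (((tendsto_measure_lt_of_real (μ := μ)
      (measurable_hittingClock lam₀ nu₀ f₀ b).coe_nnreal_real).eventually_lt_const hε2)).exists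
    obtain ⟨e, he, hev⟩ := h.eventually_le_sol hst hb0 hs (M : ℝ≥0)
    have hF := mem_couplingFilter.1 (couplingFilter_drivingPath_le (fun n => (h.sol n).measurable_path)
      h.law_eq h.clock_tendsto h.lam_tendsto h.nu_tendsto (setOf_forall_le_mem_uniformity (M : ℝ≥0) he))
    filter_upwards [hev, hF.eventually_lt_const hε2] with n hn1 hn2
    have h1 : P n {ω | (M : ℝ) < hittingClock lam₀ nu₀ f₀ b (W n ω)} < ε / 2 := by
      rw [← h.law_eq n, Measure.map_apply (h.sol n).measurable_path (measurableSet_lt measurable_const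
        (measurable_hittingClock lam₀ nu₀ f₀ b).coe_nnreal_real)] at hM
      exact hM
    rw [← ENNReal.add_halves ε]
    refine le_trans ?_ (add_le_add h1.le hn2.le)
    refine (measure_mono_ae ?_).trans (measure_union_le _ _)
    filter_upwards [hn1] with ω hω hlt
    by_contra hcon
    obtain ⟨hc1, hc2⟩ := not_or.1 hcon
    have hc1' : (hittingClock lam₀ nu₀ f₀ b (W n ω) : ℝ) ≤ M := not_lt.1 hc1
    have := hω (by exact_mod_cast hc1') (not_not.1 hc2)
    have hlt' : X n ω t < hittingClock lam₀ nu₀ f₀ b (W n ω) := hlt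
    exact absurd this (not_le.2 hlt')

end IsConvergentScheme

/-! ### Convergence of the solutions to the limiting clock in mean -/

namespace IsConvergentScheme

variable {T : ℝ} {Ω : ℕ → Type*} [mΩ : ∀ n, MeasurableSpace (Ω n)]
    {P : ∀ n, Measure (Ω n)} [∀ n, IsProbabilityMeasure (P n)] {𝒢 : ∀ n, Filtration ℝ≥0 (mΩ n)}
    {W : ∀ n, Ω n → C(ℝ≥0, ℝ)} {X : ∀ n, Ω n → IncPath T}
    {G K : ℕ → ℝ → ℝ} {f : ℕ → C(ℝ≥0, ℝ≥0)} {lam nu : ℕ → ℝ}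
    {G₀ : ℝ → ℝ} {f₀ : C(ℝ≥0, ℝ≥0)} {lam₀ nu₀ : ℝ} {μ : Measure C(ℝ≥0, ℝ)} [IsProbabilityMeasure μ]
    (h : IsConvergentScheme P 𝒢 W X G K f lam nu G₀ f₀ lam₀ nu₀ μ)
include h

theorem integrable_posPart (n : ℕ) (t : Icc (0 : ℝ) T) {b : ℝ} (hb0 : 0 ≤ b) :
    Integrable (fun ω => max ((hittingClock lam₀ nu₀ f₀ b (W n ω) : ℝ) - X n ω t) 0) (P n) :=
  ((h.integrable_hitting n hb0).sub (h.integrable_sol n t)).pos_part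

/-- Split `(S - X)⁺ ≤ M 1{X < S} + S 1{S > M}`. The tail term does not depend on `n`, as `S` has a
fixed integrable law, and the first term vanishes in the limit by `tendsto_measure_sol_lt`. -/
theorem tendsto_integral_posPart (t : Icc (0 : ℝ) T) {b : ℝ} (hb0 : 0 ≤ b)
    (hb : b = 0 ∨ b < G₀ t) :
    Tendsto (fun n => ∫ ω, max ((hittingClock lam₀ nu₀ f₀ b (W n ω) : ℝ) - X n ω t) 0 ∂P n) atTop
      (𝓝 0) := by
  set S : C(ℝ≥0, ℝ) → ℝ := fun w => hittingClock lam₀ nu₀ f₀ b w with hS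
  have hSm : Measurable S := (measurable_hittingClock _ _ _ _).coe_nnreal_real
  have hS0 : ∀ w, 0 ≤ S w := fun w => NNReal.coe_nonneg _
  have hSi : Integrable S μ := h.integrable_hittingClock hb0
  have htail : Tendsto (fun M : ℕ => ∫ w, {w | (M : ℝ) < S w}.indicator S w ∂μ) atTop (𝓝 0) := by
    have h1 := tendsto_integral_of_dominated_convergence (μ := μ)
      (F := fun M : ℕ => {w | (M : ℝ) < S w}.indicator S) (f := fun _ => 0) S
      (fun M => (hSm.indicator (measurableSet_lt measurable_const hSm)).aestronglyMeasurable) hSi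
      (fun M => ae_of_all _ fun w => by
        rw [Real.norm_of_nonneg (indicator_nonneg (fun w _ => hS0 w) w)]
        exact indicator_le_self' (fun w _ => hS0 w) w) (ae_of_all _ fun w => ?_)
    · simpa using h1
    · obtain ⟨N, hN⟩ := exists_nat_ge (S w)
      refine tendsto_const_nhds.congr' ?_
      filter_upwards [eventually_ge_atTop N] with M hM
      rw [indicator_of_notMem]
      intro hw
      have hw' : (M : ℝ) < S w := hw
      have : (N : ℝ) ≤ M := by exact_mod_cast hM
      linarith
  refine tendsto_order.2 ⟨fun a ha => Eventually.of_forall fun n =>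
    ha.trans_le (integral_nonneg fun ω => le_max_right _ _), fun ε hε => ?_⟩
  obtain ⟨M, hM⟩ := (htail.eventually_lt_const (half_pos hε)).exists
  have h2 : Tendsto (fun n => (M : ℝ) * (P n).real {ω | X n ω t < S (W n ω)}) atTop (𝓝 (M * 0)) :=
    ((ENNReal.tendsto_toReal ENNReal.zero_ne_top).comp (h.tendsto_measure_sol_lt t hb0 hb)).const_mul _
  rw [mul_zero] at h2
  filter_upwards [h2.eventually_lt_const (half_pos hε)] with n hn
  have hAm : MeasurableSet {ω | X n ω t < S (W n ω)} :=
    measurableSet_lt ((h.sol n).measurable t) (h.measurable_hitting n b)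
  have hi1 : Integrable ({ω | X n ω t < S (W n ω)}.indicator fun _ => (M : ℝ)) (P n) :=
    (integrable_const _).indicator hAm
  have hi2m : Measurable ({w | (M : ℝ) < S w}.indicator S) :=
    hSm.indicator (measurableSet_lt measurable_const hSm)
  have hi2 : Integrable (fun ω => {w | (M : ℝ) < S w}.indicator S (W n ω)) (P n) := by
    have h3 : Integrable ({w | (M : ℝ) < S w}.indicator S) μ :=
      hSi.indicator (measurableSet_lt measurable_const hSm)
    rw [← h.law_eq n] at h3
    exact h3.comp_measurable (h.sol n).measurable_path
  calc ∫ ω, max (S (W n ω) - X n ω t) 0 ∂P n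
      ≤ ∫ ω, ({ω | X n ω t < S (W n ω)}.indicator (fun _ => (M : ℝ)) ω +
          {w | (M : ℝ) < S w}.indicator S (W n ω)) ∂P n := by
        refine integral_mono (h.integrable_posPart n t hb0) (hi1.add hi2) fun ω => ?_
        have hx := (X n ω).nonneg t
        have hind : 0 ≤ {ω | X n ω t < S (W n ω)}.indicator (fun _ => (M : ℝ)) ω :=
          indicator_nonneg (fun _ _ => Nat.cast_nonneg M) ω
        have hind2 : 0 ≤ {w | (M : ℝ) < S w}.indicator S (W n ω) :=
          indicator_nonneg (fun w _ => hS0 w) _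
        refine max_le ?_ (add_nonneg hind hind2)
        by_cases h4 : X n ω t < S (W n ω)
        · by_cases h5 : (M : ℝ) < S (W n ω)
          · rw [indicator_of_mem (s := {w | (M : ℝ) < S w}) h5]
            linarith
          · rw [indicator_of_mem (s := {ω | X n ω t < S (W n ω)}) h4]
            push Not at h5
            linarith
        · push Not at h4
          linarith
    _ = M * (P n).real {ω | X n ω t < S (W n ω)} + ∫ w, {w | (M : ℝ) < S w}.indicator S w ∂μ := by
        rw [integral_add hi1 hi2, integral_indicator_const _ hAm, h.integral_path n hi2m, smul_eq_mul,
          mul_comm]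
    _ < ε := by linarith

theorem eventually_le_integral (t : Icc (0 : ℝ) T) {b : ℝ} (hb0 : 0 ≤ b)
    (hb : b = 0 ∨ b < G₀ t) {ε : ℝ} (hε : 0 < ε) :
    ∀ᶠ n in atTop, b / (1 + lam₀) - ε ≤ ∫ ω, X n ω t ∂P n := by
  filter_upwards [(h.tendsto_integral_posPart t hb0 hb).eventually_lt_const hε] with n hn
  have h1 := integral_mono ((h.integrable_hitting n hb0).sub (h.integrable_sol n t))
    (h.integrable_posPart n t hb0) fun ω => le_max_left _ _
  rw [integral_sub' (h.integrable_hitting n hb0) (h.integrable_sol n t),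
    h.integral_hitting n hb0] at h1
  linarith

omit [∀ n, IsProbabilityMeasure (P n)] [IsProbabilityMeasure μ] in
-- Left-continuity of `G₀` provides a level just below `G₀ t` that is still admissible at an earlier
-- time `s`, leaving room for a kernel of mass nearly one on `[0, t - s]`.
theorem exists_level {t : Icc (0 : ℝ) T} (ht : 0 < (t : ℝ)) {ε : ℝ} (hε : 0 < ε) :
    ∃ b, 0 ≤ b ∧ G₀ t - ε ≤ b ∧ b ≤ G₀ t ∧ (b = 0 ∨ b < G₀ t) ∧
      ∃ s : Icc (0 : ℝ) T, s < t ∧ (b = 0 ∨ b < G₀ s) := by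
  have h0 := h.input_limit_nonneg t.2
  rcases le_total (G₀ t - ε) 0 with h1 | h1
  · exact ⟨0, le_rfl, h1, h0, Or.inl rfl, ⟨0, le_rfl, h.pos.le⟩, ht, Or.inl rfl⟩
  · obtain ⟨s, hs, hs2⟩ := h.exists_lt_input_limit ht (b := G₀ t - ε) (by linarith)
    exact ⟨G₀ t - ε, h1, le_rfl, by linarith, Or.inr (by linarith), s, hs, Or.inr hs2⟩

/-- The lower bound for the mean at `s` is inserted into `integral_le`, using `G₀ - λ G₀ / (1 + λ) =
G₀ / (1 + λ)`. The error `2 λ ε` comes from the level and from the lower bound; one more `ε` makes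
the inequality strict. -/
theorem eventually_integral_le {t : Icc (0 : ℝ) T} (ht : 0 < (t : ℝ)) {ε : ℝ} (hε : 0 < ε) :
    ∀ᶠ n in atTop, ∫ ω, X n ω t ∂P n ≤ G₀ t / (1 + lam₀) + (2 * lam₀ + 1) * ε := by
  obtain ⟨b, hb0, hbε, hbt, -, s, hst, hbs⟩ := h.exists_level ht hε
  have hl := h.lam_limit_nonneg
  have hst' : (s : ℝ) < t := hst
  have h1 : Tendsto (fun n => G n t - lam n * (∫ r in (0 : ℝ)..(t - s : ℝ), K n r) *
      (b / (1 + lam₀) - ε)) atTop (𝓝 (G₀ t - lam₀ * 1 * (b / (1 + lam₀) - ε))) :=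
    (h.input_tendsto t t.2).sub ((h.lam_tendsto.mul (h.tendsto_kernel (sub_pos.2 hst')
      (by linarith [s.2.1, t.2.2]))).mul_const _)
  have h2 : G₀ t - lam₀ * 1 * (b / (1 + lam₀) - ε) < G₀ t / (1 + lam₀) + (2 * lam₀ + 1) * ε := by
    have h3 : (G₀ t - ε) / (1 + lam₀) ≤ b / (1 + lam₀) := by gcongr
    have h4 : G₀ t = G₀ t / (1 + lam₀) + lam₀ * (G₀ t / (1 + lam₀)) := by
      field_simp
    have h5 : ε / (1 + lam₀) ≤ ε := div_le_self hε.le (by linarith)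
    rw [sub_div] at h3
    nlinarith
  filter_upwards [h1.eventually_lt_const h2, h.eventually_le_integral s hb0 hbs hε] with n hn1 hn2
  have h3 := (h.sol n).integral_le (h.kernel_int n) (h.kernel_nonneg n) (h.lam_nonneg n)
    (h.clock_zero n) hst.le
  have h4 : 0 ≤ ∫ r in (0 : ℝ)..(t - s : ℝ), K n r :=
    intervalIntegral_nonneg_of_forall_Ioo (by linarith) fun r hr => h.kernel_nonneg n r hr.1
  have h5 := mul_le_mul_of_nonneg_left hn2 (mul_nonneg (h.lam_nonneg n) h4)
  linarith

/-- For the passage times `B ≤ A` of the levels `b ≤ G₀ t`, `|X - A| ≤ (X - B) + 2 (B - X)⁺ + (A -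
B)`. The means of `A` and `B` are explicit, so the upper bound on the mean of `X` suffices. -/
theorem eventually_integral_abs_sub_le {t : Icc (0 : ℝ) T} (ht : 0 < (t : ℝ)) {ε : ℝ} (hε : 0 < ε) :
    ∀ᶠ n in atTop, ∫ ω, |X n ω t - hittingClock lam₀ nu₀ f₀ (G₀ t) (W n ω)| ∂P n ≤
      (2 * lam₀ + 5) * ε := by
  obtain ⟨b, hb0, hbε, hbt, hb, -⟩ := h.exists_level ht hε
  have ha0 := h.input_limit_nonneg t.2
  have hl := h.lam_limit_nonneg
  filter_upwards [h.eventually_integral_le ht hε,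
    (h.tendsto_integral_posPart t hb0 hb).eventually_lt_const hε] with n hn1 hn2
  have hX := h.integrable_sol n t
  have hA := h.integrable_hitting n ha0
  have hB := h.integrable_hitting n hb0
  have hp := h.integrable_posPart n t hb0
  calc ∫ ω, |X n ω t - hittingClock lam₀ nu₀ f₀ (G₀ t) (W n ω)| ∂P n
      ≤ ∫ ω, (((X n ω t - hittingClock lam₀ nu₀ f₀ b (W n ω)) +
          2 * max ((hittingClock lam₀ nu₀ f₀ b (W n ω) : ℝ) - X n ω t) 0) +
          ((hittingClock lam₀ nu₀ f₀ (G₀ t) (W n ω) : ℝ) - hittingClock lam₀ nu₀ f₀ b (W n ω)))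
          ∂P n := by
        refine integral_mono_ae (hX.sub hA).abs (((hX.sub hB).add (hp.const_mul 2)).add (hA.sub hB)) ?_
        filter_upwards [h.ae_path (h.ae_exists_lt _ ha0) n] with ω hω
        have hm : (hittingClock lam₀ nu₀ f₀ b (W n ω) : ℝ) ≤ hittingClock lam₀ nu₀ f₀ (G₀ t) (W n ω) :=
          passage_mono hbt hω
        show |X n ω t - hittingClock lam₀ nu₀ f₀ (G₀ t) (W n ω)| ≤ (X n ω t -
          hittingClock lam₀ nu₀ f₀ b (W n ω)) +
          2 * max ((hittingClock lam₀ nu₀ f₀ b (W n ω) : ℝ) - X n ω t) 0 +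
          ((hittingClock lam₀ nu₀ f₀ (G₀ t) (W n ω) : ℝ) - hittingClock lam₀ nu₀ f₀ b (W n ω))
        rw [abs_le]
        have h1 := le_max_left ((hittingClock lam₀ nu₀ f₀ b (W n ω) : ℝ) - X n ω t) 0
        have h2 := le_max_right ((hittingClock lam₀ nu₀ f₀ b (W n ω) : ℝ) - X n ω t) 0
        constructor <;> linarith
    _ = (∫ ω, X n ω t ∂P n - b / (1 + lam₀)) +
          2 * (∫ ω, max ((hittingClock lam₀ nu₀ f₀ b (W n ω) : ℝ) - X n ω t) 0 ∂P n) +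
          (G₀ t / (1 + lam₀) - b / (1 + lam₀)) := by
        refine (integral_add ((hX.sub hB).add (hp.const_mul 2)) (hA.sub hB)).trans ?_
        rw [integral_add' (hX.sub hB) (hp.const_mul 2), integral_sub' hX hB, integral_sub' hA hB,
          integral_const_mul, h.integral_hitting n ha0, h.integral_hitting n hb0]
    _ ≤ (2 * lam₀ + 5) * ε := by
        have h1 : (G₀ t - ε) / (1 + lam₀) ≤ b / (1 + lam₀) := by gcongr
        have h5 : ε / (1 + lam₀) ≤ ε := div_le_self hε.le (by linarith)
        rw [sub_div] at h1
        linarith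

/-- Markov's inequality for the `L¹` limit. The time zero is separate, as it has no earlier time;
there both variables vanish. -/
theorem couplingFilter_sol_le (t : Icc (0 : ℝ) T) :
    couplingFilter P (fun n ω => X n ω t)
      (fun n ω => (hittingClock lam₀ nu₀ f₀ (G₀ t) (W n ω) : ℝ)) ≤ uniformity ℝ := by
  refine couplingFilter_real_le fun δ hδ => ?_
  rcases t.2.1.eq_or_lt with ht | ht
  · refine tendsto_const_nhds.congr fun n => (measure_eq_zero_iff_ae_notMem.2 ?_).symm
    filter_upwards [h.ae_path h.ae_hittingClock_zero n, (h.sol n).start_zero] with ω h1 h2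
    show ¬ _ ≤ _
    rw [h2 t ht.symm, ← ht, h.input_limit_zero, h1]
    simpa using hδ
  · have hl := h.lam_limit_nonneg
    have h1 : Tendsto (fun n => ∫ ω, |X n ω t - hittingClock lam₀ nu₀ f₀ (G₀ t) (W n ω)| ∂P n) atTop
        (𝓝 0) := by
      refine tendsto_order.2 ⟨fun a ha => Eventually.of_forall fun n =>
        ha.trans_le (integral_nonneg fun ω => abs_nonneg _), fun ε hε => ?_⟩
      have h5 : 0 < 2 * lam₀ + 5 := by linarith
      filter_upwards [h.eventually_integral_abs_sub_le ht (ε := ε / 2 / (2 * lam₀ + 5))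
        (by positivity)] with n hn
      rw [mul_div_cancel₀ _ h5.ne'] at hn
      linarith
    have h2 : ∀ n, P n {ω | δ ≤ |X n ω t - hittingClock lam₀ nu₀ f₀ (G₀ t) (W n ω)|} ≤
        ENNReal.ofReal (δ⁻¹ * ∫ ω, |X n ω t - hittingClock lam₀ nu₀ f₀ (G₀ t) (W n ω)| ∂P n) := by
      intro n
      rw [← ofReal_measureReal (measure_ne_top _ _)]
      refine ENNReal.ofReal_le_ofReal ?_
      rw [inv_mul_eq_div, le_div_iff₀ hδ, mul_comm]
      exact mul_meas_ge_le_integral_of_nonneg (ae_of_all _ fun ω => abs_nonneg _)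
        ((h.integrable_sol n t).sub (h.integrable_hitting n (h.input_limit_nonneg t.2))).abs δ
    have h3 : Tendsto (fun n => ENNReal.ofReal (δ⁻¹ *
        ∫ ω, |X n ω t - hittingClock lam₀ nu₀ f₀ (G₀ t) (W n ω)| ∂P n)) atTop
        (𝓝 (ENNReal.ofReal (δ⁻¹ * 0))) := ENNReal.tendsto_ofReal (h1.const_mul _)
    rw [mul_zero, ENNReal.ofReal_zero] at h3
    exact tendsto_of_tendsto_of_tendsto_of_le_of_le tendsto_const_nhds h3 (fun _ => zero_le) h2

end IsConvergentScheme

/-! ### The limiting time change as a càdlàg path -/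

/-- Strict exceedance gives right-continuity: a point where `z > a` also exceeds all levels slightly
above `a`. -/
theorem continuousWithinAt_passage {z : ℝ≥0 → ℝ} (hne : ∀ a, ∃ s, a < z s) (a : ℝ) :
    ContinuousWithinAt (fun b => (passage z b : ℝ)) (Ici a) a := by
  refine (NNReal.continuous_coe.tendsto _).comp (tendsto_order.2 ⟨fun r hr => ?_, fun r hr => ?_⟩)
  · exact eventually_nhdsWithin_of_forall fun b hb => hr.trans_le (passage_mono hb (hne b))
  · obtain ⟨s, hs, hs2⟩ := exists_lt_of_passage_lt (hne a) hr
    filter_upwards [nhdsWithin_le_nhds (Iio_mem_nhds hs2)] with b hb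
    exact (passage_le hb).trans_lt hs

section Clock

variable {T : ℝ} {g : Icc (0 : ℝ) T → ℝ} (hg : Continuous g) (hm : Monotone g)

/-- The first passage times of `z` above the increasing levels `g t`, as a path. -/
def passagePath (z : ℝ≥0 → ℝ) (hne : ∀ a, ∃ s, a < z s) : IncPath T where
  toFun t := passage z (g t)
  right_continuous t := (continuousWithinAt_passage hne (g t)).comp (f := g)
    hg.continuousWithinAt fun _ hs => hm hs
  exists_left_limit t := by
    have hmono : Monotone fun t => (passage z (g t) : ℝ) := fun _ _ hst =>
      passage_mono (hm hst) (hne _)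
    exact ⟨_, hmono.tendsto_nhdsLT t⟩
  nonneg t := NNReal.coe_nonneg _
  mono _ _ hst := passage_mono (hm hst) (hne _)

/-- The path which is identically zero. -/
def zeroPath : IncPath T where
  toFun _ := 0
  right_continuous _ := continuousWithinAt_const
  exists_left_limit _ := ⟨0, tendsto_const_nhds⟩
  nonneg _ := le_rfl
  mono _ _ _ := le_rfl

open Classical in
/-- The limiting time change `t ↦ inf {s : (1 + λ) s - ν w(f(s)) > g(t)}`, where paths `w` for
which some level is not exceeded are given the value zero. -/
def clockPath (lam nu : ℝ) (f : C(ℝ≥0, ℝ≥0)) (w : C(ℝ≥0, ℝ)) : IncPath T :=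
  if h : ∀ a, ∃ s, a < levelPath (1 + lam) nu f w s then passagePath hg hm _ h else zeroPath

theorem clockPath_val {lam nu : ℝ} {f : C(ℝ≥0, ℝ≥0)} {w : C(ℝ≥0, ℝ)}
    (h : ∀ a, ∃ s, a < levelPath (1 + lam) nu f w s) (t : Icc (0 : ℝ) T) :
    (clockPath hg hm lam nu f w).val t = hittingClock lam nu f (g t) w := by
  rw [clockPath, dif_pos h]
  rfl

theorem forall_exists_lt_iff {z : ℝ≥0 → ℝ} :
    (∀ a, ∃ s, a < z s) ↔ ∀ k : ℕ, ∃ s, (k : ℝ) < z s := by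
  refine ⟨fun h k => h k, fun h a => ?_⟩
  obtain ⟨k, hk⟩ := exists_nat_ge a
  obtain ⟨s, hs⟩ := h k
  exact ⟨s, hk.trans_lt hs⟩

theorem measurableSet_forall_exists_lt (lam nu : ℝ) (f : C(ℝ≥0, ℝ≥0)) :
    MeasurableSet {w | ∀ a, ∃ s, a < levelPath (1 + lam) nu f w s} := by
  have : {w | ∀ a, ∃ s, a < levelPath (1 + lam) nu f w s} =
      ⋂ k : ℕ, {w | ∀ s, levelPath (1 + lam) nu f w s ≤ k}ᶜ := by
    ext w
    rw [mem_iInter]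
    refine forall_exists_lt_iff.trans (forall_congr' fun k => ?_)
    show _ ↔ ¬ ∀ s, levelPath (1 + lam) nu f w s ≤ k
    push Not
    rfl
  rw [this]
  exact MeasurableSet.iInter fun k => (measurableSet_forall_levelPath _ _ _ _).compl

theorem measurable_clockPath (lam nu : ℝ) (f : C(ℝ≥0, ℝ≥0)) (t : Icc (0 : ℝ) T) :
    Measurable fun w => clockPath hg hm lam nu f w t := by
  classical
  have h1 : (fun w => clockPath hg hm lam nu f w t) = fun w =>
      if w ∈ {w | ∀ a, ∃ s, a < levelPath (1 + lam) nu f w s} then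
        (hittingClock lam nu f (g t) w : ℝ) else 0 := by
    ext w
    by_cases h : ∀ a, ∃ s, a < levelPath (1 + lam) nu f w s
    · rw [if_pos (show w ∈ {w | ∀ a, ∃ s, a < levelPath (1 + lam) nu f w s} from h)]
      exact congrArg NNReal.toReal (clockPath_val hg hm h t)
    · rw [if_neg (show ¬ w ∈ {w | ∀ a, ∃ s, a < levelPath (1 + lam) nu f w s} from h), clockPath,
        dif_neg h]
      rfl
  rw [h1]
  exact Measurable.ite (measurableSet_forall_exists_lt lam nu f)
    (measurable_hittingClock lam nu f (g t)).coe_nnreal_real measurable_const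

/-- By continuity the level path equals `g t` at its passage time. Solving for the driving path
gives the base `X* - G₀` of the limit. -/
theorem drivingPath_clockPath {lam nu : ℝ} {f : C(ℝ≥0, ℝ≥0)} {w : C(ℝ≥0, ℝ)}
    (h : ∀ a, ∃ s, a < levelPath (1 + lam) nu f w s) (hf0 : f 0 = 0) (hw : w 0 = 0)
    (t : Icc (0 : ℝ) T) (ht : 0 ≤ g t) :
    drivingPath lam nu f w ((clockPath hg hm lam nu f w).val t) =
      clockPath hg hm lam nu f w t - g t := by
  have h1 : levelPath (1 + lam) nu f w (hittingClock lam nu f (g t) w) = g t :=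
    apply_passage (continuous_levelPath _ _ _ _) (by simpa [levelPath, hf0, hw] using ht) (h _)
  have h2 : clockPath hg hm lam nu f w t = (hittingClock lam nu f (g t) w : ℝ) :=
    congrArg NNReal.toReal (clockPath_val hg hm h t)
  rw [h2, clockPath_val hg hm h]
  show nu * w (f _) - lam * _ = _
  rw [levelPath] at h1
  linarith

end Clock

/-! ### Decorations at continuity times -/

namespace TimeChangedPath

variable {T : ℝ}

theorem decoration_of_left_eq (φ : C(ℝ≥0, ℝ)) {τ : IncPath T} {t : Icc (0 : ℝ) T}
    (h : τ.left t = τ t) : decoration φ τ t = {φ (τ.val t)} := by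
  have : {s : ℝ≥0 | τ.left t ≤ s ∧ (s : ℝ) ≤ τ t} = {τ.val t} := by
    ext s
    rw [h]
    refine ⟨fun hs => NNReal.coe_injective (le_antisymm hs.2 hs.1), ?_⟩
    rintro rfl
    exact ⟨le_rfl, le_rfl⟩
  rw [decoration, this, image_singleton]

/-- Without jumps of `τ` every decoration is a singleton, so the embedded path is a value of the map
`decorate` to which continuous mapping applies. -/
theorem toDecorated_compose (φ : C(ℝ≥0, ℝ)) {τ : IncPath T} (h : Continuous τ.toFun) :
    (compose φ τ).toDecorated = decorate (φ, τ) := by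
  have hl : ∀ t, τ.left t = τ t := fun t => by
    rcases IncPath.nhdsLT_eq_bot_or t with h1 | h1
    · exact leftLim_eq_of_tendsto h.continuousWithinAt
    · refine CadlagPath.left_of_eq_bot _ ?_
      have : Iio t = ∅ := by
        ext s
        simpa using h1 s
      rw [this, nhdsWithin_empty]
  have hd : (compose φ τ).toDecorated.dec = (decorate (φ, τ)).dec := by
    ext1 t
    show {(compose φ τ).left t, compose φ τ t} = decoration φ τ t
    rw [decoration_of_left_eq φ (hl t), compose_left, compose_apply, hl t]
    have : (τ t).toNNReal = τ.val t := Real.toNNReal_of_nonneg (τ.nonneg t)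
    rw [this, pair_eq_singleton]
  have hb : (compose φ τ).toDecorated.base = (decorate (φ, τ)).base := rfl
  revert hd hb
  generalize (compose φ τ).toDecorated = p
  generalize decorate (φ, τ) = q
  intro hd hb
  cases p
  cases q
  subst hd hb
  rfl

end TimeChangedPath

theorem couplingFilter_le_of_ae_eq {Ω : ℕ → Type*} [mΩ : ∀ n, MeasurableSpace (Ω n)]
    {P : ∀ n, Measure (Ω n)} {E : Type*} {A B B' : ∀ n, Ω n → E}
    (h : ∀ n, B n =ᵐ[P n] B' n) : couplingFilter P A B' ≤ couplingFilter P A B := by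
  intro V hV
  refine (mem_couplingFilter.1 hV).congr fun n => measure_congr ?_
  filter_upwards [h n] with ω hω
  exact congrArg (fun b => ¬ (A n ω, b) ∈ V) hω

/-- A dense sequence of times which starts with the two end points. -/
def gridTimes {T : ℝ} (hT : 0 ≤ T) : ℕ → Icc (0 : ℝ) T
  | 0 => ⟨0, le_rfl, hT⟩
  | 1 => ⟨T, hT, le_rfl⟩
  | n + 2 => haveI : Nonempty (Icc (0 : ℝ) T) := ⟨⟨0, le_rfl, hT⟩⟩
    TopologicalSpace.denseSeq (Icc (0 : ℝ) T) n

theorem denseRange_gridTimes {T : ℝ} (hT : 0 ≤ T) : DenseRange (gridTimes hT) := by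
  have : Nonempty (Icc (0 : ℝ) T) := ⟨⟨0, le_rfl, hT⟩⟩
  refine (TopologicalSpace.denseRange_denseSeq (Icc (0 : ℝ) T)).mono ?_
  rintro _ ⟨n, rfl⟩
  exact ⟨n + 2, rfl⟩

end VolterraClock

end

/-! ### The main theorem -/

open VolterraClock

theorem mainTheorem4
    {T : ℝ} (hT : 0 < T)
    -- the weak solutions `(Wⁿ, Xⁿ)` and their inputs
    {Ω : ℕ → Type*} [mΩ : ∀ n, MeasurableSpace (Ω n)]
    (P : ∀ n, Measure (Ω n)) [∀ n, IsProbabilityMeasure (P n)]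
    (𝒢 : ∀ n, Filtration ℝ≥0 (mΩ n))
    (W : ∀ n, Ω n → C(ℝ≥0, ℝ)) (X : ∀ n, Ω n → VolterraClock.IncPath T)
    (G : ℕ → ℝ → ℝ) (K : ℕ → ℝ → ℝ) (f : ℕ → C(ℝ≥0, ℝ≥0)) (lam nu : ℕ → ℝ)
    (hsol : ∀ n, VolterraClock.IsWeakSolution (P n) (𝒢 n) (W n) (X n)
      (G n) (K n) (f n) (lam n) (nu n))
    (hlam : ∀ n, 0 ≤ lam n) (hnu : ∀ n, 0 ≤ nu n)
    (hf : ∀ n, VolterraClock.IsClockFunction (f n))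
    (hK_int : ∀ n, LocallyIntegrableOn (K n) (Ici 0))
    (hK_nonneg : ∀ n t, 0 < t → 0 ≤ K n t)
    (hG_mono : ∀ n, MonotoneOn (G n) (Ici 0)) (hG_zero : ∀ n, G n 0 = 0)
    -- convergence of the inputs
    (hK : ∀ φ : ℝ → ℝ, ContinuousOn φ (Icc 0 T) →
      Tendsto (fun n => ∫ t in (0 : ℝ)..T, φ t * K n t) atTop (𝓝 (φ 0)))
    (G₀ : ℝ → ℝ) (hG₀ : ContinuousOn G₀ (Icc 0 T))
    (hG : ∀ t ∈ Icc 0 T, Tendsto (fun n => G n t) atTop (𝓝 (G₀ t)))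
    (f₀ : C(ℝ≥0, ℝ≥0)) (hf_lim : TendstoLocallyUniformly (fun n x => f n x) f₀ atTop)
    (hf_growth : ∃ C : ℝ, ∀ n (x : ℝ≥0), (f n x : ℝ) / (1 + (x : ℝ) ^ 2) ≤ C)
    (lam₀ nu₀ : ℝ) (hlam_lim : Tendsto lam atTop (𝓝 lam₀)) (hnu_lim : Tendsto nu atTop (𝓝 nu₀))
    -- the limiting Brownian motion `W*`, on any probability space
    {Ω' : Type*} [MeasurableSpace Ω'] (P' : Measure Ω') [IsProbabilityMeasure P']
    (W' : Ω' → C(ℝ≥0, ℝ)) (hW' : IsBrownianReal (fun t ω => W' ω t) P') :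
    ∃ (X' : Ω' → VolterraClock.IncPath T) (Y' : Ω' → VolterraClock.DecoratedPath T),
      -- `X*_t = inf {s ≥ 0 : (1 + λ) s - ν W*_{f(s)} > G₀(t)}`
      (∀ᵐ ω ∂P', ∀ t : Icc (0 : ℝ) T,
        IsGLB {s : ℝ≥0 | G₀ t < (1 + lam₀) * s - nu₀ * W' ω (f₀ s)} ((X' ω).val t)) ∧
      -- `(Fⁿ, Xⁿ) ⇒ (F*, X*)` on `D°[0,T]`
      TendstoInDistribution
        (fun n ω => VolterraClock.TimeChangedPath.mk
          (VolterraClock.drivingPath (lam n) (nu n) (f n) (W n ω)) (X n ω))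
        atTop
        (fun ω => VolterraClock.TimeChangedPath.mk
          (VolterraClock.drivingPath lam₀ nu₀ f₀ (W' ω)) (X' ω)) P P' ∧
      -- `Y'` has base path `X* - G₀` and decorations `I*`
      (∀ᵐ ω ∂P', ∀ t : Icc (0 : ℝ) T,
        (Y' ω).base t = X' ω t - G₀ t ∧
        (t ∈ (X' ω).jumpTimes → (Y' ω).dec t =
          VolterraClock.drivingPath lam₀ nu₀ f₀ (W' ω) ''
            {s : ℝ≥0 | (X' ω).left t ≤ s ∧ (s : ℝ) ≤ X' ω t}) ∧
        (t ∉ (X' ω).jumpTimes → (Y' ω).dec t = {X' ω t - G₀ t})) ∧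
      -- `Υⁿ = Fⁿ ∘ Xⁿ ⇒ (X* - G₀, I*)` on `𝔇[0,T]`
      TendstoInDistribution
        (fun n ω => (VolterraClock.TimeChangedPath.compose
          (VolterraClock.drivingPath (lam n) (nu n) (f n) (W n ω)) (X n ω)).toDecorated)
        atTop Y' P P' := by
  have hWm := aemeasurable_path hW'.aemeasurable
  -- The Wiener measure on the path space; by uniqueness it is the law of every `W n`.
  set μ := P'.map W' with hμ
  have : IsProbabilityMeasure μ := Measure.isProbabilityMeasure_map hWm
  have h : IsConvergentScheme P 𝒢 W X G K f lam nu G₀ f₀ lam₀ nu₀ μ :=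
    { pos := hT
      sol := hsol
      lam_nonneg := hlam
      clock_zero := fun n => (hf n).map_zero
      kernel_int := hK_int
      kernel_nonneg := hK_nonneg
      input_mono := hG_mono
      input_zero := hG_zero
      kernel_tendsto := hK
      continuousOn_limit := hG₀
      input_tendsto := hG
      clock_tendsto := hf_lim
      lam_tendsto := hlam_lim
      nu_tendsto := hnu_lim
      clock_mono := fun n => (hf n).mono
      clock_growth := by
        obtain ⟨C, hC⟩ := hf_growth
        exact ⟨C, fun n x => (div_le_iff₀ (by positivity)).1 (hC n x)⟩
      law_eq := fun n => brownian_map_eq (hsol n).brownian.isBrownian hW'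
      brownian := isBrownianReal_map hW' }
  have hg : Continuous fun t : Icc (0 : ℝ) T => G₀ t := continuousOn_iff_continuous_domRestrict.1 hG₀
  have hm : Monotone fun t : Icc (0 : ℝ) T => G₀ t := fun s t hst =>
    h.input_limit_mono s.2 t.2 hst
  have hgood : ∀ᵐ w ∂μ, ∀ a, ∃ s, a < levelPath (1 + lam₀) nu₀ f₀ w s := by
    filter_upwards [ae_all_iff.2 fun k : ℕ => h.ae_exists_lt k (Nat.cast_nonneg k)] with w hw
    exact forall_exists_lt_iff.2 hw
  have hgood' := ae_of_ae_map hWm hgood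
  -- The limit as a measurable functional of the Brownian path alone: `Φ (W n)` lives on the same
  -- space as `X n` and has the law of `Φ (W')`.
  set Φ : C(ℝ≥0, ℝ) → EvalPath (gridTimes hT.le) := fun w =>
    EvalPath.mk (gridTimes hT.le) (drivingPath lam₀ nu₀ f₀ w) (clockPath hg hm lam₀ nu₀ f₀ w) with hΦ
  have hΦm : Measurable Φ := EvalPath.measurable_mk (continuous_drivingPath lam₀ nu₀ f₀).measurable
    (measurable_clockPath hg hm lam₀ nu₀ f₀)
  have hWn : ∀ n, Measurable (W n) := fun n => (hsol n).measurable_path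
  have hconv : TendstoInDistribution (fun n ω => EvalPath.mk (gridTimes hT.le)
      (drivingPath (lam n) (nu n) (f n) (W n ω)) (X n ω)) atTop (fun ω => Φ (W' ω)) P P' := by
    refine tendstoInDistribution_of_coupling (B := fun n ω => Φ (W n ω))
      (fun n => EvalPath.measurable_mk ((continuous_drivingPath _ _ _).measurable.comp (hWn n))
        (hsol n).measurable) (fun n => hΦm.comp (hWn n)) (hΦm.comp_aemeasurable hWm)
      (fun n => ?_) (couplingFilter_evalPath_le (couplingFilter_drivingPath_le hWn h.law_eq hf_lim
        hlam_lim hnu_lim) fun i => (couplingFilter_le_of_ae_eq fun n => ?_).trans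
        (h.couplingFilter_sol_le (gridTimes hT.le i)))
    · have h1 : (P n).map (fun ω => Φ (W n ω)) = μ.map Φ := by
        rw [← h.law_eq n, Measure.map_map hΦm (hWn n)]
        rfl
      have h2 : P'.map (fun ω => Φ (W' ω)) = μ.map Φ := by
        rw [hμ, AEMeasurable.map_map_of_aemeasurable hΦm.aemeasurable hWm]
        rfl
      rw [h1, h2]
    · filter_upwards [h.ae_path hgood n] with ω hω
      exact (congrArg NNReal.toReal (clockPath_val hg hm hω _)).symm
  have h0 : ∀ s, gridTimes hT.le 0 ≤ s := fun s => s.2.1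
  have h1 : ∀ s, s ≤ gridTimes hT.le 1 := fun s => s.2.2
  refine ⟨fun ω => clockPath hg hm lam₀ nu₀ f₀ (W' ω),
    fun ω => TimeChangedPath.decorate (drivingPath lam₀ nu₀ f₀ (W' ω),
      clockPath hg hm lam₀ nu₀ f₀ (W' ω)), ?_,
    hconv.continuous_comp (EvalPath.continuous_toTimeChangedPath (denseRange_gridTimes hT.le) h0 h1),
    ?_, TendstoInDistribution.congr (fun n => ?_) (ae_eq_refl _)
      (hconv.continuous_comp (EvalPath.continuous_decorate (denseRange_gridTimes hT.le) h0 h1))⟩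
  · filter_upwards [hgood'] with ω hω t
    rw [clockPath_val hg hm hω]
    exact isGLB_passage (hω _)
  · filter_upwards [hgood', hW'.eval_zero_ae_eq_zero] with ω hω hω0 t
    have hF := drivingPath_clockPath hg hm hω h.clock_limit_zero hω0 t (h.input_limit_nonneg t.2)
    refine ⟨(TimeChangedPath.compose_apply _ _ _).trans hF, fun _ => rfl, fun ht => ?_⟩
    refine (TimeChangedPath.decoration_of_left_eq _ (not_not.1 ht).symm).trans ?_
    rw [hF]
  · filter_upwards [(hsol n).continuous] with ω hω
    exact (TimeChangedPath.toDecorated_compose _ hω).symm
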